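/- Fix $0<\alpha<1$ and put $\beta=1/\alpha$. For a positive integer $n$, a restricted $\alpha$-partition of $n$ is a finite set $\{a_1<\dots<a_\ell\}$ of positive integers with $n=\lfloor a_1^\alpha\rfloor+\dots+\lfloor a_\ell^\alpha\rfloor$; let $\varpi_n$ be the number $\ell$ of summands of a uniformly random restricted $\alpha$-partition of $n$. For $k\ge 1$ let $g(k)=\lceil (k+1)^\beta\rceil-\lceil k^\beta\rceil$ be the number of integers $a\ge1$ with $\lfloor a^\alpha\rfloor=k$. For every $n\ge 1$ there is a unique $\eta=\eta_n>0$ with $$n=\sum_{k\ge1}\frac{k\,g(k)}{e^{\eta k}+1}.$$ Put $$\mu_n=\sum_{k\ge1}\frac{g(k)}{e^{\eta k}+1},\qquad \sigma_n^2=\sum_{k\ge1}\frac{g(k)e^{\eta k}}{(e^{\eta k}+1)^2}-\frac{\Bigl(\sum_{k\ge1}\frac{g(k)\,k\,e^{\eta k}}{(e^{\eta k}+1)^2}\Bigr)^2}{\sum_{k\ge1}\frac{g(k)\,k^2e^{\eta k}}{(e^{\eta k}+1)^2}}.$$ Then, as $n\to\infty$, $\mathbb E(\varpi_n)\sim\mu_n$,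 $\mathbb V(\varpi_n)\sim\sigma_n^2$, and $$\mathbb P\Bigl(\frac{\varpi_n-\mu_n}{\sigma_n}<x\Bigr)=\frac1{\sqrt{2\pi}}\int_{-\infty}^x e^{-t^2/2}\,dt+o(1)$$ uniformly in $x\in\mathbb R$. Moreover $\mu_n\sim c_1n^{1/(\alpha+1)}$ and $\sigma_n^2\sim c_2n^{1/(\alpha+1)}$, where, with $\mathrm{Li}_s(-1)=\sum_{m\ge1}(-1)^m/m^s$ and $A=-\beta\,\mathrm{Li}_{\beta+1}(-1)\Gamma(\beta+1)$, $$c_1=-\beta\,\mathrm{Li}_\beta(-1)\Gamma(\beta)\,A^{-\beta/(\beta+1)},\qquad c_2=\Bigl(-\beta\,\mathrm{Li}_{\beta-1}(-1)\Gamma(\beta)+\frac{(\beta\,\mathrm{Li}_\beta(-1)\Gamma(\beta+1))^2}{\beta\,\mathrm{Li}_{\beta+1}(-1)\Gamma(\beta+2)}\Bigr)A^{-\beta/(\beta+1)}.$$ Finally, with $T_n=n^{1/(6\alpha+6)}/\log n$, $$\mathbb P\Bigl(\frac{\varpi_n-\mu_n}{\sigma_n}\ge x\Bigr)\le\begin{cases}e^{-x^2/2}\bigl(1+\mathcal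 O((\log n)^{-3})\bigr)&\text{if }0\le x\le T_n,\\ e^{-T_nx/2}\bigl(1+\mathcal O((\log n)^{-3})\bigr)&\text{if }x\ge T_n,\end{cases}$$ as $n\to\infty$, where the implied constants depend only on $\alpha$ (in particular not on $x$), and the same bounds hold for $\mathbb P\bigl(\frac{\varpi_n-\mu_n}{\sigma_n}\le -x\bigr)$. -/

import Mathlib

open MeasureTheory ProbabilityTheory Filter Topology Asymptotics

namespace AlphaPartition

/-- The restricted `α`-partitions of `n`: finite sets `{a₁ < ⋯ < a_ℓ}` of positive integers
with `⌊a₁ ^ α⌋ + ⋯ + ⌊a_ℓ ^ α⌋ = n`. -/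
def partitions (α : ℝ) (n : ℕ) : Set (Finset ℕ) :=
  {S | (∀ a ∈ S, 1 ≤ a) ∧ ∑ a ∈ S, ⌊(a : ℝ) ^ α⌋₊ = n}

/-- The uniform probability measure on the restricted `α`-partitions of `n`. -/
noncomputable def unif (α : ℝ) (n : ℕ) : Measure (Finset ℕ) :=
  uniformOn (partitions α n)

/-- The number of summands of a partition, as a real random variable. -/
def numSummands (S : Finset ℕ) : ℝ := (S.card : ℝ)

/-- `g(k) = ⌈(k+1)^β⌉ - ⌈k^β⌉` with `β = 1/α`: the number of integers `a ≥ 1`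
with `⌊a ^ α⌋ = k` (for `k ≥ 1`). -/
noncomputable def g (α : ℝ) (k : ℕ) : ℝ :=
  (⌈((k : ℝ) + 1) ^ (1 / α)⌉ : ℝ) - (⌈(k : ℝ) ^ (1 / α)⌉ : ℝ)

/-- `η` is a positive solution of the saddle-point equation
`n = ∑_{k ≥ 1} k g(k) / (e^{η k} + 1)`. -/
def IsSaddlePoint (α : ℝ) (n : ℕ) (η : ℝ) : Prop :=
  0 < η ∧ HasSum (fun k : ℕ+ => (k : ℝ) * g α k / (Real.exp (η * k) + 1)) (n : ℝ)

/-- `∑_{k ≥ 1} g(k) / (e^{η k} + 1)`. -/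
noncomputable def mu (α η : ℝ) : ℝ :=
  ∑' k : ℕ+, g α k / (Real.exp (η * k) + 1)

/-- `∑_{k ≥ 1} g(k) k^j e^{η k} / (e^{η k} + 1)^2`. -/
noncomputable def momentSum (α η : ℝ) (j : ℕ) : ℝ :=
  ∑' k : ℕ+, g α k * (k : ℝ) ^ j * Real.exp (η * k) / (Real.exp (η * k) + 1) ^ 2

/-- The variance `σ²` as a function of the saddle point `η`. -/
noncomputable def sigmaSq (α η : ℝ) : ℝ :=
  momentSum α η 0 - momentSum α η 1 ^ 2 / momentSum α η 2

/-- The polylogarithm `Li_s(z) = ∑_{m ≥ 1} z^m / m^s` for real `s` and `z`, as the limit of the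
partial sums (the series converges only conditionally for `z = -1` and `0 < s ≤ 1`). -/
noncomputable def polylog (s z : ℝ) : ℝ :=
  limUnder atTop (fun N : ℕ => ∑ m ∈ Finset.range N, z ^ (m + 1) / ((m : ℝ) + 1) ^ s)

/-- `-β Li_{β+1}(-1) Γ(β+1)`. -/
noncomputable def constA (β : ℝ) : ℝ :=
  -β * polylog (β + 1) (-1) * Real.Gamma (β + 1)

/-- The constant in the asymptotics of the mean, in terms of `β = 1/α`. -/
noncomputable def c₁ (β : ℝ) : ℝ :=
  -β * polylog β (-1) * Real.Gamma β * constA β ^ (-(β / (β + 1)))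

/-- The constant in the asymptotics of the variance, in terms of `β = 1/α`. -/
noncomputable def c₂ (β : ℝ) : ℝ :=
  (-β * polylog (β - 1) (-1) * Real.Gamma β
    + (β * polylog β (-1) * Real.Gamma (β + 1)) ^ 2
      / (β * polylog (β + 1) (-1) * Real.Gamma (β + 2)))
    * constA β ^ (-(β / (β + 1)))

/-- The distribution function of the standard normal distribution. -/
noncomputable def Φ (x : ℝ) : ℝ :=
  1 / √(2 * Real.pi) * ∫ t in Set.Iic x, Real.exp (-t ^ 2 / 2)

/-! Sanity facts: the measure above is a probability measure, `g` counts what it should, and the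
series defining the polylogarithm converges at `z = -1`. -/

theorem floor_eq_iff {α : ℝ} (hα : 0 < α) {k : ℕ} (hk : 1 ≤ k) (a : ℕ) :
    ⌊(a : ℝ) ^ α⌋₊ = k ↔ ⌈(k : ℝ) ^ (1 / α)⌉₊ ≤ a ∧ a < ⌈((k : ℝ) + 1) ^ (1 / α)⌉₊ := by
  have ha : (0 : ℝ) ≤ a := a.cast_nonneg
  rw [Nat.floor_eq_iff' (by omega), Nat.ceil_le, Nat.lt_ceil, one_div,
    Real.rpow_inv_le_iff_of_pos (by positivity) ha hα,
    Real.lt_rpow_inv_iff_of_pos ha (by positivity) hα]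

theorem g_eq_ncard {α : ℝ} (hα : 0 < α) {k : ℕ} (hk : 1 ≤ k) :
    g α k = ({a : ℕ | 1 ≤ a ∧ ⌊(a : ℝ) ^ α⌋₊ = k}.ncard : ℝ) := by
  have h1 : (1 : ℝ) ≤ (k : ℝ) ^ (1 / α) :=
    Real.one_le_rpow (by exact_mod_cast hk) (by positivity)
  have hle : ⌈(k : ℝ) ^ (1 / α)⌉₊ ≤ ⌈((k : ℝ) + 1) ^ (1 / α)⌉₊ :=
    Nat.ceil_mono (Real.rpow_le_rpow (by positivity) (by linarith) (by positivity))
  have hset : {a : ℕ | 1 ≤ a ∧ ⌊(a : ℝ) ^ α⌋₊ = k}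
      = ((Finset.Ico ⌈(k : ℝ) ^ (1 / α)⌉₊ ⌈((k : ℝ) + 1) ^ (1 / α)⌉₊ : Finset ℕ) : Set ℕ) := by
    ext a
    simp only [Set.mem_ofPred_eq, Finset.coe_Ico, Set.mem_Ico, floor_eq_iff hα hk]
    refine ⟨fun h => h.2, fun h => ⟨?_, h⟩⟩
    exact le_trans (Nat.one_le_iff_ne_zero.2 (Nat.ceil_pos.2 (by linarith)).ne') h.1
  rw [hset, Set.ncard_coe_finset, Nat.card_Ico, Nat.cast_sub hle, g,
    ← natCast_ceil_eq_intCast_ceil (by positivity),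
    ← natCast_ceil_eq_intCast_ceil (by positivity)]

theorem partitions_finite {α : ℝ} (hα : 0 < α) (n : ℕ) : (partitions α n).Finite := by
  refine Set.Finite.subset
    (Finset.finite_toSet (Finset.range ⌈((n : ℝ) + 1) ^ (1 / α)⌉₊).powerset) ?_
  rintro S ⟨h1, hS⟩
  simp only [Finset.mem_coe, Finset.mem_powerset]
  intro a ha
  have hle : ⌊(a : ℝ) ^ α⌋₊ ≤ n :=
    hS ▸ Finset.single_le_sum (f := fun a : ℕ => ⌊(a : ℝ) ^ α⌋₊) (fun _ _ => Nat.zero_le _) ha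
  have hpos : 1 ≤ ⌊(a : ℝ) ^ α⌋₊ :=
    Nat.one_le_floor_iff _ |>.2 (Real.one_le_rpow (by exact_mod_cast h1 a ha) hα.le)
  have h := ((floor_eq_iff hα hpos a).1 rfl).2
  refine Finset.mem_range.2 (lt_of_lt_of_le h (Nat.ceil_mono ?_))
  exact Real.rpow_le_rpow (by positivity) (by gcongr) (by positivity)

theorem partitions_nonempty {α : ℝ} (hα : 0 < α) (hα1 : α ≤ 1) {n : ℕ} (hn : 1 ≤ n) :
    (partitions α n).Nonempty := by
  have h1 : (1 : ℝ) ≤ (n : ℝ) ^ (1 / α) :=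
    Real.one_le_rpow (by exact_mod_cast hn) (by positivity)
  have hβ : 1 ≤ 1 / α := by rw [le_div_iff₀ hα]; linarith
  have h2 : (n : ℝ) ^ (1 / α) + 1 ≤ ((n : ℝ) + 1) ^ (1 / α) := by
    have := Real.add_rpow_le_rpow_add (a := (n : ℝ)) (b := 1) (by positivity) zero_le_one hβ
    simpa using this
  have h3 : ⌊((⌈(n : ℝ) ^ (1 / α)⌉₊ : ℕ) : ℝ) ^ α⌋₊ = n := by
    rw [floor_eq_iff hα hn]
    refine ⟨le_rfl, Nat.lt_ceil.2 (lt_of_lt_of_le ?_ h2)⟩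
    exact Nat.ceil_lt_add_one (by positivity)
  refine ⟨{⌈(n : ℝ) ^ (1 / α)⌉₊}, ?_, ?_⟩
  · intro a ha
    rw [Finset.mem_singleton.1 ha]
    exact Nat.one_le_iff_ne_zero.2 (Nat.ceil_pos.2 (by linarith)).ne'
  · rw [Finset.sum_singleton, h3]

theorem isProbabilityMeasure_unif {α : ℝ} (hα : 0 < α) (hα1 : α ≤ 1) {n : ℕ} (hn : 1 ≤ n) :
    IsProbabilityMeasure (unif α n) :=
  isProbabilityMeasure_uniformOn (partitions_finite hα n) (partitions_nonempty hα hα1 hn)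

theorem tendsto_polylog_neg_one {s : ℝ} (hs : 0 < s) :
    Tendsto (fun N : ℕ => ∑ m ∈ Finset.range N, (-1 : ℝ) ^ (m + 1) / ((m : ℝ) + 1) ^ s) atTop
      (𝓝 (polylog s (-1))) := by
  have hanti : Antitone fun m : ℕ => ((m : ℝ) + 1) ^ (-s) := by
    intro a b hab
    have : (a : ℝ) ≤ b := by exact_mod_cast hab
    exact Real.rpow_le_rpow_of_nonpos (by positivity) (by linarith) (by linarith)
  have h0 : Tendsto (fun m : ℕ => ((m : ℝ) + 1) ^ (-s)) atTop (𝓝 0) :=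
    (tendsto_rpow_neg_atTop hs).comp
      (tendsto_atTop_add_const_right _ _ tendsto_natCast_atTop_atTop)
  obtain ⟨l, hl⟩ := hanti.tendsto_alternating_series_of_tendsto_zero h0
  refine tendsto_nhds_limUnder ⟨-l, ?_⟩
  convert hl.neg using 2 with N
  rw [← Finset.sum_neg_distrib]
  refine Finset.sum_congr rfl fun m _ => ?_
  rw [Real.rpow_neg (by positivity), pow_succ]
  ring

end AlphaPartition

/-! Select every positive integer independently, one with part k being taken with probability
1/(e^{ηk}+1). Conditioned on total size n, the selected set is uniform among the restricted
partitions of n, and the saddle-point equation says that n is the mean size. The law of the number ℓ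
of summands is read off from E e^{sℓ} by exponential tilting: for real s, use odds exp(-`tiltArg`) =
exp(s - (η + s·`slope`)k) instead of exp(-ηk). In the tilted product model the probability of size
n, `tiltMass`, is `partitionSum` times explicit exponentials (`bernMass_tilt`). Hence log E e^{sℓ}
equals a cumulant sum plus a linear term plus the logarithm of a ratio of two masses
(`log_partitionSum_sub`).

The number `slope` is a regression coefficient: 1 - `slope`·k is orthogonal to k for the weights
`fermiVar`. So tilting does not move the mean size to first order in s (`abs_tiltMean_sub_le`), and
the quadratic coefficient of the cumulant sum is the residual variance σ²
(`abs_tiltCumulant_sub_le`). Write V = `vol` = η^{-1/α}. The size has standard deviation of order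
V^{1/2}/η, while its mean moves by O(s²V/η), which is negligible when |s| ≤ V^{-5/16}. A
quantitative local limit theorem (`abs_bernMass_sub_le`), obtained by Fourier inversion with a
Gaussian approximation near 0 and the decay `minor_arc` elsewhere, shows that the masses for s and
for 0 have ratio 1 + O(V^{-1/4}). This gives `exists_log_mgf_bound`: log E e^{sℓ} = sμ + s²σ²/2 +
O(|s|³V + V^{-1/4}).

After normalisation the moment generating functions tend to e^{t²/2}. That yields the asymptotic
mean and variance, weak convergence to the normal law and, by Pólya's argument, uniform convergence
of the distribution functions. For |t| ≤ T_n the error is O((log n)^{-3}), and Chernoff's inequality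
at t = min(x, T_n) gives both tail bounds. The constants come from Riemann sums
(`tendsto_rpow_mul_tsum_part`), whose limiting integrals are Mellin transforms of the Fermi function
and evaluate to Γ times Li at -1. -/

namespace AlphaPartition

/-! ### Sums over parts and their Riemann-sum asymptotics. -/

/-- The part `⌊(a + 1) ^ α⌋` contributed by the positive integer `a + 1`. -/
noncomputable def part (α : ℝ) (a : ℕ) : ℕ := ⌊((a : ℝ) + 1) ^ α⌋₊

lemma one_le_part {α : ℝ} (hα : 0 < α) (a : ℕ) : 1 ≤ part α a :=
  Nat.one_le_floor_iff _ |>.2 (Real.one_le_rpow (by simp) hα.le)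

lemma part_le (α : ℝ) (a : ℕ) : (part α a : ℝ) ≤ ((a : ℝ) + 1) ^ α :=
  Nat.floor_le (by positivity)

lemma rpow_lt_part_add_one (α : ℝ) (a : ℕ) : ((a : ℝ) + 1) ^ α < part α a + 1 :=
  Nat.lt_floor_add_one _

lemma card_part_fiber {α : ℝ} (hα : 0 < α) {k : ℕ} (hk : 1 ≤ k) :
    ({a : ℕ | part α a = k}.ncard : ℝ) = g α k := by
  rw [g_eq_ncard hα hk]
  congr 1
  rw [← Set.ncard_image_of_injective _ (add_left_injective 1)]
  congr 1
  ext a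
  constructor
  · rintro ⟨b, hb, rfl⟩
    refine ⟨by simp, ?_⟩
    simpa [part] using hb
  · rintro ⟨h1, h2⟩
    refine ⟨a - 1, ?_, by simp; omega⟩
    simp only [Set.mem_ofPred_eq, part]
    rw [← h2]
    congr 2
    rw [Nat.cast_sub h1]; simp

lemma finite_part_fiber {α : ℝ} (hα : 0 < α) (k : ℕ) : {a : ℕ | part α a = k}.Finite := by
  refine (Set.finite_Iio ⌈((k : ℝ) + 1) ^ (1 / α)⌉₊).subset fun a ha => ?_
  have h1 := rpow_lt_part_add_one α a
  rw [show part α a = k from ha] at h1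
  rw [Set.mem_Iio, Nat.lt_ceil, one_div, Real.lt_rpow_inv_iff_of_pos (by positivity)
    (by positivity) hα]
  refine lt_of_le_of_lt ?_ h1
  gcongr
  simp

/-- Summing over all positive integers, grouped by the size of their part. -/
lemma hasSum_g_mul {α : ℝ} (hα : 0 < α) {f : ℕ → ℝ} (hf : Summable fun a => f (part α a)) :
    HasSum (fun k : ℕ+ => g α k * f k) (∑' a, f (part α a)) := by
  let K : ℕ → ℕ+ := fun a => ⟨part α a, one_le_part hα a⟩
  have h := (Equiv.sigmaFiberEquiv K).hasSum_iff.2 hf.hasSum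
  refine h.sigma fun k => ?_
  have hset : ∀ a, K a = k ↔ part α a = k := fun a => by
    rw [← PNat.coe_inj]; rfl
  have hfin : Finite {a // K a = k} := by
    have : {a | K a = k}.Finite := by
      simp only [hset]; exact finite_part_fiber hα k
    exact this
  have := Fintype.ofFinite {a // K a = k}
  have hc : (Fintype.card {a // K a = k} : ℝ) = g α k := by
    rw [← card_part_fiber hα k.pos, ← Nat.card_eq_fintype_card]
    simp only [← hset]
    rfl
  have : (fun c : {a // K a = k} => ((fun a => f (part α a)) ∘ Equiv.sigmaFiberEquiv K) ⟨k, c⟩)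
      = fun _ => f k := by
    ext c
    have := (hset c.1).1 c.2
    simp [Equiv.sigmaFiberEquiv, this]
  rw [this]
  convert hasSum_fintype (fun _ : {a // K a = k} => f k) using 1
  simp [hc]

lemma summable_exp_neg_mul_rpow {α c : ℝ} (hα : 0 < α) (hc : 0 < c) :
    Summable fun a : ℕ => Real.exp (-c * ((a : ℝ) + 1) ^ α) := by
  -- The exponent -2/α is chosen so that x = (a + 1)^α turns the comparison function into (a +
  -- 1)^{-2}.
  have h1 := (isLittleO_exp_neg_mul_rpow_atTop hc (-(2 / α))).isBigO
  have h2 : Tendsto (fun a : ℕ => ((a : ℝ) + 1) ^ α) atTop atTop :=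
    (tendsto_rpow_atTop hα).comp (tendsto_atTop_add_const_right _ _ tendsto_natCast_atTop_atTop)
  have h3 := h1.comp_tendsto h2
  refine summable_of_isBigO_nat (g := fun a : ℕ => 1 / (((a : ℝ) + 1) ^ 2)) ?_ ?_
  · have := (summable_nat_add_iff 1).2 (Real.summable_one_div_nat_pow.2 (one_lt_two))
    simpa using this
  · refine h3.congr_right fun a => ?_
    simp only [Function.comp]
    rw [← Real.rpow_mul (by positivity), mul_neg, mul_div_cancel₀ _ hα.ne',
      Real.rpow_neg (by positivity), one_div]
    norm_num

lemma exp_neg_mul_part_le {α c : ℝ} (hc : 0 < c) (a : ℕ) :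
    Real.exp (-c * part α a) ≤ Real.exp c * Real.exp (-c * ((a : ℝ) + 1) ^ α) := by
  rw [← Real.exp_add, Real.exp_le_exp]
  nlinarith [rpow_lt_part_add_one α a]

lemma summable_exp_neg_mul_part {α c : ℝ} (hα : 0 < α) (hc : 0 < c) :
    Summable fun a : ℕ => Real.exp (-c * part α a) :=
  Summable.of_nonneg_of_le (fun _ => (Real.exp_pos _).le) (fun a => exp_neg_mul_part_le hc a)
    ((summable_exp_neg_mul_rpow hα hc).mul_left _)

/-- The rate 1/4 is common to all later sums: it is what remains of e^{-x/2} after a polynomial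
factor has been absorbed. -/
lemma summable_comp_part {α η C : ℝ} (hα : 0 < α) (hη : 0 < η) {h : ℝ → ℝ}
    (hb : ∀ x, 0 ≤ x → |h x| ≤ C * Real.exp (-x / 4)) :
    Summable fun a : ℕ => h (η * part α a) := by
  refine Summable.of_norm_bounded
    ((summable_exp_neg_mul_part hα (show 0 < η / 4 by positivity)).mul_left C) fun a => ?_
  refine (hb _ (by positivity)).trans_eq ?_
  congr 2; ring

/-- Turns a series over ℕ into an integral over the half-line, so that limits of Riemann sums become
cases of dominated convergence. -/
lemma map_floor_volume :
    ((volume : Measure ℝ).restrict (Set.Ioi 0)).map (fun y : ℝ => ⌊y⌋₊) = Measure.count := by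
  refine Measure.ext_of_singleton fun a => ?_
  rw [Measure.map_apply Nat.measurable_floor (measurableSet_singleton a),
    Measure.restrict_apply (Nat.measurable_floor (measurableSet_singleton a)),
    Measure.count_singleton]
  have hset : (fun y : ℝ => ⌊y⌋₊) ⁻¹' {a} ∩ Set.Ioi 0 = Set.Ico (a : ℝ) (a + 1) ∩ Set.Ioi 0 := by
    ext y
    simp only [Set.mem_inter_iff, Set.mem_preimage, Set.mem_singleton_iff, Set.mem_Ioi, Set.mem_Ico]
    exact and_congr_left fun h => Nat.floor_eq_iff h.le
  rw [hset]
  refine le_antisymm ((measure_mono Set.inter_subset_left).trans (by simp)) ?_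
  refine le_trans (by simp) (measure_mono (s := Set.Ioo (a : ℝ) (a + 1)) fun y hy => ?_)
  exact ⟨⟨hy.1.le, hy.2⟩, lt_of_le_of_lt (Nat.cast_nonneg a) hy.1⟩

lemma integral_comp_floor {F : ℕ → ℝ} (hF : Summable F) :
    ∫ y in Set.Ioi (0 : ℝ), F ⌊y⌋₊ = ∑' a, F a := by
  rw [← integral_map (φ := fun y : ℝ => ⌊y⌋₊) Nat.measurable_floor.aemeasurable
    (measurable_of_countable F).aestronglyMeasurable, map_floor_volume,
    integral_countable (by rw [integrable_count_iff]; exact hF.norm)]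
  simp

/-- Riemann-sum asymptotics for sums over the parts. -/
theorem tendsto_rpow_mul_tsum_part {α C : ℝ} (hα : 0 < α) {h : ℝ → ℝ} (hc : Continuous h)
    (hb : ∀ x, 0 ≤ x → |h x| ≤ C * Real.exp (-x / 4)) :
    Tendsto (fun η => η ^ (1 / α) * ∑' a, h (η * part α a)) (𝓝[>] 0)
      (𝓝 (∫ y in Set.Ioi (0 : ℝ), h (y ^ α))) := by
  have hC : 0 ≤ C := by simpa using (abs_nonneg _).trans (hb 0 le_rfl)
  have hev : ∀ᶠ η : ℝ in 𝓝[>] 0, 0 < η ∧ η ≤ 1 :=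
    Ioc_mem_nhdsGT zero_lt_one
  -- Rescaling by w = η^{1/α} is natural because w^α = η: the prefactor is the Jacobian.
  have key : ∀ η : ℝ, 0 < η → η ^ (1 / α) * ∑' a, h (η * part α a)
      = ∫ y in Set.Ioi (0 : ℝ), h (η * part α ⌊(η ^ (1 / α))⁻¹ * y⌋₊) := by
    intro η hη
    have hw : 0 < η ^ (1 / α) := by positivity
    rw [integral_comp_mul_left_Ioi (fun y => h (η * part α ⌊y⌋₊)) 0 (inv_pos.2 hw), mul_zero,
      integral_comp_floor (F := fun a => h (η * part α a)) (summable_comp_part hα hη hb),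
      inv_inv, smul_eq_mul]
  refine Tendsto.congr' (by filter_upwards [hev] with η hη using (key η hη.1).symm) ?_
  -- The floor defining the part costs at most η, and the rounding of y/w shifts y by at most w. The
  -- lower bound gives the majorant, and both together give the pointwise limit y^α.
  have hbase : ∀ η : ℝ, 0 < η → ∀ y : ℝ, 0 < y →
      y ^ α - η ≤ η * part α ⌊(η ^ (1 / α))⁻¹ * y⌋₊ ∧
      η * part α ⌊(η ^ (1 / α))⁻¹ * y⌋₊ ≤ (y + η ^ (1 / α)) ^ α := by
    intro η hη y hy
    have hw : 0 < η ^ (1 / α) := by positivity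
    have hwα : (η ^ (1 / α)) ^ α = η := by
      rw [← Real.rpow_mul hη.le, one_div_mul_cancel hα.ne', Real.rpow_one]
    set w := η ^ (1 / α)
    have hmul : ∀ z : ℝ, 0 ≤ z → η * z ^ α = (w * z) ^ α := fun z hz => by
      rw [Real.mul_rpow hw.le hz, hwα]
    constructor
    · have h1 := (rpow_lt_part_add_one α ⌊w⁻¹ * y⌋₊).le
      have h2 : (w⁻¹ * y) ^ α ≤ ((⌊w⁻¹ * y⌋₊ : ℝ) + 1) ^ α :=
        Real.rpow_le_rpow (by positivity) (Nat.lt_floor_add_one _).le hα.le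
      have h3 := hmul (w⁻¹ * y) (by positivity)
      rw [mul_inv_cancel_left₀ hw.ne'] at h3
      nlinarith [mul_le_mul_of_nonneg_left (h2.trans h1) hη.le]
    · have h1 := part_le α ⌊w⁻¹ * y⌋₊
      have h2 : ((⌊w⁻¹ * y⌋₊ : ℝ) + 1) ^ α ≤ (w⁻¹ * y + 1) ^ α :=
        Real.rpow_le_rpow (by positivity)
          (by linarith [Nat.floor_le (show 0 ≤ w⁻¹ * y by positivity)]) hα.le
      have h3 := hmul (w⁻¹ * y + 1) (by positivity)
      rw [mul_add, mul_inv_cancel_left₀ hw.ne', mul_one] at h3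
      rw [← h3]
      exact mul_le_mul_of_nonneg_left (h1.trans h2) hη.le
  refine tendsto_integral_filter_of_dominated_convergence
    (fun y => C * Real.exp (1 / 4) * Real.exp (-(1 / 4) * y ^ α)) ?_ ?_ ?_ ?_
  · filter_upwards with η
    refine Measurable.aestronglyMeasurable ?_
    exact (measurable_of_countable fun a : ℕ => h (η * part α a)).comp
      (Nat.measurable_floor.comp (measurable_const_mul _))
  · filter_upwards [hev] with η hη
    filter_upwards [ae_restrict_mem measurableSet_Ioi] with y hy
    refine (hb _ (mul_nonneg hη.1.le (Nat.cast_nonneg _))).trans ?_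
    rw [mul_assoc, ← Real.exp_add]
    gcongr
    have := (hbase η hη.1 y hy).1
    linarith [hη.2]
  · refine Integrable.const_mul ?_ _
    have := integrableOn_rpow_mul_exp_neg_mul_rpow (p := α) (s := 0) (b := 1 / 4)
      (by norm_num) hα (by norm_num)
    simpa [IntegrableOn] using this
  · filter_upwards [ae_restrict_mem measurableSet_Ioi] with y hy
    refine (hc.tendsto _).comp ?_
    have hy : 0 < y := hy
    have hid : Tendsto (fun η : ℝ => η) (𝓝[>] 0) (𝓝 0) := nhdsWithin_le_nhds
    refine tendsto_of_tendsto_of_tendsto_of_le_of_le' (g := fun η : ℝ => y ^ α - η)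
      (h := fun η : ℝ => (y + η ^ (1 / α)) ^ α) ?_ ?_ ?_ ?_
    · simpa using (tendsto_const_nhds (x := y ^ α)).sub hid
    · have h1 : Tendsto (fun η : ℝ => η ^ (1 / α)) (𝓝[>] 0) (𝓝 0) := by
        have := hid.rpow_const (p := 1 / α) (Or.inr (by positivity))
        rwa [Real.zero_rpow (by positivity)] at this
      have := (h1.const_add y).rpow_const (p := α) (Or.inr hα.le)
      simpa using this
    · filter_upwards [hev] with η hη using (hbase η hη.1 y hy).1
    · filter_upwards [hev] with η hη using (hbase η hη.1 y hy).2

/-! ### The Fermi function, its Mellin transforms and the limiting moments. -/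

/-- The Fermi function `1 / (e ^ x + 1)`. -/
noncomputable def fermi (x : ℝ) : ℝ := 1 / (Real.exp x + 1)

/-- The function `e ^ x / (e ^ x + 1) ^ 2`, minus the derivative of `fermi`. -/
noncomputable def fermiVar (x : ℝ) : ℝ := Real.exp x / (Real.exp x + 1) ^ 2

lemma fermi_pos (x : ℝ) : 0 < fermi x := by unfold fermi; positivity

lemma fermi_lt_one (x : ℝ) : fermi x < 1 := by
  unfold fermi
  rw [div_lt_one (by positivity)]
  linarith [Real.exp_pos x]

lemma fermiVar_pos (x : ℝ) : 0 < fermiVar x := by unfold fermiVar; positivity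

lemma fermiVar_eq (x : ℝ) : fermiVar x = fermi x * (1 - fermi x) := by
  unfold fermi fermiVar
  have := Real.exp_pos x
  field_simp
  ring

@[fun_prop]
lemma continuous_fermi : Continuous fermi := by
  unfold fermi
  exact continuous_const.div (by fun_prop) fun x => by positivity

@[fun_prop]
lemma continuous_fermiVar : Continuous fermiVar := by
  unfold fermiVar
  exact Continuous.div (by fun_prop) (by fun_prop) fun x => by positivity

lemma hasDerivAt_fermi (x : ℝ) : HasDerivAt fermi (-fermiVar x) x := by
  have h := ((Real.hasDerivAt_exp x).add_const 1).inv (by positivity)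
  have he : fermi = (fun x => Real.exp x + 1)⁻¹ := by
    ext y; simp [fermi]
  rw [he]
  exact h.congr_deriv (by simp only [fermiVar, neg_div])

lemma hasDerivAt_fermiVar (x : ℝ) :
    HasDerivAt fermiVar (fermiVar x * (2 * fermi x - 1)) x := by
  have h := (hasDerivAt_fermi x).mul ((hasDerivAt_fermi x).const_sub 1)
  have he : fermiVar = fermi * fun x => 1 - fermi x := by
    ext y; exact fermiVar_eq y
  rw [he]
  exact h.congr_deriv (by rw [← he, fermiVar_eq]; ring)

lemma fermi_le_exp_neg (x : ℝ) : fermi x ≤ Real.exp (-x) := by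
  unfold fermi
  rw [Real.exp_neg, ← one_div]
  have := Real.exp_pos x
  gcongr; linarith

lemma fermiVar_le_fermi (x : ℝ) : fermiVar x ≤ fermi x := by
  rw [fermiVar_eq]
  nlinarith [fermi_pos x, fermi_lt_one x]

lemma fermiVar_le_exp_neg (x : ℝ) : fermiVar x ≤ Real.exp (-x) :=
  (fermiVar_le_fermi x).trans (fermi_le_exp_neg x)

/-- Partial sums of the geometric series for the Fermi function. -/
lemma sum_geom_fermi (N : ℕ) (x : ℝ) :
    ∑ m ∈ Finset.range N, (-1 : ℝ) ^ m * Real.exp (-(((m : ℝ) + 1) * x))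
      = fermi x * (1 - (-Real.exp (-x)) ^ N) := by
  induction N with
  | zero => simp
  | succ N ih =>
    rw [Finset.sum_range_succ, ih]
    have h1 : Real.exp (-(((N : ℝ) + 1) * x)) = Real.exp (-x) ^ (N + 1) := by
      rw [← Real.exp_nat_mul]; congr 1; push_cast; ring
    have h2 : fermi x * (1 + Real.exp (-x)) = Real.exp (-x) := by
      rw [fermi, Real.exp_neg]
      have := Real.exp_pos x
      field_simp
    rw [h1, neg_pow, neg_pow (Real.exp (-x)) (N + 1)]
    simp only [pow_succ]
    linear_combination (-(-1) ^ N * Real.exp (-x) ^ N) * h2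

lemma integrableOn_rpow_mul_of_le {s C : ℝ} (hs : 0 < s) {f : ℝ → ℝ} (hf : Continuous f)
    (hb : ∀ x, 0 < x → |f x| ≤ C * Real.exp (-x)) :
    IntegrableOn (fun x : ℝ => x ^ (s - 1) * f x) (Set.Ioi 0) := by
  refine Integrable.mono' ((Real.GammaIntegral_convergent hs).const_mul C)
    ((Measurable.pow_const measurable_id _).mul hf.measurable).aestronglyMeasurable ?_
  filter_upwards [ae_restrict_mem measurableSet_Ioi] with x hx
  have hx : 0 < x := hx
  rw [norm_mul, Real.norm_of_nonneg (by positivity), Real.norm_eq_abs]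
  calc _ ≤ x ^ (s - 1) * (C * Real.exp (-x)) := by gcongr; exact hb x hx
    _ = _ := by ring

/-- Expand 1/(e^x+1) as the alternating geometric series in e^{-x} and integrate term by term. The
partial sums are at most 2e^{-x}, so dominated convergence applies to them for every s > 0, even for
s ≤ 1, where the resulting series converges only conditionally. -/
lemma integral_rpow_mul_fermi {s : ℝ} (hs : 0 < s) :
    ∫ x in Set.Ioi (0 : ℝ), x ^ (s - 1) * fermi x = -(Real.Gamma s * polylog s (-1)) := by
  have hexp : ∀ x : ℝ, 0 < x → Real.exp (-x) < 1 := fun x hx => by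
    rw [Real.exp_lt_one_iff]; linarith
  have h1 : Tendsto (fun N : ℕ => ∫ x in Set.Ioi (0 : ℝ), x ^ (s - 1) *
      (∑ m ∈ Finset.range N, (-1 : ℝ) ^ m * Real.exp (-(((m : ℝ) + 1) * x)))) atTop
      (𝓝 (∫ x in Set.Ioi (0 : ℝ), x ^ (s - 1) * fermi x)) := by
    refine tendsto_integral_of_dominated_convergence
      (fun x => 2 * (Real.exp (-x) * x ^ (s - 1))) ?_ ?_ ?_ ?_
    · intro N
      refine Measurable.aestronglyMeasurable ?_
      exact (Measurable.pow_const measurable_id _).mul (by fun_prop)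
    · exact (Real.GammaIntegral_convergent hs).const_mul 2
    · intro N
      filter_upwards [ae_restrict_mem measurableSet_Ioi] with x hx
      have hx : 0 < x := hx
      rw [sum_geom_fermi, norm_mul, norm_mul, Real.norm_of_nonneg (by positivity),
        Real.norm_of_nonneg (fermi_pos x).le]
      have h2 : ‖1 - (-Real.exp (-x)) ^ N‖ ≤ 2 := by
        refine (norm_sub_le _ _).trans ?_
        rw [norm_one, norm_pow, norm_neg, Real.norm_of_nonneg (Real.exp_pos _).le]
        linarith [pow_le_one₀ (n := N) (Real.exp_pos _).le (hexp x hx).le]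
      calc _ ≤ x ^ (s - 1) * (Real.exp (-x) * 2) := by
            have := fermi_le_exp_neg x
            have := (fermi_pos x).le
            gcongr
        _ = _ := by ring
    · filter_upwards [ae_restrict_mem measurableSet_Ioi] with x hx
      have hx : 0 < x := hx
      simp only [sum_geom_fermi]
      have h2 : Tendsto (fun N : ℕ => (-Real.exp (-x)) ^ N) atTop (𝓝 0) := by
        refine tendsto_pow_atTop_nhds_zero_of_abs_lt_one ?_
        rw [abs_neg, abs_of_pos (Real.exp_pos _)]
        exact hexp x hx
      simpa using ((h2.const_sub 1).const_mul (fermi x)).const_mul (x ^ (s - 1))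
  have h3 : ∀ N : ℕ, ∫ x in Set.Ioi (0 : ℝ), x ^ (s - 1) *
      (∑ m ∈ Finset.range N, (-1 : ℝ) ^ m * Real.exp (-(((m : ℝ) + 1) * x)))
      = -(Real.Gamma s * ∑ m ∈ Finset.range N, (-1 : ℝ) ^ (m + 1) / ((m : ℝ) + 1) ^ s) := by
    intro N
    have h4 : ∀ m : ℕ, ∫ x in Set.Ioi (0 : ℝ), x ^ (s - 1) * Real.exp (-(((m : ℝ) + 1) * x))
        = (1 / ((m : ℝ) + 1)) ^ s * Real.Gamma s := fun m =>
      Real.integral_rpow_mul_exp_neg_mul_Ioi hs (by positivity)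
    have h5 : ∀ m : ℕ, IntegrableOn
        (fun x : ℝ => x ^ (s - 1) * Real.exp (-(((m : ℝ) + 1) * x))) (Set.Ioi 0) := fun m => by
      refine integrableOn_rpow_mul_of_le (C := 1) hs (by fun_prop) fun x hx => ?_
      rw [abs_of_pos (Real.exp_pos _), one_mul, Real.exp_le_exp]
      nlinarith [mul_nonneg (Nat.cast_nonneg (α := ℝ) m) hx.le]
    simp only [Finset.mul_sum]
    rw [integral_finsetSum]
    · rw [← Finset.sum_neg_distrib]
      refine Finset.sum_congr rfl fun m _ => ?_
      have : ∀ x : ℝ, x ^ (s - 1) * ((-1 : ℝ) ^ m * Real.exp (-(((m : ℝ) + 1) * x)))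
        = (-1 : ℝ) ^ m * (x ^ (s - 1) * Real.exp (-(((m : ℝ) + 1) * x))) := fun x => by ring
      simp only [this]
      rw [integral_const_mul, h4, Real.div_rpow (by positivity) (by positivity), Real.one_rpow,
        pow_succ]
      ring
    · intro m _
      have := (h5 m).const_mul ((-1 : ℝ) ^ m)
      refine this.congr (Filter.Eventually.of_forall fun x => ?_)
      simp only []
      ring
  refine tendsto_nhds_unique h1 ?_
  simp only [h3]
  exact ((tendsto_polylog_neg_one hs).const_mul _).neg

/-- Integration by parts, `fermiVar` being minus the derivative of `fermi`; since s > 0 the boundary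
term at 0 vanishes. -/
lemma integral_rpow_mul_fermiVar {s : ℝ} (hs : 0 < s) :
    ∫ x in Set.Ioi (0 : ℝ), x ^ s * fermiVar x
      = -(Real.Gamma (s + 1) * polylog s (-1)) := by
  have hi1 : IntegrableOn (fun x : ℝ => x ^ s * fermiVar x) (Set.Ioi 0) := by
    have := integrableOn_rpow_mul_of_le (s := s + 1) (C := 1) (by linarith) continuous_fermiVar
      fun x _ => by
        rw [abs_of_pos (fermiVar_pos x), one_mul]; exact fermiVar_le_exp_neg x
    simpa using this
  have hi2 : IntegrableOn (fun x : ℝ => x ^ (s - 1) * fermi x) (Set.Ioi 0) :=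
    integrableOn_rpow_mul_of_le (C := 1) hs continuous_fermi
      fun x _ => by
        rw [abs_of_pos (fermi_pos x), one_mul]; exact fermi_le_exp_neg x
  have h := integral_Ioi_mul_deriv_eq_deriv_mul (a := 0) (u := fun x : ℝ => x ^ s)
    (u' := fun x => s * x ^ (s - 1)) (v := fermi) (v' := fun x => -fermiVar x) (a' := 0) (b' := 0)
    (fun x hx => Real.hasDerivAt_rpow_const (Or.inl (ne_of_gt hx)))
    (fun x _ => hasDerivAt_fermi x) ?_ ?_ ?_ ?_
  · simp only [mul_neg, integral_neg, sub_self, zero_sub, neg_inj, mul_assoc] at h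
    rw [h, integral_const_mul, integral_rpow_mul_fermi hs, Real.Gamma_add_one hs.ne']
    ring
  · refine hi1.neg.congr (Filter.Eventually.of_forall fun x => ?_)
    simp
  · refine (hi2.const_mul s).congr (Filter.Eventually.of_forall fun x => ?_)
    simp [mul_assoc]
  · have h1 : Tendsto (fun x : ℝ => x ^ s * fermi x) (𝓝 0) (𝓝 (0 ^ s * fermi 0)) := by
      refine Tendsto.mul ?_ (continuous_fermi.tendsto _)
      exact tendsto_id.rpow_const (Or.inr hs.le)
    rw [Real.zero_rpow hs.ne', zero_mul] at h1
    exact h1.mono_left nhdsWithin_le_nhds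
  · refine squeeze_zero' (g := fun x : ℝ => x ^ s * Real.exp (-x)) ?_ ?_ ?_
    · filter_upwards [eventually_gt_atTop 0] with x hx
      simp only [Pi.mul_apply]
      have := fermi_pos x
      positivity
    · filter_upwards [eventually_gt_atTop 0] with x hx
      simp only [Pi.mul_apply]
      have := fermi_le_exp_neg x
      gcongr
    · have := (isLittleO_exp_neg_mul_rpow_atTop one_pos (-s)).tendsto_div_nhds_zero
      refine this.congr' ?_
      filter_upwards [eventually_gt_atTop 0] with x hx
      rw [Real.rpow_neg hx.le, div_inv_eq_mul, mul_comm]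
      simp

lemma integral_comp_rpow {α : ℝ} (hα : 0 < α) (j : ℕ) (f : ℝ → ℝ) :
    ∫ y in Set.Ioi (0 : ℝ), (y ^ α) ^ j * f (y ^ α)
      = 1 / α * ∫ x in Set.Ioi (0 : ℝ), x ^ (1 / α + j - 1) * f x := by
  have h := integral_comp_rpow_Ioi_of_pos (g := fun y : ℝ => (y ^ α) ^ j * f (y ^ α))
    (show 0 < 1 / α by positivity)
  rw [← h, ← integral_const_mul]
  refine setIntegral_congr_fun measurableSet_Ioi fun x hx => ?_
  have hx : 0 < x := hx
  simp only [smul_eq_mul]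
  rw [← Real.rpow_mul hx.le, one_div_mul_cancel hα.ne', Real.rpow_one,
    show 1 / α + j - 1 = (1 / α - 1) + j by ring, Real.rpow_add_natCast hx.ne']
  ring

/-- The limiting moment integrals `∫ (y ^ α) ^ j e ^ (y ^ α) / (e ^ (y ^ α) + 1) ^ 2 dy`. -/
noncomputable def limMoment (α : ℝ) (j : ℕ) : ℝ :=
  ∫ y in Set.Ioi (0 : ℝ), (y ^ α) ^ j * fermiVar (y ^ α)

/-- Since α < 1, the order 1/α + j - 1 is positive even for j = 0, as the Mellin formula requires.
-/
lemma limMoment_eq {α : ℝ} (hα : 0 < α) (hα1 : α < 1) (j : ℕ) :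
    limMoment α j = -(1 / α * Real.Gamma (1 / α + j) * polylog (1 / α + j - 1) (-1)) := by
  have : 1 < 1 / α := by rw [lt_div_iff₀ hα]; linarith
  have hj : (0 : ℝ) ≤ j := by positivity
  rw [limMoment, integral_comp_rpow hα, integral_rpow_mul_fermiVar (by linarith)]
  rw [show 1 / α + (j : ℝ) - 1 + 1 = 1 / α + j by ring]
  ring

lemma integral_fermi_rpow {α : ℝ} (hα : 0 < α) :
    ∫ y in Set.Ioi (0 : ℝ), fermi (y ^ α)
      = -(1 / α) * polylog (1 / α) (-1) * Real.Gamma (1 / α) := by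
  have h := integral_comp_rpow hα 0 fermi
  simp only [pow_zero, one_mul, Nat.cast_zero, add_zero] at h
  rw [h, integral_rpow_mul_fermi (by positivity)]
  ring

lemma integral_rpow_mul_fermi_rpow {α : ℝ} (hα : 0 < α) :
    ∫ y in Set.Ioi (0 : ℝ), y ^ α * fermi (y ^ α) = constA (1 / α) := by
  have h := integral_comp_rpow hα 1 fermi
  simp only [pow_one, Nat.cast_one] at h
  rw [h, integral_rpow_mul_fermi (by positivity), constA]
  ring

lemma pow_mul_exp_neg_half_le (j : ℕ) {x : ℝ} (hx : 0 ≤ x) :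
    x ^ j * Real.exp (-x / 2) ≤ (j.factorial * 4 ^ j) * Real.exp (-x / 4) := by
  have h := Real.pow_div_factorial_le_exp (x := x / 4) (by positivity) j
  rw [div_pow, div_div, div_le_iff₀ (by positivity)] at h
  calc x ^ j * Real.exp (-x / 2)
      ≤ (Real.exp (x / 4) * (4 ^ j * j.factorial)) * Real.exp (-x / 2) := by gcongr
    _ = (j.factorial * 4 ^ j) * (Real.exp (x / 4) * Real.exp (-x / 2)) := by ring
    _ = _ := by rw [← Real.exp_add]; congr 2; ring

lemma pow_mul_le_of_le_exp_neg (j : ℕ) {f : ℝ → ℝ} (h0 : ∀ x, 0 < f x)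
    (hf : ∀ x, f x ≤ Real.exp (-x)) :
    ∀ x, 0 ≤ x → |x ^ j * f x| ≤ (j.factorial * 4 ^ j) * Real.exp (-x / 4) := by
  intro x hx
  rw [abs_of_nonneg (mul_nonneg (by positivity) (h0 x).le)]
  refine le_trans ?_ (pow_mul_exp_neg_half_le j hx)
  gcongr
  exact (hf x).trans (Real.exp_le_exp.2 (by linarith))

lemma integrableOn_limMoment {α : ℝ} (hα : 0 < α) (j : ℕ) :
    IntegrableOn (fun y : ℝ => (y ^ α) ^ j * fermiVar (y ^ α)) (Set.Ioi 0) := by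
  have h := (integrableOn_rpow_mul_exp_neg_mul_rpow (p := α) (s := 0) (b := 1 / 4)
      (by norm_num) hα (by norm_num)).const_mul (j.factorial * 4 ^ j : ℝ)
  refine Integrable.mono' h ?_ ?_
  · refine Measurable.aestronglyMeasurable ?_
    have : Measurable fun y : ℝ => y ^ α := Measurable.pow_const measurable_id _
    exact (this.pow_const j).mul (continuous_fermiVar.measurable.comp this)
  · filter_upwards [ae_restrict_mem measurableSet_Ioi] with y hy
    have hy : 0 < y := hy
    rw [Real.norm_eq_abs]
    refine (pow_mul_le_of_le_exp_neg j fermiVar_pos fermiVar_le_exp_neg _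
      (by positivity)).trans_eq ?_
    rw [Real.rpow_zero, one_mul]
    congr 2; ring

lemma limMoment_pos {α : ℝ} (hα : 0 < α) (j : ℕ) : 0 < limMoment α j := by
  rw [limMoment, setIntegral_pos_iff_support_of_nonneg_ae]
  · refine lt_of_lt_of_le (b := volume (Set.Ioi (0 : ℝ))) (by simp)
      (measure_mono fun y hy => ⟨?_, hy⟩)
    have hy : 0 < y := hy
    have := fermiVar_pos (y ^ α)
    rw [Function.mem_support]
    positivity
  · filter_upwards [ae_restrict_mem measurableSet_Ioi] with y hy
    have hy : 0 < y := hy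
    have := fermiVar_pos (y ^ α)
    simp only [Pi.zero_apply]
    positivity
  · exact integrableOn_limMoment hα j

/-- Strict Cauchy–Schwarz for the limiting moments. -/
lemma limMoment_variance_pos {α : ℝ} (hα : 0 < α) :
    0 < limMoment α 0 - limMoment α 1 ^ 2 / limMoment α 2 := by
  -- This t minimises ∫ (1 - t y^α)² `fermiVar` (y^α) dy, and the minimum is the expression in
  -- question.
  set t := limMoment α 1 / limMoment α 2 with ht
  have h2 := limMoment_pos hα 2
  have h1 := limMoment_pos hα 1
  have ht0 : 0 < t := div_pos h1 h2
  have e : limMoment α 0 - limMoment α 1 ^ 2 / limMoment α 2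
      = ∫ y in Set.Ioi (0 : ℝ), (1 - t * y ^ α) ^ 2 * fermiVar (y ^ α) := by
    have e1 : ∀ y : ℝ, (1 - t * y ^ α) ^ 2 * fermiVar (y ^ α) =
        (y ^ α) ^ 0 * fermiVar (y ^ α) - 2 * t * ((y ^ α) ^ 1 * fermiVar (y ^ α))
          + t ^ 2 * ((y ^ α) ^ 2 * fermiVar (y ^ α)) := fun y => by ring
    simp only [e1]
    have i0 := integrableOn_limMoment hα 0
    have i1 := (integrableOn_limMoment hα 1).const_mul (2 * t)
    have i2 := (integrableOn_limMoment hα 2).const_mul (t ^ 2)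
    rw [integral_add (by exact i0.sub i1) i2, integral_sub i0 i1, integral_const_mul, integral_const_mul]
    change _ = limMoment α 0 - 2 * t * limMoment α 1 + t ^ 2 * limMoment α 2
    rw [ht]; field_simp; ring
  have hint : IntegrableOn (fun y : ℝ => (1 - t * y ^ α) ^ 2 * fermiVar (y ^ α)) (Set.Ioi 0) := by
    have i0 := integrableOn_limMoment hα 0
    have i1 := (integrableOn_limMoment hα 1).const_mul (2 * t)
    have i2 := (integrableOn_limMoment hα 2).const_mul (t ^ 2)
    refine ((i0.sub i1).add i2).congr (Filter.Eventually.of_forall fun y => ?_)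
    simp only [Pi.sub_apply, Pi.add_apply]
    ring
  rw [e, setIntegral_pos_iff_support_of_nonneg_ae]
  -- Beyond (2/t)^{1/α} one has t y^α > 2, so the square cannot vanish there; this half-line has
  -- infinite measure.
  · refine lt_of_lt_of_le (b := volume (Set.Ioi ((2 / t) ^ (1 / α)))) (by simp)
      (measure_mono fun y hy => ?_)
    have hy' : (2 / t) ^ (1 / α) < y := hy
    have hy0 : 0 < y := lt_of_le_of_lt (by positivity) hy'
    refine ⟨?_, hy0⟩
    rw [one_div, Real.rpow_inv_lt_iff_of_pos (by positivity) hy0.le hα, div_lt_iff₀ ht0] at hy'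
    have := fermiVar_pos (y ^ α)
    rw [Function.mem_support]
    have : (1 - t * y ^ α) ≠ 0 := by
      intro h; linarith
    positivity
  · filter_upwards with y
    have := fermiVar_pos (y ^ α)
    simp only [Pi.zero_apply]
    positivity
  · exact hint

/-! ### A local limit theorem for sums of scaled Bernoulli variables. -/

/-- The probability that `∑ k i X i = n` for independent Bernoulli variables `X i`, `i ∈ s`, with
parameters `p i`. -/
noncomputable def bernMass (s : Finset ℕ) (p : ℕ → ℝ) (k : ℕ → ℕ) (n : ℕ) : ℝ :=
  ∑ S ∈ s.powerset with ∑ i ∈ S, k i = n, (∏ i ∈ S, p i) * ∏ i ∈ s \ S, (1 - p i)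

/-- The characteristic function of a Bernoulli variable scaled by `x`. -/
noncomputable def bernChar (p x : ℝ) : ℂ := (1 - p : ℂ) + p * Complex.exp (x * Complex.I)

@[fun_prop]
lemma continuous_bernChar (p : ℝ) : Continuous (bernChar p) := by
  unfold bernChar; fun_prop

lemma integral_exp_int_mul (m : ℤ) :
    ∫ θ in (-Real.pi)..Real.pi, Complex.exp (m * θ * Complex.I)
      = if m = 0 then 2 * (Real.pi : ℂ) else 0 := by
  split_ifs with h
  · subst h
    simp
    ring
  · have hc : (m * Complex.I : ℂ) ≠ 0 := mul_ne_zero (by exact_mod_cast h) Complex.I_ne_zero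
    have := integral_exp_mul_complex (a := -Real.pi) (b := Real.pi) hc
    have e : ∀ θ : ℝ, (m * θ * Complex.I : ℂ) = m * Complex.I * θ := fun θ => by ring
    simp only [e]
    rw [this, div_eq_zero_iff]
    left
    rw [sub_eq_zero, Complex.exp_eq_exp_iff_exists_int]
    refine ⟨m, ?_⟩
    push_cast
    ring

/-- Fourier inversion: expanding the product gives one exponential per subset, and orthogonality on
[-π, π] keeps the subsets of size n. -/
lemma two_pi_mul_bernMass (s : Finset ℕ) (p : ℕ → ℝ) (k : ℕ → ℕ) (n : ℕ) :
    (2 * Real.pi * bernMass s p k n : ℂ) = ∫ θ in (-Real.pi)..Real.pi,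
      (∏ i ∈ s, bernChar (p i) (θ * k i)) * Complex.exp (-(n * θ * Complex.I)) := by
  have h1 : ∀ θ : ℝ, (∏ i ∈ s, bernChar (p i) (θ * k i)) * Complex.exp (-(n * θ * Complex.I))
      = ∑ S ∈ s.powerset, (((∏ i ∈ S, p i) * ∏ i ∈ s \ S, (1 - p i) : ℝ) : ℂ) *
        Complex.exp (((∑ i ∈ S, k i : ℕ) - n : ℤ) * θ * Complex.I) := by
    intro θ
    have h2 : ∀ i, bernChar (p i) (θ * k i)
        = p i * Complex.exp (θ * k i * Complex.I) + (1 - p i) := fun i => by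
      rw [bernChar]; push_cast; ring
    simp only [h2]
    rw [Finset.prod_add, Finset.sum_mul]
    refine Finset.sum_congr rfl fun S _ => ?_
    rw [Finset.prod_mul_distrib, ← Complex.exp_sum]
    push_cast
    rw [show (∏ i ∈ S, (p i : ℂ)) * Complex.exp (∑ i ∈ S, θ * k i * Complex.I)
        * (∏ i ∈ s \ S, (1 - (p i : ℂ))) * Complex.exp (-(n * θ * Complex.I))
      = (∏ i ∈ S, (p i : ℂ)) * (∏ i ∈ s \ S, (1 - (p i : ℂ))) *
        (Complex.exp (∑ i ∈ S, θ * k i * Complex.I) * Complex.exp (-(n * θ * Complex.I))) by ring,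
      ← Complex.exp_add]
    congr 2
    rw [sub_mul, sub_mul, ← sub_eq_add_neg, Finset.sum_mul, Finset.sum_mul]
    congr 1
    exact Finset.sum_congr rfl fun i _ => by ring
  simp only [h1]
  rw [intervalIntegral.integral_finsetSum]
  · simp only [intervalIntegral.integral_const_mul, integral_exp_int_mul]
    rw [bernMass, Finset.sum_filter]
    push_cast
    rw [Finset.mul_sum]
    refine Finset.sum_congr rfl fun S _ => ?_
    by_cases hS : ∑ i ∈ S, k i = n
    · have : (∑ i ∈ S, (k i : ℤ)) - n = 0 := by rw [← hS]; simp
      rw [if_pos hS, if_pos this]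
      push_cast
      ring
    · have : (∑ i ∈ S, (k i : ℤ)) - n ≠ 0 := fun h => hS (by
        have := sub_eq_zero.1 h
        exact_mod_cast this)
      rw [if_neg hS, if_neg this]
      simp
  · intro S _
    exact (Continuous.intervalIntegrable (by fun_prop) _ _)

/-- Replace the factors one at a time; the other factors have norm at most 1. -/
lemma norm_prod_sub_prod_le {s : Finset ℕ} {a b : ℕ → ℂ} (ha : ∀ i, ‖a i‖ ≤ 1)
    (hb : ∀ i, ‖b i‖ ≤ 1) :
    ‖∏ i ∈ s, a i - ∏ i ∈ s, b i‖ ≤ ∑ i ∈ s, ‖a i - b i‖ := by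
  induction s using Finset.induction_on with
  | empty => simp
  | insert j s hj ih =>
    rw [Finset.prod_insert hj, Finset.prod_insert hj, Finset.sum_insert hj]
    have h1 : ‖∏ i ∈ s, b i‖ ≤ 1 := by
      rw [norm_prod]
      exact Finset.prod_le_one (fun _ _ => norm_nonneg _) fun i _ => hb i
    calc ‖a j * ∏ i ∈ s, a i - b j * ∏ i ∈ s, b i‖
        = ‖a j * (∏ i ∈ s, a i - ∏ i ∈ s, b i) + (a j - b j) * ∏ i ∈ s, b i‖ := by
          congr 1; ring
      _ ≤ ‖a j‖ * ‖∏ i ∈ s, a i - ∏ i ∈ s, b i‖ + ‖a j - b j‖ * ‖∏ i ∈ s, b i‖ := by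
          rw [← norm_mul, ← norm_mul]; exact norm_add_le _ _
      _ ≤ 1 * ‖∏ i ∈ s, a i - ∏ i ∈ s, b i‖ + ‖a j - b j‖ * 1 := by
          gcongr; exact ha j
      _ ≤ _ := by linarith

lemma norm_exp_mul_I_sub_le (y : ℝ) :
    ‖Complex.exp (y * Complex.I) - (1 + y * Complex.I - y ^ 2 / 2)‖ ≤ 4 * |y| ^ 3 := by
  have hn : ‖(y * Complex.I : ℂ)‖ = |y| := by simp
  rcases le_or_gt |y| 1 with h | h
  · have := Complex.exp_bound (x := y * Complex.I) (by rwa [hn]) (n := 3) (by norm_num)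
    rw [hn] at this
    have e : ∑ m ∈ Finset.range 3, (y * Complex.I : ℂ) ^ m / m.factorial
        = 1 + y * Complex.I - y ^ 2 / 2 := by
      simp only [Finset.sum_range_succ, Finset.sum_range_zero, Nat.factorial]
      push_cast
      linear_combination ((y : ℂ) ^ 2 / 2) * Complex.I_sq
    rw [e] at this
    refine this.trans ?_
    norm_num [Nat.factorial]
    nlinarith [pow_nonneg (abs_nonneg y) 3]
  · have h1 : ‖Complex.exp (y * Complex.I)‖ = 1 := Complex.norm_exp_ofReal_mul_I y
    have h2 : ‖(y : ℂ) ^ 2 / 2‖ = |y| ^ 2 / 2 := by simp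
    calc _ ≤ ‖Complex.exp (y * Complex.I)‖ + (‖(1 : ℂ)‖ + ‖(y * Complex.I : ℂ)‖
            + ‖(y : ℂ) ^ 2 / 2‖) := by
          refine (norm_sub_le _ _).trans ?_
          gcongr
          refine (norm_sub_le _ _).trans ?_
          gcongr
          exact norm_add_le _ _
      _ = 2 + |y| + |y| ^ 2 / 2 := by rw [h1, h2, hn, norm_one]; ring
      _ ≤ 4 * |y| ^ 3 := by
          nlinarith [mul_pos (sub_pos.2 h) (sub_pos.2 h), pow_pos (lt_trans one_pos h) 2,
            mul_pos (sub_pos.2 h) (pow_pos (lt_trans one_pos h) 2)]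

/-- With u of order x², the bound u² serves |x| ≤ 1 and the bound u serves |x| > 1; both are then
dominated by |x|³. -/
lemma abs_exp_neg_sub_le {u : ℝ} (hu : 0 ≤ u) :
    |Real.exp (-u) - (1 - u)| ≤ min u (u ^ 2) := by
  have h1 := Real.add_one_le_exp (-u)
  rw [abs_of_nonneg (by linarith), le_min_iff]
  have h2 : Real.exp (-u) ≤ 1 := by rw [Real.exp_le_one_iff]; linarith
  refine ⟨by linarith, ?_⟩
  rcases le_or_gt u 1 with h | h
  · have := Real.abs_exp_sub_one_sub_id_le (x := -u) (by rw [abs_neg, abs_of_nonneg hu]; exact h)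
    have := (abs_le.1 this).2
    nlinarith
  · nlinarith

/-- The squared modulus is 1 - 2p(1-p)(1 - cos x), and 1 + y ≤ e^y. -/
lemma norm_bernChar_le (p x : ℝ) :
    ‖bernChar p x‖ ≤ Real.exp (-(p * (1 - p) * (1 - Real.cos x))) := by
  have h2 : ‖bernChar p x‖ ^ 2 = 1 - 2 * (p * (1 - p) * (1 - Real.cos x)) := by
    rw [← Complex.normSq_eq_norm_sq, Complex.normSq_apply]
    have hre : (bernChar p x).re = 1 - p + p * Real.cos x := by
      simp [bernChar, Complex.exp_ofReal_mul_I_re]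
    have him : (bernChar p x).im = p * Real.sin x := by
      simp [bernChar, Complex.exp_ofReal_mul_I_im]
    rw [hre, him]
    linear_combination p ^ 2 * Real.sin_sq_add_cos_sq x
  refine le_of_sq_le_sq ?_ (Real.exp_pos _).le
  rw [h2, ← Real.exp_nat_mul]
  have := Real.add_one_le_exp (((2 : ℕ) : ℝ) * -(p * (1 - p) * (1 - Real.cos x)))
  push_cast at this ⊢
  linarith

lemma norm_bernChar_le_one {p : ℝ} (h0 : 0 ≤ p) (h1 : p ≤ 1) (x : ℝ) : ‖bernChar p x‖ ≤ 1 := by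
  refine (norm_bernChar_le p x).trans ?_
  rw [Real.exp_le_one_iff, neg_nonpos]
  have := Real.cos_le_one x
  have : 0 ≤ 1 - p := by linarith
  have : 0 ≤ 1 - Real.cos x := by linarith
  positivity

/-- The centred variable takes the values -p and q = 1 - p with weights q and p, so both sides agree
to second order. The two Taylor remainders add up to 4pq(p² + q²)|x|³, and the Gaussian contributes
pq|x|³. Keeping the factor pq matters: the errors then sum to a moment with variance weights. -/
lemma norm_bernChar_mul_sub_le {p : ℝ} (h0 : 0 ≤ p) (h1 : p ≤ 1) (x : ℝ) :
    ‖bernChar p x * Complex.exp (-(p * x) * Complex.I)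
      - Complex.exp (-(p * (1 - p) * x ^ 2 / 2))‖ ≤ 5 * (p * (1 - p) * |x| ^ 3) := by
  have hq : 0 ≤ 1 - p := by linarith
  set q := 1 - p with hqdef
  have hpq : p + q = 1 := by rw [hqdef]; ring
  have hpqC : (p : ℂ) + q = 1 := by exact_mod_cast hpq
  have hx3 : 0 ≤ |x| ^ 3 := by positivity
  have e1 : bernChar p x * Complex.exp (-(p * x) * Complex.I)
      = q * Complex.exp ((-(p * x) : ℝ) * Complex.I) + p * Complex.exp ((q * x : ℝ) * Complex.I) := by
    rw [bernChar, add_mul, mul_assoc (p : ℂ), ← Complex.exp_add]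
    have : (1 - (p : ℂ)) = q := by rw [hqdef]; push_cast; ring
    rw [this]
    congr 3
    · push_cast; ring
    · push_cast
      linear_combination (x * Complex.I : ℂ) * (-hpqC)
  have e2 : (1 - p * q * x ^ 2 / 2 : ℂ)
      = q * (1 + (-(p * x) : ℝ) * Complex.I - ((-(p * x) : ℝ) : ℂ) ^ 2 / 2)
        + p * (1 + (q * x : ℝ) * Complex.I - ((q * x : ℝ) : ℂ) ^ 2 / 2) := by
    push_cast
    linear_combination (-1 + p * q * x ^ 2 / 2 : ℂ) * hpqC
  have e3 : Complex.exp (-(p * (1 - p) * x ^ 2 / 2)) - (1 - p * q * x ^ 2 / 2)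
      = ((Real.exp (-(p * q * x ^ 2 / 2)) - (1 - p * q * x ^ 2 / 2) : ℝ) : ℂ) := by
    rw [hqdef]; push_cast; rfl
  have hA := norm_exp_mul_I_sub_le (-(p * x))
  have hB := norm_exp_mul_I_sub_le (q * x)
  rw [abs_neg, abs_mul, abs_of_nonneg h0, mul_pow] at hA
  rw [abs_mul, abs_of_nonneg hq, mul_pow] at hB
  have hpq0 : 0 ≤ p * q := mul_nonneg h0 hq
  have hC : |Real.exp (-(p * q * x ^ 2 / 2)) - (1 - p * q * x ^ 2 / 2)| ≤ p * q * |x| ^ 3 := by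
    have h := abs_exp_neg_sub_le (u := p * q * x ^ 2 / 2) (by positivity)
    refine h.trans ?_
    rcases le_or_gt |x| 1 with hx | hx
    · refine (min_le_right _ _).trans ?_
      have hpq1 : p * q ≤ 1 := by nlinarith
      rw [← sq_abs x]
      have : |x| ^ 4 ≤ |x| ^ 3 := pow_le_pow_of_le_one (abs_nonneg _) hx (by norm_num)
      calc (p * q * |x| ^ 2 / 2) ^ 2 = (p * q) * ((p * q) * |x| ^ 4) / 4 := by ring
        _ ≤ (p * q) * (1 * |x| ^ 3) / 4 := by gcongr
        _ ≤ _ := by nlinarith [mul_nonneg hpq0 hx3]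
    · refine (min_le_left _ _).trans ?_
      rw [← sq_abs x]
      have : |x| ^ 2 ≤ |x| ^ 3 := pow_le_pow_right₀ hx.le (by norm_num)
      nlinarith [mul_le_mul_of_nonneg_left this hpq0, mul_nonneg hpq0 hx3]
  calc _ = ‖(q * (Complex.exp ((-(p * x) : ℝ) * Complex.I)
            - (1 + (-(p * x) : ℝ) * Complex.I - ((-(p * x) : ℝ) : ℂ) ^ 2 / 2))
          + p * (Complex.exp ((q * x : ℝ) * Complex.I)
            - (1 + (q * x : ℝ) * Complex.I - ((q * x : ℝ) : ℂ) ^ 2 / 2)))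
          - ((Real.exp (-(p * q * x ^ 2 / 2)) - (1 - p * q * x ^ 2 / 2) : ℝ) : ℂ)‖ := by
        rw [← e3, e1]
        congr 1
        linear_combination -e2
    _ ≤ q * (4 * (p ^ 3 * |x| ^ 3)) + p * (4 * (q ^ 3 * |x| ^ 3)) + p * q * |x| ^ 3 := by
        refine (norm_sub_le _ _).trans (add_le_add ((norm_add_le _ _).trans ?_) ?_)
        · rw [norm_mul, norm_mul, Complex.norm_real, Complex.norm_real, Real.norm_of_nonneg h0,
            Real.norm_of_nonneg hq]
          gcongr
        · rw [Complex.norm_real]; exact hC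
    _ = (4 * (p ^ 2 + q ^ 2) + 1) * (p * q * |x| ^ 3) := by ring
    _ ≤ 5 * (p * q * |x| ^ 3) := by
        have : p ^ 2 + q ^ 2 ≤ 1 := by nlinarith
        gcongr
        linarith

lemma norm_prod_bernChar_le {s : Finset ℕ} {p : ℕ → ℝ} (k : ℕ → ℕ) (θ : ℝ) :
    ‖∏ i ∈ s, bernChar (p i) (θ * k i)‖
      ≤ Real.exp (-∑ i ∈ s, p i * (1 - p i) * (1 - Real.cos (θ * k i))) := by
  rw [norm_prod, ← Finset.sum_neg_distrib, Real.exp_sum]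
  exact Finset.prod_le_prod (fun _ _ => norm_nonneg _)
    fun i _ => norm_bernChar_le _ _

lemma norm_prod_bernChar_mul_sub_le {s : Finset ℕ} {p : ℕ → ℝ} (k : ℕ → ℕ) (h0 : ∀ i, 0 ≤ p i)
    (h1 : ∀ i, p i ≤ 1) (θ : ℝ) :
    ‖(∏ i ∈ s, bernChar (p i) (θ * k i)) * Complex.exp (-((∑ i ∈ s, p i * k i : ℝ) * θ)
        * Complex.I) - Complex.exp (-((∑ i ∈ s, p i * (1 - p i) * k i ^ 2 : ℝ) / 2 * θ ^ 2))‖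
      ≤ 5 * (∑ i ∈ s, p i * (1 - p i) * k i ^ 3) * |θ| ^ 3 := by
  have e1 : Complex.exp (-((∑ i ∈ s, p i * k i : ℝ) * θ) * Complex.I)
      = ∏ i ∈ s, Complex.exp (-(p i * (θ * k i : ℝ)) * Complex.I) := by
    rw [← Complex.exp_sum]
    congr 1
    push_cast
    rw [Finset.sum_mul, ← Finset.sum_neg_distrib, Finset.sum_mul]
    exact Finset.sum_congr rfl fun i _ => by ring
  have e2 : Complex.exp (-((∑ i ∈ s, p i * (1 - p i) * k i ^ 2 : ℝ) / 2 * θ ^ 2))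
      = ∏ i ∈ s, Complex.exp (-(p i * (1 - p i) * (θ * k i : ℝ) ^ 2 / 2)) := by
    rw [← Complex.exp_sum]
    congr 1
    push_cast
    rw [Finset.sum_div, Finset.sum_mul, ← Finset.sum_neg_distrib]
    exact Finset.sum_congr rfl fun i _ => by ring
  rw [e1, e2, ← Finset.prod_mul_distrib]
  refine (norm_prod_sub_prod_le (fun i => ?_) (fun i => ?_)).trans ?_
  · rw [norm_mul]
    have : ‖Complex.exp (-(p i * (θ * k i : ℝ)) * Complex.I)‖ = 1 := by
      have := Complex.norm_exp_ofReal_mul_I (-(p i * (θ * k i)))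
      push_cast at this ⊢
      exact this
    rw [this, mul_one]
    exact norm_bernChar_le_one (h0 i) (h1 i) _
  · rw [show (-(p i * (1 - p i) * (θ * k i : ℝ) ^ 2 / 2) : ℂ)
      = ((-(p i * (1 - p i) * (θ * k i : ℝ) ^ 2 / 2) : ℝ) : ℂ) by push_cast; ring,
      ← Complex.ofReal_exp, Complex.norm_real, Real.norm_of_nonneg (Real.exp_pos _).le,
      Real.exp_le_one_iff, neg_nonpos]
    have := h0 i
    have : 0 ≤ 1 - p i := by linarith [h1 i]
    positivity
  · rw [Finset.mul_sum, Finset.sum_mul]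
    refine Finset.sum_le_sum fun i _ => ?_
    refine (norm_bernChar_mul_sub_le (h0 i) (h1 i) _).trans_eq ?_
    rw [abs_mul, mul_pow, Nat.abs_cast]
    ring

lemma integral_gaussian_mul_exp {B : ℝ} (hB : 0 < B) (t : ℝ) :
    ∫ θ : ℝ, Complex.exp (-(B / 2 * θ ^ 2)) * Complex.exp (-(t * θ * Complex.I))
      = ((√(2 * Real.pi / B) * Real.exp (-t ^ 2 / (2 * B)) : ℝ) : ℂ) := by
  have h := fourierIntegral_gaussian (b := (B / 2 : ℝ)) (by simpa using half_pos hB) (-t : ℂ)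
  have e : ∀ θ : ℝ, Complex.exp (-(B / 2 * θ ^ 2)) * Complex.exp (-(t * θ * Complex.I))
      = Complex.exp (Complex.I * -t * θ) * Complex.exp (-(B / 2 : ℝ) * θ ^ 2) := fun θ => by
    rw [mul_comm]
    congr 2
    · ring
    · push_cast; ring
  simp only [e]
  rw [h, Real.sqrt_eq_rpow, Complex.ofReal_mul, Complex.ofReal_cpow (by positivity),
    Complex.ofReal_exp]
  congr 2
  · push_cast
    field_simp
  · push_cast; ring
  · push_cast
    rw [neg_sq]
    ring

/-- A local limit theorem with explicit error for sums of independent scaled Bernoulli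
variables. -/
theorem abs_bernMass_sub_le {s : Finset ℕ} {p : ℕ → ℝ} {k : ℕ → ℕ} (n : ℕ) (h0 : ∀ i, 0 ≤ p i)
    (h1 : ∀ i, p i ≤ 1) {θ₀ D m B : ℝ} (hθ0 : 0 ≤ θ₀)
    (hθπ : θ₀ < Real.pi)
    (hm : ∑ i ∈ s, p i * k i = m) (hB : ∑ i ∈ s, p i * (1 - p i) * k i ^ 2 = B) (hB0 : 0 < B)
    (hD : ∀ θ : ℝ, θ₀ ≤ |θ| → |θ| ≤ Real.pi →
      D ≤ ∑ i ∈ s, p i * (1 - p i) * (1 - Real.cos (θ * k i))) :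
    |2 * Real.pi * bernMass s p k n - √(2 * Real.pi / B) * Real.exp (-(n - m) ^ 2 / (2 * B))|
      ≤ 10 * (∑ i ∈ s, p i * (1 - p i) * k i ^ 3) * θ₀ ^ 4 + 2 * Real.pi * Real.exp (-D)
        + Real.exp (-(θ₀ ^ 2 * B / 4)) * √(4 * Real.pi / B) := by
  set L := ∑ i ∈ s, p i * (1 - p i) * k i ^ 3 with hL
  have hL0 : 0 ≤ L := Finset.sum_nonneg fun i _ => by
    have := h0 i
    have : 0 ≤ 1 - p i := by linarith [h1 i]
    positivity
  set f : ℝ → ℂ := fun θ => (∏ i ∈ s, bernChar (p i) (θ * k i)) *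
    Complex.exp (-(n * θ * Complex.I)) with hf
  have hfc : Continuous f := by
    rw [hf]
    refine Continuous.mul (continuous_finsetProd _ fun i _ => ?_) (by fun_prop)
    exact (continuous_bernChar _).comp (by fun_prop)
  set γ : ℝ → ℂ := fun θ => Complex.exp (-(B / 2 * θ ^ 2)) *
    Complex.exp (-((n - m : ℝ) * θ * Complex.I)) with hγ
  have hγn : ∀ θ, ‖γ θ‖ = Real.exp (-(B / 2 * θ ^ 2)) := fun θ => by
    rw [hγ, norm_mul, Complex.norm_exp, Complex.norm_exp]
    have e1 : (-((n - m : ℝ) * θ * Complex.I) : ℂ).re = 0 := by simp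
    have e2 : (-(B / 2 * θ ^ 2) : ℂ).re = -(B / 2 * θ ^ 2) := by
      rw [show (-(B / 2 * θ ^ 2) : ℂ) = ((-(B / 2 * θ ^ 2) : ℝ) : ℂ) by push_cast; ring,
        Complex.ofReal_re]
    rw [e1, e2, Real.exp_zero, mul_one]
  have hγi : Integrable γ := by
    refine Integrable.mono' (integrable_exp_neg_mul_sq (half_pos hB0)) ?_ ?_
    · exact Continuous.aestronglyMeasurable (by fun_prop)
    · filter_upwards with θ
      rw [hγn, neg_mul]
  have hI1 : (2 * Real.pi * bernMass s p k n : ℂ)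
      = ∫ θ, (Set.Ioc (-Real.pi) Real.pi).indicator f θ := by
    rw [two_pi_mul_bernMass, intervalIntegral.integral_of_le (by linarith [Real.pi_pos]),
      integral_indicator measurableSet_Ioc]
  have hfi : Integrable ((Set.Ioc (-Real.pi) Real.pi).indicator f) := by
    rw [integrable_indicator_iff measurableSet_Ioc]
    exact (hfc.integrableOn_Icc).mono_set Set.Ioc_subset_Icc_self
  have hmain : ((2 * Real.pi * bernMass s p k n - √(2 * Real.pi / B)
      * Real.exp (-(n - m) ^ 2 / (2 * B)) : ℝ) : ℂ)
      = ∫ θ, ((Set.Ioc (-Real.pi) Real.pi).indicator f θ - γ θ) := by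
    rw [integral_sub hfi hγi, ← hI1, integral_gaussian_mul_exp hB0]
    push_cast
    ring
  rw [← Real.norm_eq_abs, ← Complex.norm_real, hmain]
  -- One term per source of error: the cubic comparison on |θ| ≤ θ₀, the characteristic function on
  -- the rest of (-π, π], and the Gaussian tail. In the tail half of the exponent Bθ²/2 is spent on
  -- the small factor, the other half on integrability.
  have hpt : ∀ θ, ‖(Set.Ioc (-Real.pi) Real.pi).indicator f θ - γ θ‖ ≤
      (Set.Icc (-θ₀) θ₀).indicator (fun _ => 5 * L * θ₀ ^ 3) θ
      + (Set.Ioc (-Real.pi) Real.pi).indicator (fun _ => Real.exp (-D)) θ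
      + Real.exp (-(θ₀ ^ 2 * B / 4)) * Real.exp (-(B / 4) * θ ^ 2) := by
    intro θ
    have hγt : θ₀ ≤ |θ| → ‖γ θ‖ ≤ Real.exp (-(θ₀ ^ 2 * B / 4)) * Real.exp (-(B / 4) * θ ^ 2) := by
      intro h
      rw [hγn, ← Real.exp_add, Real.exp_le_exp, ← sq_abs θ]
      have : θ₀ ^ 2 ≤ |θ| ^ 2 := by gcongr
      nlinarith
    by_cases hmaj : θ ∈ Set.Icc (-θ₀) θ₀
    · have hπ : θ ∈ Set.Ioc (-Real.pi) Real.pi := ⟨by linarith [hmaj.1], by linarith [hmaj.2]⟩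
      rw [Set.indicator_of_mem hmaj, Set.indicator_of_mem hπ, Set.indicator_of_mem hπ]
      have hθ : |θ| ≤ θ₀ := abs_le.2 hmaj
      have h := norm_prod_bernChar_mul_sub_le k h0 h1 θ (s := s)
      rw [hm, hB, ← hL] at h
      have e : f θ - γ θ = ((∏ i ∈ s, bernChar (p i) (θ * k i)) *
          Complex.exp (-(m * θ) * Complex.I) - Complex.exp (-(B / 2 * θ ^ 2)))
          * Complex.exp ((-((n - m) * θ) : ℝ) * Complex.I) := by
        have e1 : Complex.exp (-(n * θ * Complex.I)) = Complex.exp (-(m * θ) * Complex.I)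
            * Complex.exp ((-((n - m) * θ) : ℝ) * Complex.I) := by
          rw [← Complex.exp_add]; congr 1; push_cast; ring
        have e2 : Complex.exp (-((n - m : ℝ) * θ * Complex.I))
            = Complex.exp ((-((n - m) * θ) : ℝ) * Complex.I) := by
          congr 1; push_cast; ring
        simp only [hf, hγ]
        rw [e1, e2]
        ring
      rw [e, norm_mul, Complex.norm_exp_ofReal_mul_I, mul_one]
      have : 5 * L * |θ| ^ 3 ≤ 5 * L * θ₀ ^ 3 := by gcongr
      have := Real.exp_pos (-D)
      have : 0 < Real.exp (-(θ₀ ^ 2 * B / 4)) * Real.exp (-(B / 4) * θ ^ 2) := by positivity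
      linarith
    · have hθ : θ₀ ≤ |θ| := by
        by_contra hcon
        exact hmaj (abs_le.1 (not_le.1 hcon).le)
      rw [Set.indicator_of_notMem hmaj, zero_add]
      by_cases hπ : θ ∈ Set.Ioc (-Real.pi) Real.pi
      · rw [Set.indicator_of_mem hπ, Set.indicator_of_mem hπ]
        refine (norm_sub_le _ _).trans (add_le_add ?_ (hγt hθ))
        rw [hf, norm_mul]
        have : ‖Complex.exp (-(n * θ * Complex.I))‖ = 1 := by
          have := Complex.norm_exp_ofReal_mul_I (-(n * θ))
          push_cast at this
          rw [← this]; congr 2; ring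
        rw [this, mul_one]
        refine (norm_prod_bernChar_le k θ).trans ?_
        rw [Real.exp_le_exp, neg_le_neg_iff]
        exact hD θ hθ (abs_le.2 ⟨hπ.1.le, hπ.2⟩)
      · rw [Set.indicator_of_notMem hπ, Set.indicator_of_notMem hπ, zero_sub, norm_neg, zero_add]
        exact hγt hθ
  have hb1 : Integrable ((Set.Icc (-θ₀) θ₀).indicator (fun _ => 5 * L * θ₀ ^ 3)) := by
    rw [integrable_indicator_iff measurableSet_Icc]
    exact integrableOn_const (by simp)
  have hb2 : Integrable ((Set.Ioc (-Real.pi) Real.pi).indicator (fun _ => Real.exp (-D))) := by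
    rw [integrable_indicator_iff measurableSet_Ioc]
    exact integrableOn_const (by simp)
  have hb3 : Integrable fun θ : ℝ =>
      Real.exp (-(θ₀ ^ 2 * B / 4)) * Real.exp (-(B / 4) * θ ^ 2) :=
    (integrable_exp_neg_mul_sq (show 0 < B / 4 by positivity)).const_mul _
  refine (norm_integral_le_of_norm_le ((hb1.add hb2).add hb3)
    (Filter.Eventually.of_forall hpt)).trans_eq ?_
  simp only [Pi.add_apply]
  rw [integral_add (by exact hb1.add hb2) hb3, integral_add hb1 hb2,
    integral_indicator measurableSet_Icc, integral_indicator measurableSet_Ioc,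
    integral_const_mul (Real.exp (-(θ₀ ^ 2 * B / 4))), integral_gaussian]
  simp only [setIntegral_const, smul_eq_mul, Real.volume_real_Icc, Real.volume_real_Ioc]
  rw [max_eq_left (by linarith), max_eq_left (by linarith [Real.pi_pos])]
  rw [show Real.pi / (B / 4) = 4 * Real.pi / B by field_simp]
  ring

/-- Multiplication by 2 sin(θ/2) makes the sum telescope to a difference of two sines, at most 2;
Jordan's inequality bounds sin(θ/2) from below by θ/π. -/
lemma sum_cos_Ioc_le {K : ℕ} {θ : ℝ} (h0 : 0 < θ) (hπ : θ ≤ Real.pi) :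
    ∑ k ∈ Finset.Ioc K (2 * K), Real.cos (θ * k) ≤ Real.pi / θ := by
  have h1 : ∀ M : ℕ, (∑ k ∈ Finset.Ioc K (K + M), Real.cos (θ * k)) * (2 * Real.sin (θ / 2))
      = Real.sin ((K + M + 1 / 2) * θ) - Real.sin ((K + 1 / 2) * θ) := by
    intro M
    induction M with
    | zero => simp
    | succ M ih =>
      rw [← add_assoc, Finset.sum_Ioc_succ_top (by omega), add_mul, ih]
      have e1 : ((K : ℝ) + (M + 1 : ℕ) + 1 / 2) * θ = θ * (K + M + 1 : ℕ) + θ / 2 := by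
        push_cast; ring
      have e2 : ((K : ℝ) + M + 1 / 2) * θ = θ * (K + M + 1 : ℕ) - θ / 2 := by push_cast; ring
      rw [e1, e2, Real.sin_add, Real.sin_sub]
      ring
  have h2 := h1 K
  rw [← two_mul] at h2
  have h3 : 2 / Real.pi * (θ / 2) ≤ Real.sin (θ / 2) := Real.mul_le_sin (by linarith) (by linarith)
  have h4 : 0 < 2 / Real.pi * (θ / 2) := by have := Real.pi_pos; positivity
  have h5 := Real.sin_le_one (((K : ℝ) + K + 1 / 2) * θ)
  have h6 := Real.neg_one_le_sin (((K : ℝ) + 1 / 2) * θ)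
  have h7 : (∑ k ∈ Finset.Ioc K (2 * K), Real.cos (θ * k)) * (2 * Real.sin (θ / 2)) ≤ 2 := by
    linarith
  by_contra hcon
  rw [not_le] at hcon
  have h8 : 0 < Real.pi / θ := div_pos Real.pi_pos h0
  have h9 : Real.pi / θ * (2 * (2 / Real.pi * (θ / 2))) = 2 := by
    have := Real.pi_pos
    field_simp
  nlinarith

/-- No wrap-around occurs: all arguments lie in [-π, π], where 1 - cos x ≥ 2x²/π². -/
lemma sum_one_sub_cos_of_small {K : ℕ} {θ : ℝ} (h : |θ| * (2 * K) ≤ Real.pi) :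
    2 / Real.pi ^ 2 * K ^ 3 * θ ^ 2 ≤ ∑ k ∈ Finset.Ioc K (2 * K), (1 - Real.cos (θ * k)) := by
  have hc : ((Finset.Ioc K (2 * K)).card : ℝ) = K := by
    rw [Nat.card_Ioc]; congr 1; omega
  have : ∀ k ∈ Finset.Ioc K (2 * K), 2 / Real.pi ^ 2 * K ^ 2 * θ ^ 2 ≤ 1 - Real.cos (θ * k) := by
    intro k hk
    rw [Finset.mem_Ioc] at hk
    have hk1 : (K : ℝ) ≤ k := by exact_mod_cast hk.1.le
    have hk2 : (k : ℝ) ≤ 2 * K := by exact_mod_cast hk.2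
    have := Real.cos_le_one_sub_mul_cos_sq (x := θ * k) (by
      rw [abs_mul, Nat.abs_cast]
      exact (mul_le_mul_of_nonneg_left hk2 (abs_nonneg _)).trans h)
    have h2 : 2 / Real.pi ^ 2 * K ^ 2 * θ ^ 2 ≤ 2 / Real.pi ^ 2 * (θ * k) ^ 2 := by
      rw [mul_pow, mul_assoc, mul_comm (θ ^ 2)]
      gcongr
    linarith
  calc _ = ∑ k ∈ Finset.Ioc K (2 * K), 2 / Real.pi ^ 2 * K ^ 2 * θ ^ 2 := by
        rw [Finset.sum_const, nsmul_eq_mul, hc]; ring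
    _ ≤ _ := Finset.sum_le_sum this

/-- The cosines cancel: their sum is at most π/|θ| ≤ K/2, against K ones. -/
lemma sum_one_sub_cos_of_large {K : ℕ} (hK : 0 < K) {θ : ℝ} (h : 2 * Real.pi ≤ |θ| * K)
    (hπ : |θ| ≤ Real.pi) :
    (K : ℝ) / 2 ≤ ∑ k ∈ Finset.Ioc K (2 * K), (1 - Real.cos (θ * k)) := by
  have hc : ((Finset.Ioc K (2 * K)).card : ℝ) = K := by
    rw [Nat.card_Ioc]; congr 1; omega
  have hK' : (0 : ℝ) < K := by exact_mod_cast hK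
  have h0 : 0 < |θ| := by
    by_contra hcon
    have : |θ| = 0 := le_antisymm (not_lt.1 hcon) (abs_nonneg _)
    rw [this, zero_mul] at h
    linarith [Real.pi_pos]
  have e : ∀ k : ℕ, Real.cos (θ * k) = Real.cos (|θ| * k) := fun k => by
    rw [← Real.cos_abs, abs_mul, Nat.abs_cast]
  simp only [e]
  rw [Finset.sum_sub_distrib, Finset.sum_const, nsmul_eq_mul, hc, mul_one]
  have h1 := sum_cos_Ioc_le (K := K) h0 hπ
  have h2 : Real.pi / |θ| ≤ K / 2 := by
    rw [div_le_div_iff₀ h0 two_pos]; linarith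
  linarith

/-! ### Taylor estimates for the Fermi function -/

/-- The softplus function `log (1 + e ^ x)`. -/
noncomputable def softplus (x : ℝ) : ℝ := Real.log (1 + Real.exp x)

lemma softplus_nonneg (x : ℝ) : 0 ≤ softplus x :=
  Real.log_nonneg (by linarith [Real.exp_pos x])

lemma softplus_le_exp (x : ℝ) : softplus x ≤ Real.exp x := by
  have := Real.log_le_sub_one_of_pos (show 0 < 1 + Real.exp x by positivity)
  unfold softplus
  linarith

lemma exp_softplus (x : ℝ) : Real.exp (softplus x) = 1 + Real.exp x :=
  Real.exp_log (by positivity)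

lemma hasDerivAt_softplus (x : ℝ) : HasDerivAt softplus (fermi (-x)) x := by
  have h := ((Real.hasDerivAt_exp x).const_add 1).log (by positivity)
  refine h.congr_deriv ?_
  rw [fermi, Real.exp_neg]
  have := Real.exp_pos x
  field_simp

lemma abs_fermiVar_deriv_le (x : ℝ) : |fermiVar x * (2 * fermi x - 1)| ≤ fermiVar x := by
  rw [abs_mul, abs_of_pos (fermiVar_pos x)]
  have h1 := fermi_pos x
  have h2 := fermi_lt_one x
  have : |2 * fermi x - 1| ≤ 1 := abs_le.2 ⟨by linarith, by linarith⟩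
  nlinarith [fermiVar_pos x]

lemma abs_sub_le_of_hasDerivAt {f f' : ℝ → ℝ} {M d : ℝ} (hf : ∀ t, HasDerivAt f (f' t) t)
    (hM : ∀ t, |t| ≤ |d| → |f' t| ≤ M) : |f d - f 0| ≤ M * |d| := by
  have := Convex.norm_image_sub_le_of_norm_hasDerivWithin_le (f := f) (f' := f')
    (s := Set.Icc (-|d|) |d|) (C := M) (x := 0) (y := d) (fun t _ => (hf t).hasDerivWithinAt)
    (fun t ht => hM t (abs_le.2 ht)) (convex_Icc _ _) ⟨by simp, by simp⟩ (abs_le.1 le_rfl)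
  simpa using this

section Taylor

variable {y d M : ℝ} (hM : ∀ t, |t| ≤ |d| → fermiVar (y - t) ≤ M)
include hM

/-- As functions of t, `fermiVar (y - t)`, `fermi (y - t)` and `softplus (t - y)` are each the
derivative of the next, and `fermiVar` bounds its own derivative. Three applications of the mean
value inequality therefore give the three Taylor estimates with the same M. -/
lemma abs_fermiVar_sub_le : |fermiVar (y - d) - fermiVar y| ≤ M * |d| := by
  have h := abs_sub_le_of_hasDerivAt (f := fun t => fermiVar (y - t)) (d := d) (M := M)
    (fun t => (hasDerivAt_fermiVar (y - t)).comp t ((hasDerivAt_id t).const_sub y)) fun t ht => by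
      rw [mul_neg_one, abs_neg]
      exact (abs_fermiVar_deriv_le _).trans (hM t ht)
  simpa using h

lemma abs_fermi_sub_le : |fermi (y - d) - fermi y - d * fermiVar y| ≤ M * |d| ^ 2 := by
  have h := abs_sub_le_of_hasDerivAt (f := fun t => fermi (y - t) - t * fermiVar y) (d := d)
    (M := M * |d|)
    (fun t => ((hasDerivAt_fermi (y - t)).comp t ((hasDerivAt_id t).const_sub y)).sub
      ((hasDerivAt_id t).mul_const (fermiVar y))) fun t ht => by
      have := abs_fermiVar_sub_le (y := y) (d := t) (M := M) fun u hu => hM u (hu.trans ht)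
      have h0 : 0 ≤ M := (fermiVar_pos _).le.trans (hM 0 (by simp))
      simp only [mul_neg_one, neg_neg, one_mul]
      exact this.trans (by gcongr)
  simp only [sub_zero, zero_mul] at h
  rw [sub_right_comm, sq, ← mul_assoc]
  exact h

lemma abs_softplus_sub_le : |softplus (d - y) - softplus (-y) - d * fermi y
    - d ^ 2 * fermiVar y / 2| ≤ M * |d| ^ 3 := by
  have h := abs_sub_le_of_hasDerivAt (f := fun t => softplus (t - y) - t * fermi y
      - t ^ 2 * (fermiVar y / 2)) (d := d)
    (M := M * |d| ^ 2)
    (fun t => (((hasDerivAt_softplus (t - y)).comp t ((hasDerivAt_id t).sub_const y)).sub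
      ((hasDerivAt_id t).mul_const (fermi y))).sub
      ((hasDerivAt_pow 2 t).mul_const (fermiVar y / 2))) fun t ht => by
      have := abs_fermi_sub_le (y := y) (d := t) (M := M) fun u hu => hM u (hu.trans ht)
      have h0 : 0 ≤ M := (fermiVar_pos _).le.trans (hM 0 (by simp))
      have e : fermi (-(t - y)) * 1 - 1 * fermi y - (2 : ℕ) * t ^ (2 - 1) * (fermiVar y / 2)
          = fermi (y - t) - fermi y - t * fermiVar y := by
        rw [neg_sub]; norm_num; ring
      rw [e]
      exact this.trans (by gcongr)
  simp only [zero_sub, zero_mul] at h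
  rw [show M * |d| ^ 3 = M * |d| ^ 2 * |d| by ring]
  refine le_trans (le_of_eq ?_) h
  congr 1
  ring

end Taylor

lemma fermiVar_neg (x : ℝ) : fermiVar (-x) = fermiVar x := by
  unfold fermiVar
  rw [Real.exp_neg]
  have := Real.exp_pos x
  field_simp
  ring

lemma exp_neg_abs_le_fermiVar (x : ℝ) : Real.exp (-|x|) / 4 ≤ fermiVar x := by
  wlog hx : 0 ≤ x
  · have := this (-x) (by linarith)
    rwa [fermiVar_neg, abs_neg] at this
  rw [abs_of_nonneg hx, fermiVar, Real.exp_neg]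
  have h1 : 1 ≤ Real.exp x := Real.one_le_exp hx
  rw [div_le_div_iff₀ (by norm_num) (by positivity), inv_mul_le_iff₀ (by positivity)]
  nlinarith

/-! ### Sums over the parts -/

lemma summable_pow_mul {α η : ℝ} (hα : 0 < α) (hη : 0 < η) (j : ℕ) {f : ℝ → ℝ}
    (h0 : ∀ x, 0 < f x) (hf : ∀ x, f x ≤ Real.exp (-x)) :
    Summable fun a => (part α a : ℝ) ^ j * f (η * part α a) := by
  have h := summable_comp_part hα hη (h := fun x => x ^ j * f x) (pow_mul_le_of_le_exp_neg j h0 hf)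
  refine (h.mul_left (η ^ j)⁻¹).congr fun a => ?_
  rw [mul_pow]
  field_simp

lemma summable_pow_mul_fermiVar {α η : ℝ} (hα : 0 < α) (hη : 0 < η) (j : ℕ) :
    Summable fun a => (part α a : ℝ) ^ j * fermiVar (η * part α a) :=
  summable_pow_mul hα hη j fermiVar_pos fermiVar_le_exp_neg

lemma summable_pow_mul_fermi {α η : ℝ} (hα : 0 < α) (hη : 0 < η) (j : ℕ) :
    Summable fun a => (part α a : ℝ) ^ j * fermi (η * part α a) :=
  summable_pow_mul hα hη j fermi_pos fermi_le_exp_neg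

lemma mu_eq_tsum {α η : ℝ} (hα : 0 < α) (hη : 0 < η) :
    mu α η = ∑' a, fermi (η * part α a) := by
  have h := hasSum_g_mul hα (f := fun k => fermi (η * k)) (by
    simpa using summable_pow_mul_fermi hα hη 0)
  rw [← h.tsum_eq, mu]
  refine tsum_congr fun k => ?_
  rw [fermi]; ring

lemma momentSum_eq_tsum {α η : ℝ} (hα : 0 < α) (hη : 0 < η) (j : ℕ) :
    momentSum α η j = ∑' a, (part α a : ℝ) ^ j * fermiVar (η * part α a) := by
  have h := hasSum_g_mul hα (f := fun k => (k : ℝ) ^ j * fermiVar (η * k))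
    (summable_pow_mul_fermiVar hα hη j)
  rw [← h.tsum_eq, momentSum]
  refine tsum_congr fun k => ?_
  rw [fermiVar]; ring

/-- The expected size `∑ k g(k) / (e ^ (η k) + 1)` at inverse temperature `η`. -/
noncomputable def meanSize (α η : ℝ) : ℝ := ∑' a, (part α a : ℝ) * fermi (η * part α a)

lemma summable_meanSize {α η : ℝ} (hα : 0 < α) (hη : 0 < η) :
    Summable fun a => (part α a : ℝ) * fermi (η * part α a) := by
  simpa using summable_pow_mul_fermi hα hη 1

lemma isSaddlePoint_iff {α η : ℝ} (hα : 0 < α) (n : ℕ) :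
    IsSaddlePoint α n η ↔ 0 < η ∧ meanSize α η = n := by
  refine and_congr_right fun hη => ?_
  have h := hasSum_g_mul hα (f := fun k => (k : ℝ) * fermi (η * k)) (summable_meanSize hα hη)
  have e : (fun k : ℕ+ => (k : ℝ) * g α k / (Real.exp (η * k) + 1))
      = fun k : ℕ+ => g α k * ((k : ℕ) * fermi (η * (k : ℕ))) := by
    ext k; rw [fermi]; ring
  rw [e]
  exact ⟨fun h' => h.unique h', fun h' => h' ▸ h⟩

lemma tendsto_mu {α : ℝ} (hα : 0 < α) :
    Tendsto (fun η => η ^ (1 / α) * mu α η) (𝓝[>] 0)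
      (𝓝 (-(1 / α) * polylog (1 / α) (-1) * Real.Gamma (1 / α))) := by
  rw [← integral_fermi_rpow hα]
  refine (tendsto_rpow_mul_tsum_part hα continuous_fermi (C := 1)
    (by simpa using pow_mul_le_of_le_exp_neg 0 fermi_pos fermi_le_exp_neg)).congr' ?_
  filter_upwards [self_mem_nhdsWithin] with η hη
  rw [mu_eq_tsum hα hη]

lemma tendsto_meanSize {α : ℝ} (hα : 0 < α) :
    Tendsto (fun η => η ^ (1 / α) * (η * meanSize α η)) (𝓝[>] 0) (𝓝 (constA (1 / α))) := by
  rw [← integral_rpow_mul_fermi_rpow hα]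
  have := tendsto_rpow_mul_tsum_part hα (h := fun x => x * fermi x) (by fun_prop)
    (by simpa using pow_mul_le_of_le_exp_neg 1 fermi_pos fermi_le_exp_neg)
  refine this.congr fun η => ?_
  rw [meanSize, ← tsum_mul_left (a := η)]
  congr 1
  exact tsum_congr fun a => by ring

lemma tendsto_momentSum {α : ℝ} (hα : 0 < α) (j : ℕ) :
    Tendsto (fun η => η ^ (1 / α) * (η ^ j * momentSum α η j)) (𝓝[>] 0)
      (𝓝 (limMoment α j)) := by
  have := tendsto_rpow_mul_tsum_part hα (h := fun x => x ^ j * fermiVar x) (by fun_prop)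
    (pow_mul_le_of_le_exp_neg j fermiVar_pos fermiVar_le_exp_neg)
  refine this.congr' ?_
  filter_upwards [self_mem_nhdsWithin] with η hη
  rw [momentSum_eq_tsum hα hη, ← tsum_mul_left (a := η ^ j)]
  congr 1
  exact tsum_congr fun a => by ring

lemma momentSum_pos {α η : ℝ} (hα : 0 < α) (hη : 0 < η) (j : ℕ) : 0 < momentSum α η j := by
  rw [momentSum_eq_tsum hα hη]
  have hpos : ∀ a, 0 < (part α a : ℝ) ^ j * fermiVar (η * part α a) := fun a => by
    have h1 : (0 : ℝ) < part α a := by exact_mod_cast one_le_part hα a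
    have h2 := fermiVar_pos (η * part α a)
    positivity
  exact (summable_pow_mul_fermiVar hα hη j).tsum_pos (fun a => (hpos a).le) 0 (hpos 0)

lemma tendsto_sigmaSq {α : ℝ} (hα : 0 < α) :
    Tendsto (fun η => η ^ (1 / α) * sigmaSq α η) (𝓝[>] 0)
      (𝓝 (limMoment α 0 - limMoment α 1 ^ 2 / limMoment α 2)) := by
  have h := (tendsto_momentSum hα 0).sub (((tendsto_momentSum hα 1).pow 2).div
    (tendsto_momentSum hα 2) (limMoment_pos hα 2).ne')
  refine h.congr' ?_
  filter_upwards [self_mem_nhdsWithin] with η hη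
  have hη : 0 < η := hη
  have h2 := (momentSum_pos hα hη 2).ne'
  have h3 : (0 : ℝ) < η ^ (1 / α) := by positivity
  simp only [Pi.div_apply, sigmaSq]
  field_simp

/-- The envelope `(1 + y) ^ 5 e ^ (-y / 2)` dominating all sums over parts. -/
noncomputable def envelope (y : ℝ) : ℝ := (1 + y) ^ 5 * Real.exp (-y / 2)

lemma envelope_nonneg {y : ℝ} (hy : 0 ≤ y) : 0 ≤ envelope y := by
  unfold envelope; positivity

lemma envelope_bound : ∃ C : ℝ, ∀ x, 0 ≤ x → |envelope x| ≤ C * Real.exp (-x / 4) := by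
  refine ⟨((5 : ℕ).factorial * 4 ^ 5) * Real.exp (1 / 4), fun x hx => ?_⟩
  rw [abs_of_nonneg (envelope_nonneg hx), envelope]
  have h := pow_mul_exp_neg_half_le 5 (x := 1 + x) (by linarith)
  have e1 : Real.exp (-x / 2) = Real.exp (-(1 + x) / 2) * Real.exp (1 / 2) := by
    rw [← Real.exp_add]; congr 1; ring
  have e2 : Real.exp (1 / 4) * Real.exp (-x / 4) = Real.exp (-(1 + x) / 4) * Real.exp (1 / 2) := by
    rw [← Real.exp_add, ← Real.exp_add]; congr 1; ring
  rw [e1, mul_assoc _ (Real.exp (1 / 4)), e2, ← mul_assoc, ← mul_assoc]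
  gcongr

lemma summable_envelope {α η : ℝ} (hα : 0 < α) (hη : 0 < η) :
    Summable fun a => envelope (η * part α a) := by
  obtain ⟨C, hC⟩ := envelope_bound
  exact summable_comp_part hα hη hC

/-- Reduces every error estimate to a termwise bound; the envelope sum itself is of order `vol`. -/
lemma abs_tsum_le_of_envelope {α η C : ℝ} (hα : 0 < α) (hη : 0 < η) {f : ℕ → ℝ}
    (hf : ∀ a, |f a| ≤ C * envelope (η * part α a)) :
    |∑' a, f a| ≤ C * ∑' a, envelope (η * part α a) := by
  rw [← tsum_mul_left]
  rw [← Real.norm_eq_abs]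
  exact tsum_of_norm_bounded ((summable_envelope hα hη).mul_left C).hasSum hf

lemma summable_of_envelope {α η C : ℝ} (hα : 0 < α) (hη : 0 < η) {f : ℕ → ℝ}
    (hf : ∀ a, |f a| ≤ C * envelope (η * part α a)) : Summable f :=
  Summable.of_norm_bounded ((summable_envelope hα hη).mul_left C) hf

/-! ### Lower bounds for `g` and the minor arcs -/

/-- With β = 1/α, rounding loses at most 1 from the Bernoulli bound βk^{β-1}, which costs at most
half when this bound exceeds 2. Otherwise g(k) ≥ 1 suffices, as (k+1)^β ≥ k^β + 1. -/
lemma rpow_le_g {α : ℝ} (hα : 0 < α) (hα1 : α < 1) {k : ℕ} (hk : 1 ≤ k) :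
    1 / α / 2 * (k : ℝ) ^ (1 / α - 1) ≤ g α k := by
  have hβ : 1 ≤ 1 / α := by rw [le_div_iff₀ hα]; linarith
  have hk0 : (0 : ℝ) < k := by exact_mod_cast hk
  set β := 1 / α
  have h1 : (k : ℝ) ^ β + β * (k : ℝ) ^ (β - 1) ≤ ((k : ℝ) + 1) ^ β := by
    have h := one_add_mul_self_le_rpow_one_add (s := 1 / (k : ℝ)) (by
      have : (0 : ℝ) ≤ 1 / k := by positivity
      linarith) hβ
    have e : ((k : ℝ) + 1) = k * (1 + 1 / k) := by field_simp
    rw [e, Real.mul_rpow hk0.le (by positivity)]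
    calc _ = (k : ℝ) ^ β * (1 + β * (1 / k)) := by
          rw [Real.rpow_sub_one hk0.ne']; ring
      _ ≤ _ := by gcongr
  have h2 : (k : ℝ) ^ β + 1 ≤ ((k : ℝ) + 1) ^ β := by
    have := Real.add_rpow_le_rpow_add (a := (k : ℝ)) (b := 1) (by positivity) zero_le_one hβ
    simpa using this
  have h3 : (1 : ℝ) ≤ g α k := by
    have : ⌈(k : ℝ) ^ β⌉ + 1 ≤ ⌈((k : ℝ) + 1) ^ β⌉ := by
      rw [← Int.ceil_add_one]; exact Int.ceil_mono h2
    have : ((⌈(k : ℝ) ^ β⌉ + 1 : ℤ) : ℝ) ≤ (⌈((k : ℝ) + 1) ^ β⌉ : ℤ) := by exact_mod_cast this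
    push_cast at this
    rw [g]
    linarith
  have h4 : β * (k : ℝ) ^ (β - 1) - 1 ≤ g α k := by
    have h5 := Int.le_ceil (((k : ℝ) + 1) ^ β)
    have h6 := Int.ceil_lt_add_one ((k : ℝ) ^ β)
    rw [g]
    linarith
  rcases le_or_gt (β * (k : ℝ) ^ (β - 1)) 2 with h | h <;> linarith

/-- A lower bound for a sum over parts in terms of the sum over a dyadic range of sizes. -/
lemma sum_Ioc_le_sum_part {α : ℝ} (hα : 0 < α) (hα1 : α < 1) {K : ℕ} (hK : 1 ≤ K) :
    ∀ᶠ M in atTop, ∀ f : ℕ → ℝ, (∀ k, 0 ≤ f k) → 1 / α / 2 * (K : ℝ) ^ (1 / α - 1) * ∑ k ∈ Finset.Ioc K (2 * K), f k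
      ≤ ∑ a ∈ Finset.range M with part α a ∈ Finset.Ioc K (2 * K), f (part α a) := by
  have hβ : 1 ≤ 1 / α := by rw [le_div_iff₀ hα]; linarith
  -- M only has to exceed every index with a part in the block, so it does not depend on f; later
  -- this gives uniformity in θ.
  have hfin : {a : ℕ | part α a ∈ Finset.Ioc K (2 * K)}.Finite := by
    have : {a : ℕ | part α a ∈ Finset.Ioc K (2 * K)}
        = ⋃ k ∈ Finset.Ioc K (2 * K), {a : ℕ | part α a = k} := by
      ext a; simp
    rw [this]
    exact Set.Finite.biUnion (Finset.finite_toSet _) fun k _ => finite_part_fiber hα k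
  obtain ⟨M₀, hM₀⟩ := hfin.bddAbove
  filter_upwards [eventually_gt_atTop M₀] with M hM f hf
  rw [Finset.mul_sum, ← Finset.sum_fiberwise_of_maps_to (t := Finset.Ioc K (2 * K))
    (g := part α) (fun a ha => (Finset.mem_filter.1 ha).2)]
  refine Finset.sum_le_sum fun k hk => ?_
  have hk' := Finset.mem_Ioc.1 hk
  have e : ∑ a ∈ (Finset.range M).filter (fun a => part α a ∈ Finset.Ioc K (2 * K))
      with part α a = k, f (part α a) = g α k * f k := by
    rw [Finset.sum_congr rfl (g := fun _ => f k) (fun a ha => by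
      rw [(Finset.mem_filter.1 ha).2]), Finset.sum_const, nsmul_eq_mul,
      ← card_part_fiber hα (by omega)]
    congr 2
    rw [← Set.ncard_coe_finset]
    congr 1
    ext a
    simp only [Finset.coe_filter, Finset.mem_filter, Finset.mem_range, Set.mem_ofPred_eq]
    constructor
    · exact fun h => h.2
    · intro h
      refine ⟨⟨lt_of_le_of_lt (hM₀ ?_) hM, ?_⟩, h⟩
      · simpa only [Set.mem_ofPred_eq, h] using hk
      · rwa [h]
  rw [e]
  refine mul_le_mul_of_nonneg_right (le_trans ?_ (rpow_le_g hα hα1 (by omega))) (hf k)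
  have : (K : ℝ) ≤ k := by exact_mod_cast hk'.1.le
  gcongr

/-! ### The tilted model: uniform estimates of its mean, variance and cumulant sum. -/

/-- The order of magnitude `η ^ (-1 / α)` of all cumulants. -/
noncomputable def vol (α η : ℝ) : ℝ := η ^ (-(1 / α))

/-- The regression coefficient of the number of summands on the size. -/
noncomputable def slope (α η : ℝ) : ℝ := momentSum α η 1 / momentSum α η 2

/-- The residual of the number of summands after regression on the size, for a single part. -/
noncomputable def weight (α η : ℝ) (a : ℕ) : ℝ := 1 - slope α η * part α a

/-- The exponent of the tilted model: its part `a` is present with probability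
`fermi (tiltArg α η s a)`. -/
noncomputable def tiltArg (α η s : ℝ) (a : ℕ) : ℝ := η * part α a - s * weight α η a

lemma vol_pos {α η : ℝ} (hη : 0 < η) : 0 < vol α η := by unfold vol; positivity

/-- Uniform bounds on the untilted sums at inverse temperature `η`. -/
structure TiltBounds (α η C : ℝ) : Prop where
  pos : 0 < η
  le_one : η ≤ 1
  one_le : 1 ≤ C
  abs_weight_le : ∀ a, |weight α η a| ≤ C * (1 + η * part α a)
  tsum_envelope_le : ∑' a, envelope (η * part α a) ≤ C * vol α η
  le_momentSum : vol α η ≤ C * (η ^ 2 * momentSum α η 2)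
  le_sigmaSq : vol α η ≤ C * sigmaSq α η
  momentSum_le : η ^ 2 * momentSum α η 2 ≤ C * vol α η

lemma eventually_le_mul_vol {α l C : ℝ} {f : ℝ → ℝ}
    (h : Tendsto (fun η => η ^ (1 / α) * f η) (𝓝[>] 0) (𝓝 l)) (hC : l < C) :
    ∀ᶠ η in 𝓝[>] 0, f η ≤ C * vol α η := by
  filter_upwards [h.eventually_lt_const hC, self_mem_nhdsWithin] with η h1 hη
  have hη : 0 < η := hη
  have h2 : 0 < η ^ (1 / α) := by positivity
  rw [vol, Real.rpow_neg hη.le, ← div_eq_mul_inv, le_div_iff₀ h2]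
  linarith

lemma eventually_vol_le_mul {α l C : ℝ} {f : ℝ → ℝ}
    (h : Tendsto (fun η => η ^ (1 / α) * f η) (𝓝[>] 0) (𝓝 l)) (hl : 0 < l) (hC : 1 / l < C) :
    ∀ᶠ η in 𝓝[>] 0, vol α η ≤ C * f η := by
  have hC0 : 0 < C := lt_trans (by positivity) hC
  have h3 : 1 / C < l := by
    rw [div_lt_iff₀ hC0]
    rw [div_lt_iff₀ hl] at hC
    linarith
  filter_upwards [h.eventually_const_lt h3, self_mem_nhdsWithin] with η h1 hη
  have hη : 0 < η := hη
  have h2 : 0 < η ^ (1 / α) := by positivity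
  rw [vol, Real.rpow_neg hη.le, inv_eq_one_div, div_le_iff₀ h2]
  rw [div_lt_iff₀ hC0] at h1
  linarith

lemma exists_tiltBounds {α : ℝ} (hα : 0 < α) :
    ∃ C, ∀ᶠ η in 𝓝[>] 0, TiltBounds α η C := by
  obtain ⟨Ce, hCe⟩ := envelope_bound
  have hcont : Continuous envelope := by unfold envelope; fun_prop
  have he := tendsto_rpow_mul_tsum_part hα hcont hCe
  have h1 := tendsto_momentSum hα 1
  have h2 := tendsto_momentSum hα 2
  have hs := tendsto_sigmaSq hα
  have hl1 := limMoment_pos hα 1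
  have hl2 := limMoment_pos hα 2
  have hls := limMoment_variance_pos hα
  obtain ⟨c0, hc0, hc0'⟩ : ∃ c, (∫ y in Set.Ioi (0 : ℝ), envelope (y ^ α)) < c ∧ 0 < c :=
    ⟨max _ 0 + 1, lt_of_le_of_lt (le_max_left _ 0) (lt_add_one _), by positivity⟩
  set c1 := limMoment α 1 + 1
  set c2 := 1 / limMoment α 2 + 1
  set c3 := 1 / (limMoment α 0 - limMoment α 1 ^ 2 / limMoment α 2) + 1
  set c4 := limMoment α 2 + 1
  have hc1 : 0 < c1 := by positivity
  have hc2 : 0 < c2 := by positivity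
  have hc3 : 0 < c3 := by positivity
  have hc4 : 0 < c4 := by positivity
  have hc12 : 0 < c1 * c2 := by positivity
  refine ⟨1 + c0 + c1 * c2 + c2 + c3 + c4, ?_⟩
  filter_upwards [Ioc_mem_nhdsGT zero_lt_one, eventually_le_mul_vol he hc0,
    eventually_le_mul_vol h1 (lt_add_one _), eventually_vol_le_mul h2 hl2 (lt_add_one _),
    eventually_vol_le_mul hs hls (lt_add_one _),
    eventually_le_mul_vol h2 (lt_add_one _)]
    with η hη he h1 h2 h3 h4
  have hη0 : 0 < η := hη.1
  have hV := vol_pos (α := α) hη0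
  have hM1 := momentSum_pos hα hη0 1
  have hM2 := momentSum_pos hα hη0 2
  have hσ : 0 ≤ sigmaSq α η := by
    by_contra hcon
    have : c3 * sigmaSq α η < 0 := mul_neg_of_pos_of_neg hc3 (not_le.1 hcon)
    linarith
  refine ⟨hη0, hη.2, by linarith, fun a => ?_, ?_, ?_, ?_, ?_⟩
  · have hy : 0 ≤ η * part α a := by positivity
    -- The first moment sum is O(V/η) and the second is at least of order V/η², so the slope is O(η)
    -- and the weight is O(1 + η·part).
    have hs : slope α η ≤ c1 * c2 * η := by
      rw [slope, div_le_iff₀ hM2]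
      rw [pow_one] at h1
      have h6 : η * momentSum α η 1 ≤ η * (c1 * c2 * η * momentSum α η 2) := by
        calc _ ≤ c1 * vol α η := h1
          _ ≤ c1 * (c2 * (η ^ 2 * momentSum α η 2)) := by gcongr
          _ = _ := by ring
      exact le_of_mul_le_mul_left h6 hη0
    have hs0 : 0 ≤ slope α η := div_nonneg hM1.le hM2.le
    calc |weight α η a| ≤ 1 + slope α η * part α a := by
          rw [weight]
          refine (abs_sub _ _).trans ?_
          rw [abs_one, abs_of_nonneg (by positivity)]
      _ ≤ 1 + c1 * c2 * η * part α a := by gcongr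
      _ = 1 + c1 * c2 * (η * part α a) := by ring
      _ ≤ _ := by nlinarith
  · exact he.trans (by gcongr; linarith)
  · have : 0 < η ^ 2 * momentSum α η 2 := by positivity
    exact h2.trans (mul_le_mul_of_nonneg_right (by linarith) this.le)
  · exact h3.trans (mul_le_mul_of_nonneg_right (by linarith) hσ)
  · exact h4.trans (mul_le_mul_of_nonneg_right (by linarith) hV.le)

lemma pow_mul_pow_le_envelope {i j : ℕ} (hij : i + j ≤ 5) {y : ℝ} (hy : 0 ≤ y) :
    y ^ j * (1 + y) ^ i * Real.exp (-y / 2) ≤ envelope y := by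
  unfold envelope
  gcongr
  calc y ^ j * (1 + y) ^ i ≤ (1 + y) ^ j * (1 + y) ^ i := by gcongr; linarith
    _ = (1 + y) ^ (j + i) := (pow_add _ _ _).symm
    _ ≤ (1 + y) ^ 5 := pow_le_pow_right₀ (by linarith) (by omega)

/-- The mean size in the tilted model. -/
noncomputable def tiltMean (α η s : ℝ) : ℝ := ∑' a, fermi (tiltArg α η s a) * part α a

/-- The moments of the size variance in the tilted model. -/
noncomputable def tiltMoment (α η s : ℝ) (j : ℕ) : ℝ :=
  ∑' a, fermiVar (tiltArg α η s a) * part α a ^ j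

/-- The cumulant generating function of the regression residual. -/
noncomputable def tiltCumulant (α η s : ℝ) : ℝ :=
  ∑' a, (softplus (s * weight α η a - η * part α a) - softplus (-(η * part α a)))

namespace TiltBounds

variable {α η C s : ℝ} (h : TiltBounds α η C) (hs : C * |s| ≤ 1 / 2)
include h

lemma part_nonneg (a : ℕ) : 0 ≤ η * part α a := mul_nonneg h.pos.le (Nat.cast_nonneg _)

lemma C_pos : 0 < C := lt_of_lt_of_le one_pos h.one_le

lemma abs_mul_weight_le (s : ℝ) (a : ℕ) :
    |s * weight α η a| ≤ C * |s| * (1 + η * part α a) := by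
  rw [abs_mul]
  calc _ ≤ |s| * (C * (1 + η * part α a)) := by gcongr; exact h.abs_weight_le a
    _ = _ := by ring

include hs

/-- Since C|s| ≤ 1/2, the tilt is at most (1 + y)/2 with y = η·part. It uses up half of the decay
e^{-y}, which is why the envelope has e^{-y/2}; the constant loss is e^{1/2} ≤ 2. -/
lemma exp_neg_sub_le (a : ℕ) {t : ℝ} (ht : |t| ≤ |s * weight α η a|) :
    Real.exp (-(η * part α a - t)) ≤ 2 * Real.exp (-(η * part α a) / 2) := by
  have hy := h.part_nonneg a
  have h1 : t ≤ (1 + η * part α a) / 2 := by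
    refine (le_abs_self t).trans (ht.trans ((h.abs_mul_weight_le s a).trans ?_))
    nlinarith
  have h2 : Real.exp (1 / 2) ≤ 2 := by
    have := Real.exp_one_lt_d9
    have h3 : Real.exp (1 / 2) * Real.exp (1 / 2) = Real.exp 1 := by
      rw [← Real.exp_add]; norm_num
    nlinarith [Real.exp_pos (1 / 2)]
  calc _ ≤ Real.exp (1 / 2 + -(η * part α a) / 2) := Real.exp_le_exp.2 (by linarith)
    _ = Real.exp (1 / 2) * Real.exp (-(η * part α a) / 2) := Real.exp_add _ _
    _ ≤ _ := by gcongr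

lemma fermiVar_sub_le (a : ℕ) (t : ℝ) (ht : |t| ≤ |s * weight α η a|) :
    fermiVar (η * part α a - t) ≤ 2 * Real.exp (-(η * part α a) / 2) :=
  (fermiVar_le_exp_neg _).trans (h.exp_neg_sub_le hs a ht)

lemma abs_fermi_tiltArg_mul_le (a : ℕ) :
    |fermi (tiltArg α η s a) * part α a| ≤ 2 / η * envelope (η * part α a) := by
  have hy := h.part_nonneg a
  have hη := h.pos
  have h1 := (fermi_le_exp_neg _).trans (h.exp_neg_sub_le hs a le_rfl)
  rw [abs_of_nonneg (mul_nonneg (fermi_pos _).le (Nat.cast_nonneg _))]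
  calc _ ≤ 2 * Real.exp (-(η * part α a) / 2) * part α a := by
        rw [tiltArg]; gcongr
    _ = 2 / η * ((η * part α a) ^ 1 * (1 + η * part α a) ^ 0
        * Real.exp (-(η * part α a) / 2)) := by field_simp
    _ ≤ _ := by
        gcongr
        exact pow_mul_pow_le_envelope (by norm_num) hy

lemma abs_fermiVar_tiltArg_mul_le {j : ℕ} (hj : j ≤ 5) (a : ℕ) :
    |fermiVar (tiltArg α η s a) * part α a ^ j| ≤ 2 / η ^ j * envelope (η * part α a) := by
  have hy := h.part_nonneg a
  have hη := h.pos
  have h1 := h.fermiVar_sub_le hs a _ le_rfl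
  rw [abs_of_nonneg (mul_nonneg (fermiVar_pos _).le (by positivity))]
  calc _ ≤ 2 * Real.exp (-(η * part α a) / 2) * part α a ^ j := by
        rw [tiltArg]; gcongr
    _ = 2 / η ^ j * ((η * part α a) ^ j * (1 + η * part α a) ^ 0
        * Real.exp (-(η * part α a) / 2)) := by rw [mul_pow]; field_simp
    _ ≤ _ := by
        gcongr
        exact pow_mul_pow_le_envelope (by omega) hy

lemma summable_tiltMean (hα : 0 < α) :
    Summable fun a => fermi (tiltArg α η s a) * part α a :=
  summable_of_envelope hα h.pos (h.abs_fermi_tiltArg_mul_le hs)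

lemma summable_tiltMoment (hα : 0 < α) {j : ℕ} (hj : j ≤ 5) :
    Summable fun a => fermiVar (tiltArg α η s a) * part α a ^ j :=
  summable_of_envelope hα h.pos (h.abs_fermiVar_tiltArg_mul_le hs hj)

lemma tiltMoment_three_le (hα : 0 < α) :
    tiltMoment α η s 3 ≤ 2 * C * vol α η / η ^ 3 := by
  refine (le_abs_self _).trans ((abs_tsum_le_of_envelope hα h.pos
    (h.abs_fermiVar_tiltArg_mul_le hs (by norm_num : 3 ≤ 5))).trans ?_)
  have := h.pos
  calc _ ≤ 2 / η ^ 3 * (C * vol α η) := by gcongr; exact h.tsum_envelope_le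
    _ = _ := by ring

lemma abs_tiltMoment_two_sub_le (hα : 0 < α) :
    |tiltMoment α η s 2 - momentSum α η 2| ≤ 2 * C ^ 2 * |s| * vol α η / η ^ 2 := by
  have hη := h.pos
  have hC := h.C_pos
  have hsum := summable_pow_mul_fermiVar hα hη 2
  rw [tiltMoment, momentSum_eq_tsum hα hη, ← (h.summable_tiltMoment hs hα (by norm_num)).tsum_sub
    hsum]
  refine (abs_tsum_le_of_envelope hα hη (C := 2 * C * |s| / η ^ 2) fun a => ?_).trans ?_
  · have hy := h.part_nonneg a
    have h1 := abs_fermiVar_sub_le (h.fermiVar_sub_le hs a)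
    rw [mul_comm ((part α a : ℝ) ^ 2), ← sub_mul, abs_mul,
      abs_of_nonneg (show (0 : ℝ) ≤ (part α a : ℝ) ^ 2 by positivity)]
    calc _ ≤ 2 * Real.exp (-(η * part α a) / 2) * |s * weight α η a| * part α a ^ 2 := by
          gcongr; exact h1
      _ ≤ 2 * Real.exp (-(η * part α a) / 2) * (C * |s| * (1 + η * part α a))
          * part α a ^ 2 := by
          gcongr; exact h.abs_mul_weight_le s a
      _ = 2 * C * |s| / η ^ 2 * ((η * part α a) ^ 2 * (1 + η * part α a) ^ 1
        * Real.exp (-(η * part α a) / 2)) := by field_simp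
      _ ≤ _ := by
        gcongr
        exact pow_mul_pow_le_envelope (by norm_num) hy
  · calc _ ≤ 2 * C * |s| / η ^ 2 * (C * vol α η) := by gcongr; exact h.tsum_envelope_le
      _ = _ := by ring

/-- The term linear in s is the covariance of weight and size, which vanishes by the choice of
`slope`; only the quadratic Taylor remainder survives. -/
lemma abs_tiltMean_sub_le (hα : 0 < α) :
    |tiltMean α η s - meanSize α η| ≤ 2 * C ^ 3 * |s| ^ 2 * vol α η / η := by
  have hη := h.pos
  have hC := h.C_pos
  have hM2 := momentSum_pos hα hη 2
  have hsum := summable_meanSize hα hη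
  have hs1 := summable_pow_mul_fermiVar hα hη 1
  have hs2 := summable_pow_mul_fermiVar hα hη 2
  have hcov : HasSum (fun a => s * weight α η a * fermiVar (η * part α a) * part α a) 0 := by
    have h1 := (hs1.hasSum.sub (hs2.hasSum.mul_left (slope α η))).mul_left s
    rw [← momentSum_eq_tsum hα hη, ← momentSum_eq_tsum hα hη, slope,
      div_mul_cancel₀ _ hM2.ne', sub_self, mul_zero] at h1
    refine h1.congr_fun fun a => ?_
    rw [weight, slope]; ring
  have e : tiltMean α η s - meanSize α η = ∑' a, (fermi (tiltArg α η s a) * part α a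
      - part α a * fermi (η * part α a)
      - s * weight α η a * fermiVar (η * part α a) * part α a) := by
    rw [((h.summable_tiltMean hs hα).sub hsum).tsum_sub hcov.summable, hcov.tsum_eq, sub_zero,
      (h.summable_tiltMean hs hα).tsum_sub hsum]
    rfl
  rw [e]
  refine (abs_tsum_le_of_envelope hα hη (C := 2 * C ^ 2 * |s| ^ 2 / η) fun a => ?_).trans ?_
  · have hy := h.part_nonneg a
    have h1 := abs_fermi_sub_le (h.fermiVar_sub_le hs a)
    have e2 : fermi (tiltArg α η s a) * part α a - part α a * fermi (η * part α a)
      - s * weight α η a * fermiVar (η * part α a) * part α a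
      = (fermi (η * part α a - s * weight α η a) - fermi (η * part α a)
        - s * weight α η a * fermiVar (η * part α a)) * part α a := by
      rw [tiltArg]; ring
    rw [e2, abs_mul, Nat.abs_cast]
    calc _ ≤ 2 * Real.exp (-(η * part α a) / 2) * |s * weight α η a| ^ 2 * part α a := by
          gcongr
      _ ≤ 2 * Real.exp (-(η * part α a) / 2) * (C * |s| * (1 + η * part α a)) ^ 2
          * part α a := by
          gcongr; exact h.abs_mul_weight_le s a
      _ = 2 * C ^ 2 * |s| ^ 2 / η * ((η * part α a) ^ 1 * (1 + η * part α a) ^ 2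
        * Real.exp (-(η * part α a) / 2)) := by field_simp
      _ ≤ _ := by
        gcongr
        exact pow_mul_pow_le_envelope (by norm_num) hy
  · calc _ ≤ 2 * C ^ 2 * |s| ^ 2 / η * (C * vol α η) := by gcongr; exact h.tsum_envelope_le
      _ = _ := by ring

lemma abs_softplus_tilt_le (a : ℕ) :
    |softplus (s * weight α η a - η * part α a)| ≤ 2 * envelope (η * part α a) := by
  have hy := h.part_nonneg a
  rw [abs_of_nonneg (softplus_nonneg _)]
  have h1 := h.exp_neg_sub_le hs a le_rfl (t := s * weight α η a)
  rw [neg_sub] at h1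
  refine ((softplus_le_exp _).trans h1).trans ?_
  have := pow_mul_pow_le_envelope (i := 0) (j := 0) (by norm_num) hy
  rw [pow_zero, pow_zero, one_mul, one_mul] at this
  linarith

lemma summable_softplus (hα : 0 < α) :
    Summable fun a => softplus (s * weight α η a - η * part α a) :=
  summable_of_envelope hα h.pos (h.abs_softplus_tilt_le hs)

/-- Third-order Taylor expansion of each summand. The linear terms sum to the mean of the residual,
the quadratic ones to its variance. -/
lemma abs_tiltCumulant_sub_le (hα : 0 < α) :
    |tiltCumulant α η s - (s * (mu α η - slope α η * meanSize α η) + s ^ 2 * sigmaSq α η / 2)|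
      ≤ 2 * C ^ 4 * |s| ^ 3 * vol α η := by
  have hη := h.pos
  have hC := h.C_pos
  have hM2 := momentSum_pos hα hη 2
  have h0 : Summable fun a => softplus (-(η * part α a)) := by
    simpa using h.summable_softplus (s := 0) (by simp) hα
  have hF0 : Summable fun a => fermi (η * part α a) := by
    simpa using summable_pow_mul_fermi hα hη 0
  have hF1 := summable_meanSize hα hη
  have hs0 := (summable_pow_mul_fermiVar hα hη 0).hasSum
  have hs1 := (summable_pow_mul_fermiVar hα hη 1).hasSum
  have hs2 := (summable_pow_mul_fermiVar hα hη 2).hasSum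
  have hlin : HasSum (fun a => s * weight α η a * fermi (η * part α a))
      (s * (mu α η - slope α η * meanSize α η)) := by
    rw [mu_eq_tsum hα hη, meanSize]
    refine ((hF0.hasSum.sub (hF1.hasSum.mul_left (slope α η))).mul_left s).congr_fun fun a => ?_
    rw [weight]; ring
  have hquad : HasSum (fun a => (s * weight α η a) ^ 2 * fermiVar (η * part α a) / 2)
      (s ^ 2 * sigmaSq α η / 2) := by
    rw [← momentSum_eq_tsum hα hη] at hs0 hs1 hs2
    have h1 := ((hs0.sub (hs1.mul_left (2 * slope α η))).add
      (hs2.mul_left (slope α η ^ 2))).mul_left (s ^ 2 / 2)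
    -- Substituting the regression coefficient completes the square, so the variance of the residual
    -- is `sigmaSq`.
    have e : s ^ 2 / 2 * (momentSum α η 0 - 2 * slope α η * momentSum α η 1
        + slope α η ^ 2 * momentSum α η 2) = s ^ 2 * sigmaSq α η / 2 := by
      rw [slope, sigmaSq]; field_simp; ring
    rw [e] at h1
    refine h1.congr_fun fun a => ?_
    rw [weight]; ring
  have hsp := h.summable_softplus hs hα
  have e : tiltCumulant α η s
      - (s * (mu α η - slope α η * meanSize α η) + s ^ 2 * sigmaSq α η / 2)
      = ∑' a, (softplus (s * weight α η a - η * part α a) - softplus (-(η * part α a))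
        - s * weight α η a * fermi (η * part α a)
        - (s * weight α η a) ^ 2 * fermiVar (η * part α a) / 2) := by
    rw [((hsp.sub h0).sub hlin.summable).tsum_sub hquad.summable,
      (hsp.sub h0).tsum_sub hlin.summable, hlin.tsum_eq, hquad.tsum_eq, tiltCumulant]
    ring
  rw [e]
  refine (abs_tsum_le_of_envelope hα hη (C := 2 * C ^ 3 * |s| ^ 3) fun a => ?_).trans ?_
  · have hy := h.part_nonneg a
    calc _ ≤ 2 * Real.exp (-(η * part α a) / 2) * |s * weight α η a| ^ 3 :=
          abs_softplus_sub_le (h.fermiVar_sub_le hs a)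
      _ ≤ 2 * Real.exp (-(η * part α a) / 2) * (C * |s| * (1 + η * part α a)) ^ 3 := by
          gcongr; exact h.abs_mul_weight_le s a
      _ = 2 * C ^ 3 * |s| ^ 3 * ((η * part α a) ^ 0 * (1 + η * part α a) ^ 3
        * Real.exp (-(η * part α a) / 2)) := by ring
      _ ≤ _ := by
        gcongr
        exact pow_mul_pow_le_envelope (by norm_num) hy
  · calc _ ≤ 2 * C ^ 3 * |s| ^ 3 * (C * vol α η) := by gcongr; exact h.tsum_envelope_le
      _ = _ := by ring

/-- Decay of the characteristic function of the size in the tilted model. -/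
lemma minor_arc (hα : 0 < α) (hα1 : α < 1) :
    ∀ᶠ M in atTop, ∀ θ : ℝ, |θ| ≤ Real.pi →
      Real.exp (-25) / (4 * α * Real.pi ^ 2) * vol α η * min 1 ((θ / η) ^ 2)
      ≤ ∑ a ∈ Finset.range M, fermi (tiltArg α η s a) * (1 - fermi (tiltArg α η s a))
        * (1 - Real.cos (θ * part α a)) := by
  have hη := h.pos
  have hη1 := h.le_one
  have hβ : 0 < 1 / α - 1 := by
    rw [sub_pos, lt_div_iff₀ hα]; linarith
  -- Parts of size about 1/η carry the variance, so dyadic blocks at this scale suffice: Q ≤ K ≤ 4Q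
  -- with 1 ≤ ηQ ≤ 2.
  set Q : ℕ := ⌈1 / η⌉₊ with hQ
  have hQ1 : 1 / η ≤ Q := Nat.le_ceil _
  have hQ2 : (Q : ℝ) ≤ 2 / η := by
    have h1 := (Nat.ceil_lt_add_one (show 0 ≤ 1 / η by positivity)).le
    have h2 : 1 ≤ 1 / η := by rw [le_div_iff₀ hη]; linarith
    calc (Q : ℝ) ≤ 1 / η + 1 := h1
      _ ≤ 1 / η + 1 / η := by gcongr
      _ = _ := by ring
  have hQpos : 0 < Q := Nat.ceil_pos.2 (by positivity)
  have hQη : 1 ≤ η * Q := by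
    rw [div_le_iff₀ hη] at hQ1; linarith
  have hQη2 : η * Q ≤ 2 := by
    rw [le_div_iff₀ hη] at hQ2; linarith
  have hterm : ∀ a θ, 0 ≤ fermi (tiltArg α η s a) * (1 - fermi (tiltArg α η s a))
        * (1 - Real.cos (θ * part α a)) := fun a θ => by
    rw [← fermiVar_eq]
    exact mul_nonneg (fermiVar_pos _).le (by linarith [Real.cos_le_one (θ * part α a)])
  -- For these parts y = η·part ≤ 16, so |`tiltArg`| ≤ 16 + (1 + 16)/2 < 25.
  have hG : ∀ a, part α a ≤ 8 * Q →
      Real.exp (-25) / 4 ≤ fermi (tiltArg α η s a) * (1 - fermi (tiltArg α η s a)) := by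
    intro a ha
    rw [← fermiVar_eq]
    refine le_trans ?_ (exp_neg_abs_le_fermiVar _)
    gcongr
    have hy := h.part_nonneg a
    have ha' : (part α a : ℝ) ≤ 8 * Q := by exact_mod_cast ha
    have hy2 : η * part α a ≤ 16 := by nlinarith
    have h1 := h.abs_mul_weight_le s a
    rw [tiltArg]
    refine (abs_sub _ _).trans ?_
    rw [abs_of_nonneg hy]
    nlinarith
  have hgen : ∀ K : ℕ, 1 ≤ K → K ≤ 4 * Q → Q ≤ K → ∀ᶠ M in atTop, ∀ θ : ℝ,
      Real.exp (-25) / (8 * α) * (η * vol α η)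
        * ∑ k ∈ Finset.Ioc K (2 * K), (1 - Real.cos (θ * k))
      ≤ ∑ a ∈ Finset.range M, fermi (tiltArg α η s a) * (1 - fermi (tiltArg α η s a))
        * (1 - Real.cos (θ * part α a)) := by
    intro K hK1 hK2 hK3
    filter_upwards [sum_Ioc_le_sum_part hα hα1 hK1] with M hM θ
    have hcos : ∀ k : ℕ, 0 ≤ 1 - Real.cos (θ * k) := fun k => by
      linarith [Real.cos_le_one (θ * k)]
    have h1 := hM (fun k => 1 - Real.cos (θ * k)) hcos
    -- Each size in the block has multiplicity at least of order K^{1/α - 1}, and η·`vol` =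
    -- (1/η)^{1/α - 1} with 1/η ≤ K.
    have h2 : η * vol α η ≤ (K : ℝ) ^ (1 / α - 1) := by
      have h3 : η * vol α η = (1 / η) ^ (1 / α - 1) := by
        rw [vol, one_div η, Real.inv_rpow hη.le, ← Real.rpow_neg hη.le, neg_sub,
          sub_eq_add_neg, Real.rpow_add hη, Real.rpow_one]
      rw [h3]
      refine Real.rpow_le_rpow (by positivity) (hQ1.trans ?_) hβ.le
      exact_mod_cast hK3
    calc _ ≤ Real.exp (-25) / 4 * (1 / α / 2 * (K : ℝ) ^ (1 / α - 1)
          * ∑ k ∈ Finset.Ioc K (2 * K), (1 - Real.cos (θ * k))) := by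
          have h4 : 0 ≤ ∑ k ∈ Finset.Ioc K (2 * K), (1 - Real.cos (θ * k)) :=
            Finset.sum_nonneg fun k _ => hcos k
          calc _ ≤ Real.exp (-25) / (8 * α) * (K : ℝ) ^ (1 / α - 1)
                * ∑ k ∈ Finset.Ioc K (2 * K), (1 - Real.cos (θ * k)) := by gcongr
            _ = _ := by field_simp; ring
      _ ≤ Real.exp (-25) / 4 * ∑ a ∈ Finset.range M with part α a ∈ Finset.Ioc K (2 * K),
          (1 - Real.cos (θ * part α a)) := by gcongr
      _ ≤ ∑ a ∈ Finset.range M with part α a ∈ Finset.Ioc K (2 * K),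
          fermi (tiltArg α η s a) * (1 - fermi (tiltArg α η s a))
          * (1 - Real.cos (θ * part α a)) := by
          rw [Finset.mul_sum]
          refine Finset.sum_le_sum fun a ha => ?_
          have := Finset.mem_Ioc.1 (Finset.mem_filter.1 ha).2
          exact mul_le_mul_of_nonneg_right (hG a (by omega)) (hcos _)
      _ ≤ _ := Finset.sum_le_sum_of_subset_of_nonneg (Finset.filter_subset _ _)
          fun a _ _ => hterm a θ
  have hV := vol_pos (α := α) hη
  have hpi := Real.pi_pos
  filter_upwards [hgen Q hQpos (by omega) le_rfl, hgen (4 * Q) (by omega) le_rfl (by omega)]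
    with M hM1 hM2 θ hθ
  -- The block of Q is used without wrap-around, that of 4Q with cancellation. The condition 2π ≤
  -- 4Q|θ| of the second case is what the failure of the first provides.
  rcases le_or_gt (|θ| * (2 * Q)) Real.pi with hsm | hlg
  · refine le_trans ?_ (hM1 θ)
    have h1 := sum_one_sub_cos_of_small hsm
    have hQ3 : 1 ≤ (η * Q) ^ 3 := one_le_pow₀ hQη
    calc _ ≤ Real.exp (-25) / (4 * α * Real.pi ^ 2) * vol α η * (θ / η) ^ 2 := by
          gcongr; exact min_le_right _ _
      _ ≤ Real.exp (-25) / (4 * α * Real.pi ^ 2) * vol α η * (θ / η) ^ 2 * (η * Q) ^ 3 :=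
          le_mul_of_one_le_right (by positivity) hQ3
      _ = Real.exp (-25) / (8 * α) * (η * vol α η) * (2 / Real.pi ^ 2 * Q ^ 3 * θ ^ 2) := by
          field_simp; ring
      _ ≤ _ := by gcongr
  · refine le_trans ?_ (hM2 θ)
    have h1 := sum_one_sub_cos_of_large (K := 4 * Q) (by omega) (θ := θ)
      (by push_cast; linarith) hθ
    have h2 : 1 / (4 * Real.pi ^ 2) ≤ η * Q / 4 := by
      rw [div_le_div_iff₀ (by positivity) (by norm_num)]
      nlinarith [Real.pi_gt_three]
    calc _ ≤ Real.exp (-25) / (4 * α * Real.pi ^ 2) * vol α η * 1 := by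
          gcongr; exact min_le_left _ _
      _ = Real.exp (-25) / α * vol α η * (1 / (4 * Real.pi ^ 2)) := by field_simp
      _ ≤ Real.exp (-25) / α * vol α η * (η * Q / 4) := by gcongr
      _ = Real.exp (-25) / (8 * α) * (η * vol α η) * ((4 * Q : ℕ) / 2) := by
          push_cast; field_simp; ring
      _ ≤ _ := by gcongr

end TiltBounds

/-! ### The partition function and its probabilistic representation -/

/-- The generating function `∑ e ^ (s ℓ)` over the restricted partitions of `n`. -/
noncomputable def partitionSum (α : ℝ) (n : ℕ) (s : ℝ) : ℝ :=
  ∑ᶠ S ∈ partitions α n, Real.exp (s * numSummands S)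

lemma partitionSum_eq {α : ℝ} (hα : 0 < α) (n : ℕ) (s : ℝ) :
    partitionSum α n s
      = ∑ S ∈ (partitions_finite hα n).toFinset, Real.exp (s * numSummands S) :=
  finsum_mem_eq_finite_toFinset_sum _ _

lemma integrableOn_count {A : Set (Finset ℕ)} (hA : A.Finite) (f : Finset ℕ → ℝ) :
    IntegrableOn f A Measure.count := by
  have h := (integrableOn_finite_biUnion (f := f) (μ := Measure.count) hA
    (t := fun S => {S})).2 fun S _ => by
      rw [integrableOn_singleton_iff]; right; simp
  rwa [Set.biUnion_of_singleton] at h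

lemma integrable_unif {α : ℝ} (hα : 0 < α) (n : ℕ) (f : Finset ℕ → ℝ) :
    Integrable f (unif α n) := by
  rw [unif, uniformOn, ProbabilityTheory.cond]
  have h : IntegrableOn f (partitions α n) Measure.count :=
    integrableOn_count (partitions_finite hα n) f
  rcases (partitions α n).eq_empty_or_nonempty with h0 | h0
  · rw [h0]; simp
  · exact h.integrable.smul_measure (by simpa using h0.ne_empty)

lemma integral_unif {α : ℝ} (hα : 0 < α) (n : ℕ) (f : Finset ℕ → ℝ) :
    ∫ S, f S ∂(unif α n)
      = (∑ S ∈ (partitions_finite hα n).toFinset, f S) / (partitions α n).ncard := by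
  have hfin := partitions_finite hα n
  rw [unif, uniformOn, ProbabilityTheory.cond, integral_smul_measure]
  have h : IntegrableOn f (hfin.toFinset : Set (Finset ℕ)) Measure.count :=
    integrableOn_count (Finset.finite_toSet _) f
  have h2 := setIntegral_finset _ h
  rw [hfin.coe_toFinset] at h2
  rw [h2, Measure.count_apply_finite _ hfin, Set.ncard_eq_toFinset_card _ hfin]
  simp [measureReal_def, div_eq_inv_mul]

lemma mgf_numSummands {α : ℝ} (hα : 0 < α) (n : ℕ) (s : ℝ) :
    mgf numSummands (unif α n) s = partitionSum α n s / partitionSum α n 0 := by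
  rw [mgf, integral_unif hα, partitionSum_eq hα, partitionSum_eq hα,
    Set.ncard_eq_toFinset_card _ (partitions_finite hα n)]
  simp

lemma partitionSum_pos {α : ℝ} (hα : 0 < α) (hα1 : α ≤ 1) {n : ℕ} (hn : 1 ≤ n) (s : ℝ) :
    0 < partitionSum α n s := by
  rw [partitionSum_eq hα]
  refine Finset.sum_pos (fun _ _ => Real.exp_pos _) ?_
  simpa using partitions_nonempty hα hα1 hn

lemma fermi_neg_eq (u : ℝ) : fermi (-u) = Real.exp (u - softplus u) := by
  rw [Real.exp_sub, exp_softplus, fermi, Real.exp_neg]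
  have := Real.exp_pos u
  field_simp

lemma one_sub_fermi_neg (u : ℝ) : 1 - fermi (-u) = Real.exp (-softplus u) := by
  rw [Real.exp_neg, exp_softplus, fermi, Real.exp_neg]
  have := Real.exp_pos u
  field_simp
  ring

lemma part_pred {α : ℝ} {a : ℕ} (ha : 1 ≤ a) : part α (a - 1) = ⌊(a : ℝ) ^ α⌋₊ := by
  rw [part, Nat.cast_sub ha]; simp

/-- The mass function of the size in the tilted model, in terms of the partition function. -/
lemma bernMass_tilt {α η s : ℝ} (hα : 0 < α) {n M : ℕ}
    (hM : ∀ S ∈ partitions α n, ∀ a ∈ S, a ≤ M) :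
    bernMass (Finset.range M) (fun a => fermi (tiltArg α η s a)) (part α) n
      = Real.exp (-(η + s * slope α η) * n) * partitionSum α n s
        * Real.exp (-∑ a ∈ Finset.range M, softplus (s * weight α η a - η * part α a)) := by
  set u : ℕ → ℝ := fun a => s * weight α η a - η * part α a with hu
  have harg : ∀ a, tiltArg α η s a = -u a := fun a => by rw [tiltArg, hu]; ring
  rw [bernMass, partitionSum_eq hα, Finset.mul_sum, Finset.sum_mul]
  -- Index a of the model stands for the integer a + 1, hence the shift.
  refine Finset.sum_bij (fun S _ => S.map (addRightEmbedding 1)) ?_ ?_ ?_ ?_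
  · intro S hS
    rw [Finset.mem_filter] at hS
    rw [Set.Finite.mem_toFinset]
    refine ⟨fun a ha => ?_, ?_⟩
    · obtain ⟨b, _, rfl⟩ := Finset.mem_map.1 ha
      simp
    · rw [Finset.sum_map, ← hS.2]
      refine Finset.sum_congr rfl fun a _ => ?_
      simp [part]
  · intro S _ T _ h
    exact Finset.map_injective _ h
  · intro T hT
    rw [Set.Finite.mem_toFinset] at hT
    refine ⟨T.image (fun a => a - 1), ?_, ?_⟩
    · rw [Finset.mem_filter, Finset.mem_powerset]
      constructor
      · intro b hb
        obtain ⟨a, ha, rfl⟩ := Finset.mem_image.1 hb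
        have := hM T hT a ha
        have := hT.1 a ha
        rw [Finset.mem_range]
        omega
      · rw [Finset.sum_image, ← hT.2]
        · exact Finset.sum_congr rfl fun a ha => part_pred (hT.1 a ha)
        · intro a ha b hb hab
          have h1 := hT.1 a ha
          have h2 := hT.1 b hb
          simp only at hab
          omega
    · ext b
      simp only [Finset.mem_map, Finset.mem_image, addRightEmbedding_apply]
      constructor
      · rintro ⟨_, ⟨a, ha, rfl⟩, rfl⟩
        rwa [Nat.sub_add_cancel (hT.1 a ha)]
      · intro hb
        exact ⟨b - 1, ⟨b, hb, rfl⟩, Nat.sub_add_cancel (hT.1 b hb)⟩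
  · intro S hS
    rw [Finset.mem_filter, Finset.mem_powerset] at hS
    -- A chosen index contributes e^{u - softplus u} and an omitted one e^{-softplus u}. The
    -- softplus terms thus run over the whole range, and u summed over the chosen set depends only
    -- on its cardinality and size.
    simp only [harg, one_sub_fermi_neg]
    simp only [fermi_neg_eq]
    rw [← Real.exp_sum, ← Real.exp_sum, ← Real.exp_add, ← Real.exp_add, ← Real.exp_add]
    congr 1
    rw [numSummands, Finset.card_map, ← Finset.sum_sdiff hS.1, ← hS.2, Finset.sum_sub_distrib]
    have e : ∑ a ∈ S, u a = s * S.card - (η + s * slope α η) * ∑ a ∈ S, (part α a : ℝ) := by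
      rw [Finset.mul_sum, mul_comm s, ← nsmul_eq_mul, ← Finset.sum_const,
        ← Finset.sum_sub_distrib]
      refine Finset.sum_congr rfl fun a _ => ?_
      simp only [hu, weight]; ring
    rw [e]
    push_cast
    rw [Finset.sum_neg_distrib]
    ring

/-- The probability of size `n` in the tilted model. -/
noncomputable def tiltMass (α η s : ℝ) (n : ℕ) : ℝ :=
  Real.exp (-(η + s * slope α η) * n) * partitionSum α n s
    * Real.exp (-∑' a, softplus (s * weight α η a - η * part α a))

namespace TiltBounds

variable {α η C s : ℝ} (h : TiltBounds α η C)
include h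

/-- The local limit theorem for the size in the tilted model. -/
lemma abs_tiltMass_sub_le (hs : C * |s| ≤ 1 / 2) (hα : 0 < α) (hα1 : α < 1) (n : ℕ) {θ₀ : ℝ}
    (hθ0 : 0 ≤ θ₀) (hθπ : θ₀ < Real.pi) (hB : 0 < tiltMoment α η s 2) :
    |2 * Real.pi * tiltMass α η s n - √(2 * Real.pi / tiltMoment α η s 2)
        * Real.exp (-(n - tiltMean α η s) ^ 2 / (2 * tiltMoment α η s 2))|
      ≤ 10 * tiltMoment α η s 3 * θ₀ ^ 4
        + 2 * Real.pi * Real.exp (-(Real.exp (-25) / (4 * α * Real.pi ^ 2) * vol α η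
          * min 1 ((θ₀ / η) ^ 2)))
        + Real.exp (-(θ₀ ^ 2 * tiltMoment α η s 2 / 4)) * √(4 * Real.pi / tiltMoment α η s 2) := by
  have hη := h.pos
  set p : ℕ → ℝ := fun a => fermi (tiltArg α η s a) with hp
  have hpq : ∀ j a, p a * (1 - p a) * part α a ^ j = fermiVar (tiltArg α η s a) * part α a ^ j :=
    fun j a => by rw [hp, fermiVar_eq]
  have hm := (h.summable_tiltMean hs hα).hasSum.tendsto_sum_nat
  have hB2 := (h.summable_tiltMoment hs hα (j := 2) (by norm_num)).hasSum.tendsto_sum_nat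
  have hL := (h.summable_tiltMoment hs hα (j := 3) (by norm_num)).hasSum.tendsto_sum_nat
  have hsp := (h.summable_softplus hs hα).hasSum.tendsto_sum_nat
  -- The finite local limit theorem is applied to the first M indices and M tends to infinity. Once
  -- M exceeds all members of partitions of n, only the normalising product still depends on M.
  have hMM : ∀ᶠ M : ℕ in atTop, ∀ S ∈ partitions α n, ∀ a ∈ S, a ≤ M := by
    obtain ⟨M₀, hM₀⟩ := ((partitions_finite hα n).image (fun S => S.sup id)).bddAbove
    filter_upwards [eventually_ge_atTop M₀] with M hM S hS a ha
    exact (Finset.le_sup (f := id) ha).trans ((hM₀ (Set.mem_image_of_mem _ hS)).trans hM)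
  have hP : Tendsto (fun M => bernMass (Finset.range M) p (part α) n) atTop
      (𝓝 (tiltMass α η s n)) := by
    refine Tendsto.congr' ?_ (((Real.continuous_exp.tendsto _).comp hsp.neg).const_mul
      (Real.exp (-(η + s * slope α η) * n) * partitionSum α n s))
    filter_upwards [hMM] with M hM
    rw [bernMass_tilt hα hM]
    rfl
  have hleft : Tendsto (fun M => |2 * Real.pi * bernMass (Finset.range M) p (part α) n
      - √(2 * Real.pi / ∑ a ∈ Finset.range M, p a * (1 - p a) * part α a ^ 2)
        * Real.exp (-(n - ∑ a ∈ Finset.range M, p a * part α a) ^ 2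
          / (2 * ∑ a ∈ Finset.range M, p a * (1 - p a) * part α a ^ 2))|) atTop
      (𝓝 |2 * Real.pi * tiltMass α η s n - √(2 * Real.pi / tiltMoment α η s 2)
        * Real.exp (-(n - tiltMean α η s) ^ 2 / (2 * tiltMoment α η s 2))|) := by
    simp only [hpq]
    refine ((hP.const_mul _).sub (Tendsto.mul ?_ ?_)).abs
    · exact (Real.continuous_sqrt.tendsto _).comp (tendsto_const_nhds.div hB2 hB.ne')
    · refine (Real.continuous_exp.tendsto _).comp (Tendsto.div ?_ (hB2.const_mul 2)
        (mul_pos two_pos hB).ne')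
      exact ((hm.const_sub _).pow 2).neg
  have hright : Tendsto (fun M => 10 * (∑ a ∈ Finset.range M, p a * (1 - p a) * part α a ^ 3)
        * θ₀ ^ 4 + 2 * Real.pi * Real.exp (-(Real.exp (-25) / (4 * α * Real.pi ^ 2) * vol α η
          * min 1 ((θ₀ / η) ^ 2)))
        + Real.exp (-(θ₀ ^ 2 * (∑ a ∈ Finset.range M, p a * (1 - p a) * part α a ^ 2) / 4))
        * √(4 * Real.pi / (∑ a ∈ Finset.range M, p a * (1 - p a) * part α a ^ 2))) atTop
      (𝓝 (10 * tiltMoment α η s 3 * θ₀ ^ 4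
        + 2 * Real.pi * Real.exp (-(Real.exp (-25) / (4 * α * Real.pi ^ 2) * vol α η
          * min 1 ((θ₀ / η) ^ 2)))
        + Real.exp (-(θ₀ ^ 2 * tiltMoment α η s 2 / 4))
          * √(4 * Real.pi / tiltMoment α η s 2))) := by
    simp only [hpq]
    refine (((hL.const_mul _).mul_const _).add tendsto_const_nhds).add (Tendsto.mul ?_ ?_)
    · exact (Real.continuous_exp.tendsto _).comp ((hB2.const_mul _).div_const _).neg
    · exact (Real.continuous_sqrt.tendsto _).comp (tendsto_const_nhds.div hB2 hB.ne')
  refine le_of_tendsto_of_tendsto hleft hright ?_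
  have hBpos : ∀ᶠ M in atTop, 0 < ∑ a ∈ Finset.range M, p a * (1 - p a) * part α a ^ 2 := by
    simp only [hpq]
    exact hB2.eventually_const_lt hB
  filter_upwards [h.minor_arc hs hα hα1, hBpos] with M hM hBM
  refine abs_bernMass_sub_le n (fun a => (fermi_pos _).le) (fun a => (fermi_lt_one _).le) hθ0 hθπ
    rfl rfl hBM fun θ h1 h2 => le_trans ?_ (hM θ h2)
  have hV := vol_pos (α := α) hη
  gcongr _ * min _ ?_
  rw [div_pow, div_pow, ← sq_abs θ]
  gcongr

end TiltBounds

lemma abs_log_le_two_mul {x : ℝ} (h : |x - 1| ≤ 1 / 2) : |Real.log x| ≤ 2 * |x - 1| := by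
  have h1 := abs_le.1 h
  have hx : 0 < x := by linarith
  have h2 := Real.log_le_sub_one_of_pos hx
  have h3 := Real.one_sub_inv_le_log_of_pos hx
  have h4 : -(2 * |x - 1|) ≤ 1 - x⁻¹ := by
    have : 1 - x⁻¹ = (x - 1) / x := by field_simp
    rw [this, le_div_iff₀ hx]
    nlinarith [neg_abs_le (x - 1), abs_nonneg (x - 1)]
  rw [abs_le]
  exact ⟨by linarith, by linarith [le_abs_self (x - 1), abs_nonneg (x - 1)]⟩

lemma exp_neg_mul_sq_le {c U : ℝ} (hc : 0 < c) (hU : 0 < U) (j : ℕ) :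
    Real.exp (-(c * U ^ 2)) ≤ j.factorial / c ^ j / U ^ (2 * j) := by
  have h := Real.pow_div_factorial_le_exp (x := c * U ^ 2) (by positivity) j
  rw [Real.exp_neg, inv_eq_one_div, div_div, div_le_div_iff₀ (Real.exp_pos _) (by positivity)]
  rw [div_le_iff₀ (by positivity), mul_pow, ← pow_mul] at h
  linarith

/-- Bookkeeping of exponents with U = V^{1/16}. The cutoff is θ₀ = η/U⁷. Then B ~ U¹⁶/η² gives θ₀²B
~ U², so the tails beyond θ₀ decay like e^{-cU²}. The cubic error Lθ₀⁴√B ~ (U¹⁶/η³)(η⁴/U²⁸)(U⁸/η) is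
U⁻⁴, and so is d²/B for a shift d ~ U⁶/η. -/
lemma abs_normalized_mass_sub_one_le {C c : ℝ} (hC : 1 ≤ C) (hc : 0 < c) :
    ∃ A, ∀ U η B L T d : ℝ, 1 ≤ U → 0 < η → 1 / η ≤ U ^ 16 → U ^ 16 ≤ 2 * C * (η ^ 2 * B) →
      η ^ 2 * B ≤ 2 * C * U ^ 16 → L ≤ 2 * C * U ^ 16 / η ^ 3 → |d| ≤ 2 * C ^ 3 * U ^ 6 / η →
      |2 * Real.pi * T - √(2 * Real.pi / B) * Real.exp (-d ^ 2 / (2 * B))|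
        ≤ 10 * L * (η / U ^ 7) ^ 4
          + 2 * Real.pi * Real.exp (-(c * U ^ 16 * min 1 ((η / U ^ 7 / η) ^ 2)))
          + Real.exp (-((η / U ^ 7) ^ 2 * B / 4)) * √(4 * Real.pi / B) →
      |√(2 * Real.pi * B) * T - 1| ≤ A / U ^ 4 := by
  refine ⟨40 * C ^ 2 + 4 * Real.pi * C * ((14 : ℕ).factorial / c ^ 14)
    + 2 * ((2 : ℕ).factorial / (1 / (8 * C)) ^ 2) + 4 * C ^ 7, ?_⟩
  intro U η B L T d hU hη hηU hB1 hB2 hL hd hmain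
  have hC0 : 0 < C := by linarith
  have hU0 : 0 < U := by linarith
  have hpi := Real.pi_pos
  have hB : 0 < B := by
    by_contra hcon
    have h1 : η ^ 2 * B ≤ 0 := mul_nonpos_of_nonneg_of_nonpos (by positivity) (not_lt.1 hcon)
    have h2 : 2 * C * (η ^ 2 * B) ≤ 0 := mul_nonpos_of_nonneg_of_nonpos (by positivity) h1
    have h3 : 0 < U ^ 16 := by positivity
    linarith
  set N := √(B / (2 * Real.pi)) with hN
  have hN0 : 0 ≤ N := Real.sqrt_nonneg _
  have hN1 : N * (2 * Real.pi) = √(2 * Real.pi * B) := by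
    rw [hN, ← Real.sqrt_sq (show 0 ≤ 2 * Real.pi by positivity), ← Real.sqrt_mul (by positivity)]
    rw [Real.sqrt_sq (by positivity)]
    congr 1
    field_simp
  have hN2 : N * √(2 * Real.pi / B) = 1 := by
    rw [hN, ← Real.sqrt_mul (by positivity), div_mul_div_comm, mul_comm B, div_self (by positivity),
      Real.sqrt_one]
  have hN3 : N * √(4 * Real.pi / B) ≤ 2 := by
    rw [hN, ← Real.sqrt_mul (by positivity)]
    refine Real.sqrt_le_iff.2 ⟨by norm_num, ?_⟩
    rw [div_mul_div_comm, div_le_iff₀ (by positivity)]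
    nlinarith [mul_pos hB hpi]
  have hN4 : N ≤ 2 * C * U ^ 8 / η := by
    refine Real.sqrt_le_iff.2 ⟨by positivity, ?_⟩
    rw [div_pow, div_le_div_iff₀ (by positivity) (by positivity)]
    have h1 : 1 ≤ 2 * C * (2 * Real.pi) := by nlinarith [Real.pi_gt_three]
    calc B * η ^ 2 ≤ 2 * C * U ^ 16 := by linarith
      _ ≤ 2 * C * U ^ 16 * (2 * C * (2 * Real.pi)) := le_mul_of_one_le_right (by positivity) h1
      _ = _ := by ring
  have e1 : √(2 * Real.pi * B) * T - Real.exp (-d ^ 2 / (2 * B))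
      = N * (2 * Real.pi * T - √(2 * Real.pi / B) * Real.exp (-d ^ 2 / (2 * B))) := by
    rw [← hN1]
    linear_combination (Real.exp (-d ^ 2 / (2 * B))) * hN2
  have hmin : min 1 ((η / U ^ 7 / η) ^ 2) = 1 / U ^ 14 := by
    have h1 : (η / U ^ 7 / η) ^ 2 = 1 / U ^ 14 := by field_simp
    rw [h1, min_eq_right]
    rw [div_le_one (by positivity)]
    exact one_le_pow₀ hU
  have t1 : N * (10 * L * (η / U ^ 7) ^ 4) ≤ 40 * C ^ 2 / U ^ 4 := by
    calc N * (10 * L * (η / U ^ 7) ^ 4)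
        ≤ N * (10 * (2 * C * U ^ 16 / η ^ 3) * (η / U ^ 7) ^ 4) := by gcongr
      _ ≤ (2 * C * U ^ 8 / η) * (10 * (2 * C * U ^ 16 / η ^ 3) * (η / U ^ 7) ^ 4) := by gcongr
      _ = _ := by field_simp; ring
  have t2 : N * (2 * Real.pi * Real.exp (-(c * U ^ 16 * min 1 ((η / U ^ 7 / η) ^ 2))))
      ≤ 4 * Real.pi * C * ((14 : ℕ).factorial / c ^ 14) / U ^ 4 := by
    have h1 : c * U ^ 16 * (1 / U ^ 14) = c * U ^ 2 := by field_simp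
    rw [hmin, h1]
    -- The factor 1/η in the bound for N is replaced by U¹⁶, so U^{24} must be beaten with U⁻⁴ to
    -- spare: 28 = 2·14.
    calc _ ≤ (2 * C * U ^ 8 * U ^ 16) * (2 * Real.pi
          * ((14 : ℕ).factorial / c ^ 14 / U ^ (2 * 14))) := by
          gcongr
          · refine hN4.trans ?_
            rw [div_eq_mul_one_div]
            gcongr
          · exact exp_neg_mul_sq_le hc hU0 14
      _ = _ := by field_simp; ring
  have t3 : N * (Real.exp (-((η / U ^ 7) ^ 2 * B / 4)) * √(4 * Real.pi / B))
      ≤ 2 * ((2 : ℕ).factorial / (1 / (8 * C)) ^ 2) / U ^ 4 := by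
    have h1 : 1 / (8 * C) * U ^ 2 ≤ (η / U ^ 7) ^ 2 * B / 4 := by
      have : (η / U ^ 7) ^ 2 * B / 4 = η ^ 2 * B / (4 * U ^ 14) := by field_simp
      rw [this, le_div_iff₀ (by positivity)]
      calc 1 / (8 * C) * U ^ 2 * (4 * U ^ 14) = U ^ 16 / (2 * C) := by field_simp; ring
        _ ≤ _ := by rw [div_le_iff₀ (by positivity)]; linarith
    calc _ = (N * √(4 * Real.pi / B)) * Real.exp (-((η / U ^ 7) ^ 2 * B / 4)) := by ring
      _ ≤ 2 * Real.exp (-(1 / (8 * C) * U ^ 2)) := by gcongr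
      _ ≤ 2 * ((2 : ℕ).factorial / (1 / (8 * C)) ^ 2 / U ^ (2 * 2)) := by
          gcongr
          exact exp_neg_mul_sq_le (by positivity) hU0 2
      _ = _ := by ring
  have t4 : |Real.exp (-d ^ 2 / (2 * B)) - 1| ≤ 4 * C ^ 7 / U ^ 4 := by
    have h0 : 0 ≤ d ^ 2 / (2 * B) := by positivity
    have h1 := Real.add_one_le_exp (-d ^ 2 / (2 * B))
    have h2 : Real.exp (-d ^ 2 / (2 * B)) ≤ 1 := by
      rw [Real.exp_le_one_iff, neg_div]; linarith
    rw [abs_sub_comm, abs_of_nonneg (by linarith)]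
    have h3 : d ^ 2 / (2 * B) ≤ 4 * C ^ 7 / U ^ 4 := by
      rw [div_le_div_iff₀ (by positivity) (by positivity)]
      have h4 : d ^ 2 ≤ (2 * C ^ 3 * U ^ 6 / η) ^ 2 := by
        rw [← sq_abs]; gcongr
      calc d ^ 2 * U ^ 4 ≤ (2 * C ^ 3 * U ^ 6 / η) ^ 2 * U ^ 4 := by gcongr
        _ = 4 * C ^ 6 * U ^ 16 / η ^ 2 := by field_simp; ring
        _ ≤ 4 * C ^ 6 * (2 * C * (η ^ 2 * B)) / η ^ 2 := by gcongr
        _ = _ := by field_simp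
    rw [neg_div] at h1 ⊢
    linarith
  calc |√(2 * Real.pi * B) * T - 1|
      = |(√(2 * Real.pi * B) * T - Real.exp (-d ^ 2 / (2 * B)))
        + (Real.exp (-d ^ 2 / (2 * B)) - 1)| := by congr 1; ring
    _ ≤ |√(2 * Real.pi * B) * T - Real.exp (-d ^ 2 / (2 * B))|
        + |Real.exp (-d ^ 2 / (2 * B)) - 1| := abs_add_le _ _
    _ ≤ N * (10 * L * (η / U ^ 7) ^ 4
          + 2 * Real.pi * Real.exp (-(c * U ^ 16 * min 1 ((η / U ^ 7 / η) ^ 2)))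
          + Real.exp (-((η / U ^ 7) ^ 2 * B / 4)) * √(4 * Real.pi / B)) + 4 * C ^ 7 / U ^ 4 := by
        rw [e1, abs_mul, abs_of_nonneg hN0]
        gcongr
    _ ≤ _ := by
        rw [mul_add, mul_add, add_div, add_div, add_div]
        gcongr

namespace TiltBounds

variable {α C : ℝ}

/-- Allows powers of 1/η to be traded for powers of U, and makes U large as η tends to 0. -/
lemma one_div_le_vol {η : ℝ} (hα : 0 < α) (hα1 : α < 1) (h0 : 0 < η) (h1 : η ≤ 1) :
    1 / η ≤ vol α η := by
  have : 1 ≤ 1 / α := by rw [le_div_iff₀ hα]; linarith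
  rw [vol, one_div η, ← Real.rpow_neg_one]
  exact Real.rpow_le_rpow_of_exponent_ge h0 h1 (by linarith)

/-- The size has asymptotically Gaussian mass at `n` in all the tilted models, with variance
close to the untilted one. -/
lemma exists_tiltMass_bound (hα : 0 < α) (hα1 : α < 1) (hC : 1 ≤ C) :
    ∃ A U₀ : ℝ, ∀ (η U s : ℝ) (n : ℕ), TiltBounds α η C → vol α η = U ^ 16 → U₀ ≤ U → 1 ≤ U →
      meanSize α η = n → |s| * U ^ 5 ≤ 1 →
      C * |s| ≤ 1 / 2 ∧ 0 < tiltMoment α η s 2 ∧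
      |√(2 * Real.pi * tiltMoment α η s 2) * tiltMass α η s n - 1| ≤ A / U ^ 4 ∧
      |tiltMoment α η s 2 / momentSum α η 2 - 1| ≤ 2 * C ^ 3 / U ^ 4 := by
  obtain ⟨A, hA⟩ := abs_normalized_mass_sub_one_le hC
    (show 0 < Real.exp (-25) / (4 * α * Real.pi ^ 2) by have := Real.pi_pos; positivity)
  -- U ≥ 4C³ gives 4C³|s| ≤ 1, so tilting changes η² times the second moment by at most V/(2C), half
  -- of its lower bound.
  refine ⟨A, 4 * C ^ 3, ?_⟩
  intro η U s n h hV hU0 hU1 hn hs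
  have hη := h.pos
  have hC0 := h.C_pos
  have hU : 0 < U := by linarith
  have hM2 := momentSum_pos hα hη 2
  have hs5 : |s| ≤ 1 / U ^ 5 := by rw [le_div_iff₀ (by positivity)]; exact hs
  have hC3 : C ≤ C ^ 3 := by nlinarith [sq_nonneg (C - 1)]
  have hs1 : |s| * (4 * C ^ 3) ≤ 1 := by
    calc |s| * (4 * C ^ 3) ≤ |s| * U ^ 5 := by
          gcongr
          exact hU0.trans (le_self_pow₀ hU1 (by norm_num))
      _ ≤ 1 := hs
  have hsC : C * |s| ≤ 1 / 2 := by nlinarith [abs_nonneg s]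
  have hdiff := h.abs_tiltMoment_two_sub_le hsC hα
  have hV0 := vol_pos (α := α) hη
  have hdiff2 : |η ^ 2 * tiltMoment α η s 2 - η ^ 2 * momentSum α η 2|
      ≤ 2 * C ^ 2 * |s| * vol α η := by
    rw [← mul_sub, abs_mul, abs_of_pos (by positivity : 0 < η ^ 2)]
    calc _ ≤ η ^ 2 * (2 * C ^ 2 * |s| * vol α η / η ^ 2) := by gcongr
      _ = _ := by field_simp
  have hhalf : C * (2 * C ^ 2 * |s| * vol α η) ≤ vol α η / 2 := by
    calc _ = |s| * (4 * C ^ 3) * (vol α η / 2) := by ring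
      _ ≤ 1 * (vol α η / 2) := by gcongr
      _ = _ := one_mul _
  have hab := abs_le.1 hdiff2
  have hlow : vol α η ≤ 2 * C * (η ^ 2 * tiltMoment α η s 2) := by
    have h1 := h.le_momentSum
    have h2 : C * (η ^ 2 * momentSum α η 2 - η ^ 2 * tiltMoment α η s 2)
        ≤ C * (2 * C ^ 2 * |s| * vol α η) := by gcongr; linarith
    linarith
  have hup : η ^ 2 * tiltMoment α η s 2 ≤ 2 * C * vol α η := by
    have h1 := h.momentSum_le
    have h2 : 2 * C ^ 2 * |s| * vol α η ≤ C * (2 * C ^ 2 * |s| * vol α η) :=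
      le_mul_of_one_le_left (by positivity) hC
    have h3 : vol α η ≤ C * vol α η := le_mul_of_one_le_left hV0.le hC
    linarith
  have hB : 0 < tiltMoment α η s 2 := by
    by_contra hcon
    have h1 : η ^ 2 * tiltMoment α η s 2 ≤ 0 :=
      mul_nonpos_of_nonneg_of_nonpos (by positivity) (not_lt.1 hcon)
    have h2 := mul_nonpos_of_nonneg_of_nonpos (show 0 ≤ 2 * C by positivity) h1
    linarith
  refine ⟨hsC, hB, ?_, ?_⟩
  · refine hA U η (tiltMoment α η s 2) (tiltMoment α η s 3) (tiltMass α η s n)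
      (n - tiltMean α η s) hU1 hη (hV ▸ one_div_le_vol hα hα1 hη h.le_one) (hV ▸ hlow)
      (hV ▸ hup) (hV ▸ h.tiltMoment_three_le hsC hα) ?_ ?_
    · rw [abs_sub_comm, ← hn]
      refine (h.abs_tiltMean_sub_le hsC hα).trans ?_
      rw [hV]
      calc _ ≤ 2 * C ^ 3 * (1 / U ^ 5) ^ 2 * U ^ 16 / η := by gcongr
        _ = _ := by field_simp
    · have := h.abs_tiltMass_sub_le hsC hα hα1 n (θ₀ := η / U ^ 7) (by positivity) ?_ hB
      · rw [hV] at this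
        exact this
      · refine lt_of_le_of_lt ?_ (lt_trans (by norm_num : (1 : ℝ) < 3) Real.pi_gt_three)
        rw [div_le_one (by positivity)]
        exact h.le_one.trans (one_le_pow₀ hU1)
  · have e : tiltMoment α η s 2 / momentSum α η 2 - 1
        = (η ^ 2 * tiltMoment α η s 2 - η ^ 2 * momentSum α η 2) / (η ^ 2 * momentSum α η 2) := by
      field_simp
    have hpos : 0 < η ^ 2 * momentSum α η 2 := by positivity
    rw [e, abs_div, abs_of_pos hpos, div_le_iff₀ hpos]
    refine hdiff2.trans ?_
    have hU54 : 1 / U ^ 5 ≤ 1 / U ^ 4 := by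
      gcongr
      norm_num
    calc 2 * C ^ 2 * |s| * vol α η ≤ 2 * C ^ 2 * (1 / U ^ 4)
          * (C * (η ^ 2 * momentSum α η 2)) := by
          gcongr
          · exact hs5.trans hU54
          · exact h.le_momentSum
      _ = _ := by ring

end TiltBounds

/-- Take logarithms in the definition of `tiltMass` at s and at 0 and subtract: the number of
partitions normalises the mgf, and the common term ηn cancels. -/
lemma log_partitionSum_sub {α η C s : ℝ} (h : TiltBounds α η C) (hs : C * |s| ≤ 1 / 2)
    (hα : 0 < α) (hα1 : α < 1) {n : ℕ} (hn : 1 ≤ n) :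
    Real.log (mgf numSummands (unif α n) s)
      = Real.log (tiltMass α η s n) - Real.log (tiltMass α η 0 n) + s * slope α η * n
        + tiltCumulant α η s := by
  have hZ : ∀ t, 0 < partitionSum α n t := partitionSum_pos hα hα1.le hn
  have hlog : ∀ t, Real.log (tiltMass α η t n) = -(η + t * slope α η) * n
      + Real.log (partitionSum α n t)
      - ∑' a, softplus (t * weight α η a - η * part α a) := fun t => by
    rw [tiltMass, Real.log_mul (mul_ne_zero (Real.exp_ne_zero _) (hZ t).ne') (Real.exp_ne_zero _),
      Real.log_mul (Real.exp_ne_zero _) (hZ t).ne', Real.log_exp, Real.log_exp]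
    ring
  have hcum : tiltCumulant α η s = ∑' a, softplus (s * weight α η a - η * part α a)
      - ∑' a, softplus (0 * weight α η a - η * part α a) := by
    rw [← (h.summable_softplus hs hα).tsum_sub (h.summable_softplus (s := 0) (by simp) hα)]
    simp [tiltCumulant]
  rw [mgf_numSummands hα, Real.log_div (hZ s).ne' (hZ 0).ne', hlog, hlog, hcum]
  ring

/-- The cumulant generating function of the number of summands is asymptotically Gaussian. -/
theorem exists_log_mgf_bound {α : ℝ} (hα : 0 < α) (hα1 : α < 1) :
    ∃ A : ℝ, 0 ≤ A ∧ ∀ᶠ η in 𝓝[>] 0, ∀ n : ℕ, 1 ≤ n → meanSize α η = n → ∀ s : ℝ,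
      |s| * vol α η ^ (5 / 16 : ℝ) ≤ 1 →
      |Real.log (mgf numSummands (unif α n) s) - (s * mu α η + s ^ 2 * sigmaSq α η / 2)|
        ≤ A * (|s| ^ 3 * vol α η + vol α η ^ (-(1 / 4) : ℝ)) := by
  obtain ⟨C, hC⟩ := exists_tiltBounds hα
  obtain ⟨η₁, hη₁⟩ := hC.exists
  have hC1 := hη₁.one_le
  obtain ⟨A, U₀, hA⟩ := TiltBounds.exists_tiltMass_bound hα hα1 hC1
  set A' := max A 0 with hA'
  -- The last entry makes both relative errors at most 1/2, so that log x is controlled by x - 1.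
  set U₁ := max (max U₀ 1) (2 * A' + 4 * C ^ 3) with hU₁
  have hU₁1 : 1 ≤ U₁ := (le_max_right _ _).trans (le_max_left _ _)
  refine ⟨2 * C ^ 4 + 4 * A' + 2 * C ^ 3, by positivity, ?_⟩
  filter_upwards [hC, Ioc_mem_nhdsGT (show 0 < 1 / U₁ ^ 16 by positivity)] with η h hηU n hn hmean
    s hs
  have hη := h.pos
  have hC0 := h.C_pos
  have hV := vol_pos (α := α) hη
  set U := vol α η ^ (1 / 16 : ℝ) with hU
  have hU0 : 0 < U := by positivity
  have hVU : vol α η = U ^ 16 := by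
    rw [hU, ← Real.rpow_natCast, ← Real.rpow_mul hV.le]; norm_num
  have hU5 : vol α η ^ (5 / 16 : ℝ) = U ^ 5 := by
    rw [hU, ← Real.rpow_natCast, ← Real.rpow_mul hV.le]; norm_num
  have hU4 : vol α η ^ (-(1 / 4) : ℝ) = 1 / U ^ 4 := by
    rw [hU, ← Real.rpow_natCast, ← Real.rpow_mul hV.le, Real.rpow_neg hV.le, one_div]; norm_num
  have hUU : U₁ ≤ U := by
    refine le_of_pow_le_pow_left₀ (n := 16) (by norm_num) hU0.le ?_
    rw [← hVU]
    refine le_trans ?_ (TiltBounds.one_div_le_vol hα hα1 hη h.le_one)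
    rw [le_div_iff₀ hη]
    have := hηU.2
    rw [le_div_iff₀ (by positivity)] at this
    linarith
  have hU1 : 1 ≤ U := hU₁1.trans hUU
  have hUb : 2 * A' + 4 * C ^ 3 ≤ U ^ 4 :=
    (le_max_right _ _).trans (hUU.trans (le_self_pow₀ hU1 (by norm_num)))
  have hUa : U₀ ≤ U := ((le_max_left _ _).trans (le_max_left _ _)).trans hUU
  obtain ⟨hs1, hB1, hT1, hM1⟩ := hA η U s n h hVU hUa hU1 hmean (hU5 ▸ hs)
  obtain ⟨-, hB0, hT0, hM0⟩ := hA η U 0 n h hVU hUa hU1 hmean (by simp)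
  have hM2 := momentSum_pos hα hη 2
  have hAA : A / U ^ 4 ≤ A' / U ^ 4 := by gcongr; exact le_max_left _ _
  have hA'0 : 0 ≤ A' := le_max_right _ _
  have hC3 : 0 < C ^ 3 := by positivity
  have hsmall1 : A' / U ^ 4 ≤ 1 / 2 := by
    rw [div_le_div_iff₀ (by positivity) two_pos]; linarith
  have hsmall2 : 2 * C ^ 3 / U ^ 4 ≤ 1 / 2 := by
    rw [div_le_div_iff₀ (by positivity) two_pos]; linarith
  -- Each log mass is compared with -log(2π·`momentSum α η 2`)/2, which does not depend on t and
  -- hence drops out of the difference between t = s and t = 0.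
  have key : ∀ t, 0 < tiltMoment α η t 2 →
      |√(2 * Real.pi * tiltMoment α η t 2) * tiltMass α η t n - 1| ≤ A / U ^ 4 →
      |tiltMoment α η t 2 / momentSum α η 2 - 1| ≤ 2 * C ^ 3 / U ^ 4 →
      |Real.log (tiltMass α η t n) + Real.log (2 * Real.pi * momentSum α η 2) / 2|
        ≤ (2 * A' + 2 * C ^ 3) / U ^ 4 := by
    intro t hB hT hM
    have hpi := Real.pi_pos
    have hT' := hT.trans hAA
    have hsq : 0 < √(2 * Real.pi * tiltMoment α η t 2) := Real.sqrt_pos.2 (by positivity)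
    have hTpos : 0 < tiltMass α η t n := by
      have := (abs_le.1 (hT'.trans hsmall1)).1
      by_contra hcon
      have := mul_nonpos_of_nonneg_of_nonpos hsq.le (not_lt.1 hcon)
      linarith
    have l1 := abs_log_le_two_mul (hT'.trans hsmall1)
    have l2 := abs_log_le_two_mul (hM.trans hsmall2)
    rw [Real.log_mul hsq.ne' hTpos.ne', Real.log_sqrt (by positivity),
      Real.log_mul (by positivity) hB.ne'] at l1
    rw [Real.log_div hB.ne' hM2.ne'] at l2
    rw [Real.log_mul (by positivity) hM2.ne']
    have l3 := abs_le.1 l1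
    have l4 := abs_le.1 l2
    have e : (2 * A' + 2 * C ^ 3) / U ^ 4 = 2 * (A' / U ^ 4) + 2 * C ^ 3 / U ^ 4 := by ring
    rw [e, abs_le]
    constructor <;> linarith
  have k1 := abs_le.1 (key s hB1 hT1 hM1)
  have k0 := abs_le.1 (key 0 hB0 hT0 hM0)
  have hcum := abs_le.1 (h.abs_tiltCumulant_sub_le hs1 hα)
  rw [log_partitionSum_sub h hs1 hα hα1 hn, hU4]
  rw [hmean] at hcum
  have e : (2 * C ^ 4 + 4 * A' + 2 * C ^ 3) * (|s| ^ 3 * vol α η + 1 / U ^ 4)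
      = 2 * C ^ 4 * |s| ^ 3 * vol α η + (4 * A' + 2 * C ^ 3) * (|s| ^ 3 * vol α η)
        + (2 * C ^ 4 + 4 * A' + 2 * C ^ 3) / U ^ 4 := by ring
  have e2 : (2 * A' + 2 * C ^ 3) / U ^ 4 + (2 * A' + 2 * C ^ 3) / U ^ 4
      ≤ (2 * C ^ 4 + 4 * A' + 2 * C ^ 3) / U ^ 4 := by
    rw [← add_div]
    refine div_le_div_of_nonneg_right ?_ (by positivity)
    linarith [pow_le_pow_right₀ hC1 (show 3 ≤ 4 by norm_num)]
  have e3 : 0 ≤ (4 * A' + 2 * C ^ 3) * (|s| ^ 3 * vol α η) := by positivity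
  rw [e, abs_le]
  constructor <;> linarith

/-! ### From convergence of moment generating functions to moments and distribution functions. -/

lemma sq_le_exp_add_exp_neg (u : ℝ) : u ^ 2 ≤ Real.exp u + Real.exp (-u) - 2 := by
  have h1 : Real.exp u + Real.exp (-u) - 2 = 4 * Real.sinh (u / 2) ^ 2 := by
    have e1 : Real.exp u = Real.exp (u / 2) ^ 2 := by rw [← Real.exp_nat_mul]; congr 1; push_cast; ring
    have e2 : Real.exp (-u) = Real.exp (-(u / 2)) ^ 2 := by
      rw [← Real.exp_nat_mul]; congr 1; push_cast; ring
    have e3 : Real.exp (u / 2) * Real.exp (-(u / 2)) = 1 := by rw [← Real.exp_add]; simp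
    rw [Real.sinh_eq, e1, e2]
    linear_combination (2 : ℝ) * e3
  have h2 : |u / 2| ≤ |Real.sinh (u / 2)| := by
    rw [Real.abs_sinh]
    exact Real.self_le_sinh_iff.2 (abs_nonneg _)
  have h3 := sq_le_sq.2 h2
  rw [h1]
  nlinarith

/-- Taylor expansion of e^u and e^{-u} to third order; the odd terms cancel. -/
lemma exp_add_exp_neg_le (u : ℝ) :
    Real.exp u + Real.exp (-u) - 2 ≤ u ^ 2 + 2 * u ^ 4 * Real.exp |u| := by
  have key : ∀ v : ℝ, Real.exp v - (1 + v + v ^ 2 / 2 + v ^ 3 / 6) ≤ |v| ^ 4 * Real.exp |v| := by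
    intro v
    have h := Complex.norm_exp_sub_sum_le_norm_mul_exp (v : ℂ) 4
    have e : Complex.exp v - ∑ m ∈ Finset.range 4, (v : ℂ) ^ m / (m.factorial : ℂ)
        = ((Real.exp v - (1 + v + v ^ 2 / 2 + v ^ 3 / 6) : ℝ) : ℂ) := by
      simp [Finset.sum_range_succ, Nat.factorial]
    rw [e, Complex.norm_real, Complex.norm_real, Real.norm_eq_abs, Real.norm_eq_abs] at h
    exact (le_abs_self _).trans h
  have h1 := key u
  have h2 := key (-u)
  rw [abs_neg] at h2
  have e : |u| ^ 4 = u ^ 4 := by rw [← abs_pow, abs_of_nonneg (by positivity)]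
  rw [e] at h1 h2
  nlinarith

lemma exp_le_one_add_add_sq {y : ℝ} (h0 : 0 ≤ y) (h1 : y ≤ 1) : Real.exp y ≤ 1 + y + y ^ 2 := by
  have h := (abs_le.1 (Real.abs_exp_sub_one_sub_id_le (x := y) (by rwa [abs_of_nonneg h0]))).2
  linarith

section MgfLimit

variable {Ω : Type*} [MeasurableSpace Ω] {P : ℕ → Measure Ω} [∀ n, IsProbabilityMeasure (P n)]
  {X : ℕ → Ω → ℝ}

lemma integrable_pow_of_integrable_exp {Q : Measure Ω} {Y : Ω → ℝ}
    (hint : ∀ t, Integrable (fun ω => Real.exp (t * Y ω)) Q) (k : ℕ) :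
    Integrable (fun ω => Y ω ^ k) Q := by
  have := integrable_pow_of_integrable_exp_mul (X := Y) (μ := Q) (t := 1) one_ne_zero
    (hint 1) (hint (-1)) k
  simpa using this

/-- From tX ≤ e^{tX} - 1 one gets t·E X ≤ e^{t²/2} - 1 + o(1) = O(t²) + o(1). Divide by a small
fixed t, and use -t for the other side. -/
lemma tendsto_integral_of_tendsto_mgf
    (hint : ∀ n t, Integrable (fun ω => Real.exp (t * X n ω)) (P n))
    (h : ∀ t, Tendsto (fun n => mgf (X n) (P n) t) atTop (𝓝 (Real.exp (t ^ 2 / 2)))) :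
    Tendsto (fun n => ∫ ω, X n ω ∂P n) atTop (𝓝 0) := by
  have hX : ∀ n, Integrable (X n) (P n) := fun n => by
    simpa using integrable_pow_of_integrable_exp (hint n) 1
  have hupper : ∀ t n, t * ∫ ω, X n ω ∂P n ≤ mgf (X n) (P n) t - 1 := by
    intro t n
    rw [← integral_const_mul, mgf]
    have : ∫ ω, (Real.exp (t * X n ω) - 1) ∂P n = ∫ ω, Real.exp (t * X n ω) ∂P n - 1 := by
      rw [integral_sub (hint n t) (integrable_const _)]; simp
    rw [← this]
    refine integral_mono ((hX n).const_mul t) ((hint n t).sub (integrable_const _)) fun ω => ?_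
    have := Real.add_one_le_exp (t * X n ω)
    dsimp only
    linarith
  rw [Metric.tendsto_nhds]
  intro ε hε
  obtain ⟨t, ht0, ht1, htε⟩ : ∃ t : ℝ, 0 < t ∧ t ≤ 1 ∧ t ≤ ε / 2 :=
    ⟨min 1 (ε / 2), by positivity, min_le_left _ _, min_le_right _ _⟩
  have hexp : Real.exp (t ^ 2 / 2) < 1 + 2 * t ^ 2 := by
    have := exp_le_one_add_add_sq (y := t ^ 2 / 2) (by positivity) (by nlinarith)
    nlinarith [pow_pos ht0 2, pow_pos ht0 4, pow_le_one₀ ht0.le ht1 (n := 2)]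
  have e1 := (h t).eventually_lt_const hexp
  have e2 := (h (-t)).eventually_lt_const (by rw [neg_sq]; exact hexp)
  filter_upwards [e1, e2] with n h1 h2
  have h3 := hupper t n
  have h4 := hupper (-t) n
  rw [Real.dist_eq, sub_zero, abs_lt]
  have h5 : t * (∫ ω, X n ω ∂P n) < t * (2 * t) := by nlinarith
  have h6 : t * (-(2 * t)) < t * (∫ ω, X n ω ∂P n) := by nlinarith
  have h7 := lt_of_mul_lt_mul_left h5 ht0.le
  have h8 := lt_of_mul_lt_mul_left h6 ht0.le
  exact ⟨by linarith, by linarith⟩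

/-- The second difference e^{tX} + e^{-tX} - 2 is t²X² up to a fourth-order error whose expectation
is controlled by the mgf at ±2. Its expectation tends to 2(e^{t²/2} - 1) = t² + O(t⁴); divide by t²
with t small. -/
lemma tendsto_integral_sq_of_tendsto_mgf
    (hint : ∀ n t, Integrable (fun ω => Real.exp (t * X n ω)) (P n))
    (h : ∀ t, Tendsto (fun n => mgf (X n) (P n) t) atTop (𝓝 (Real.exp (t ^ 2 / 2)))) :
    Tendsto (fun n => ∫ ω, X n ω ^ 2 ∂P n) atTop (𝓝 1) := by
  have hX : ∀ n, Integrable (fun ω => X n ω ^ 2) (P n) := fun n =>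
    integrable_pow_of_integrable_exp (hint n) 2
  have hsum : ∀ t n, Integrable (fun ω => Real.exp (t * X n ω) + Real.exp (-t * X n ω)) (P n) :=
    fun t n => (hint n t).add (hint n (-t))
  have hmgf : ∀ t n, ∫ ω, (Real.exp (t * X n ω) + Real.exp (-t * X n ω)) ∂P n
      = mgf (X n) (P n) t + mgf (X n) (P n) (-t) := by
    intro t n
    rw [integral_add (hint n t) (hint n (-t))]; rfl
  have hmgf' : ∀ t n, ∫ ω, (Real.exp (t * X n ω) + Real.exp (-t * X n ω) - 2) ∂P n
      = mgf (X n) (P n) t + mgf (X n) (P n) (-t) - 2 := by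
    intro t n
    rw [integral_sub (hsum t n) (integrable_const _), hmgf]; simp
  have hupper : ∀ t n, t ^ 2 * ∫ ω, X n ω ^ 2 ∂P n
      ≤ mgf (X n) (P n) t + mgf (X n) (P n) (-t) - 2 := by
    intro t n
    rw [← integral_const_mul, ← hmgf']
    refine integral_mono ((hX n).const_mul _) ((hsum t n).sub (integrable_const _)) fun ω => ?_
    have := sq_le_exp_add_exp_neg (t * X n ω)
    dsimp only
    rw [neg_mul, ← mul_pow]
    exact this
  have hlower : ∀ t n, 0 < t → t ≤ 1 → mgf (X n) (P n) t + mgf (X n) (P n) (-t) - 2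
      ≤ t ^ 2 * ∫ ω, X n ω ^ 2 ∂P n
        + 48 * t ^ 4 * (mgf (X n) (P n) 2 + mgf (X n) (P n) (-2)) := by
    intro t n ht0 ht1
    rw [← integral_const_mul, ← hmgf', ← hmgf, ← integral_const_mul,
      ← integral_add ((hX n).const_mul _) ((hsum 2 n).const_mul _)]
    refine integral_mono ((hsum t n).sub (integrable_const _))
      (((hX n).const_mul _).add ((hsum 2 n).const_mul _)) fun ω => ?_
    have h1 := exp_add_exp_neg_le (t * X n ω)
    set x := X n ω
    have h2 : |t * x| ≤ |x| := by
      rw [abs_mul, abs_of_pos ht0]; exact mul_le_of_le_one_left (abs_nonneg _) ht1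
    have h3 : x ^ 4 ≤ 24 * Real.exp |x| := by
      have := Real.pow_div_factorial_le_exp (x := |x|) (abs_nonneg _) 4
      rw [div_le_iff₀ (by positivity), ← abs_pow, abs_of_nonneg (by positivity)] at this
      have e : ((Nat.factorial 4 : ℕ) : ℝ) = 24 := by norm_num [Nat.factorial]
      rw [e] at this
      linarith
    have h4 : Real.exp |x| * Real.exp |x| ≤ Real.exp (2 * x) + Real.exp (-2 * x) := by
      rw [← Real.exp_add]
      rcases abs_cases x with ⟨e, -⟩ | ⟨e, -⟩ <;> rw [e]
      · have : x + x = 2 * x := by ring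
        rw [this]; linarith [Real.exp_pos (-2 * x)]
      · have : -x + -x = -2 * x := by ring
        rw [this]; linarith [Real.exp_pos (2 * x)]
    have h5 : (t * x) ^ 4 * Real.exp |t * x|
        ≤ 24 * t ^ 4 * (Real.exp (2 * x) + Real.exp (-2 * x)) := by
      calc (t * x) ^ 4 * Real.exp |t * x| ≤ (t * x) ^ 4 * Real.exp |x| :=
            mul_le_mul_of_nonneg_left (Real.exp_le_exp.2 h2) (by positivity)
        _ = t ^ 4 * (x ^ 4 * Real.exp |x|) := by ring
        _ ≤ t ^ 4 * (24 * Real.exp |x| * Real.exp |x|) :=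
            mul_le_mul_of_nonneg_left (mul_le_mul_of_nonneg_right h3 (Real.exp_pos _).le)
              (by positivity)
        _ = 24 * t ^ 4 * (Real.exp |x| * Real.exp |x|) := by ring
        _ ≤ _ := mul_le_mul_of_nonneg_left h4 (by positivity)
    dsimp only
    rw [neg_mul]
    nlinarith
  have hb : Real.exp (2 ^ 2 / 2) < 9 := by
    have : (2 : ℝ) ^ 2 / 2 = 1 + 1 := by norm_num
    rw [this, Real.exp_add]
    nlinarith [Real.exp_one_lt_three, Real.exp_pos 1]
  rw [Metric.tendsto_nhds]
  intro ε hε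
  obtain ⟨t, ht0, ht1, htε⟩ : ∃ t : ℝ, 0 < t ∧ t ≤ 1 ∧ t ≤ ε / 1000 :=
    ⟨min 1 (ε / 1000), by positivity, min_le_left _ _, min_le_right _ _⟩
  have ht2 : 0 < t ^ 2 := by positivity
  have ht4 : 0 < t ^ 4 := by positivity
  have hexp : Real.exp (t ^ 2 / 2) < 1 + t ^ 2 / 2 + t ^ 4 := by
    have := exp_le_one_add_add_sq (y := t ^ 2 / 2) (by positivity) (by nlinarith)
    nlinarith
  have hexp' : 1 + t ^ 2 / 2 - t ^ 4 < Real.exp (t ^ 2 / 2) := by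
    have := Real.add_one_le_exp (t ^ 2 / 2)
    linarith
  filter_upwards [(h t).eventually_lt_const hexp,
    (h (-t)).eventually_lt_const (by rw [neg_sq]; exact hexp),
    (h t).eventually_const_lt hexp', (h (-t)).eventually_const_lt (by rw [neg_sq]; exact hexp'),
    (h 2).eventually_lt_const hb, (h (-2)).eventually_lt_const (by rw [neg_sq]; exact hb)]
    with n h1 h2 h3 h4 h5 h6
  have h7 := hupper t n
  have h8 := hlower t n ht0 ht1
  set I := ∫ ω, X n ω ^ 2 ∂P n
  have h9 : 48 * t ^ 4 * (mgf (X n) (P n) 2 + mgf (X n) (P n) (-2)) ≤ 48 * t ^ 4 * 18 :=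
    mul_le_mul_of_nonneg_left (by linarith) (by positivity)
  have htt : t ^ 2 ≤ ε / 1000 := by nlinarith
  rw [Real.dist_eq, abs_lt]
  have h10 : t ^ 2 * I < t ^ 2 * (1 + 2 * t ^ 2) := by nlinarith
  -- 866 = 48·18 + 2: the fourth-order error with both mgf values at ±2 below 9, plus the slack t⁴
  -- in each of the two lower bounds.
  have h11 : t ^ 2 * (1 - 866 * t ^ 2) < t ^ 2 * I := by nlinarith
  have h12 := lt_of_mul_lt_mul_left h10 ht2.le
  have h13 := lt_of_mul_lt_mul_left h11 ht2.le
  exact ⟨by linarith, by linarith⟩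

lemma tendsto_variance_of_tendsto_mgf
    (hint : ∀ n t, Integrable (fun ω => Real.exp (t * X n ω)) (P n))
    (h : ∀ t, Tendsto (fun n => mgf (X n) (P n) t) atTop (𝓝 (Real.exp (t ^ 2 / 2)))) :
    Tendsto (fun n => variance (X n) (P n)) atTop (𝓝 1) := by
  have h1 := tendsto_integral_of_tendsto_mgf hint h
  have h2 := tendsto_integral_sq_of_tendsto_mgf hint h
  have h3 := h2.sub (h1.pow 2)
  simp only [ne_eq, OfNat.ofNat_ne_zero, not_false_eq_true, zero_pow, sub_zero] at h3
  refine h3.congr fun n => ?_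
  have hm : AEStronglyMeasurable (X n) (P n) := by
    have := (integrable_pow_of_integrable_exp (hint n) 1).1
    simpa using this
  rw [variance_eq_sub ((memLp_two_iff_integrable_sq hm).2
    (integrable_pow_of_integrable_exp (hint n) 2))]
  rfl

end MgfLimit

section WeakLimit

variable {P : ℕ → ProbabilityMeasure ℝ}

/-- Chernoff bounds with t = ±1: both mgf sequences converge, hence are bounded, so the tails are
O(e^{-r}) uniformly in n. -/
lemma isTightMeasureSet_of_tendsto_mgf
    (hint : ∀ n t, Integrable (fun x => Real.exp (t * x)) (P n : Measure ℝ))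
    (h : ∀ t, Tendsto (fun n => mgf id (P n : Measure ℝ) t) atTop (𝓝 (Real.exp (t ^ 2 / 2)))) :
    IsTightMeasureSet {(P n : Measure ℝ) | n} := by
  obtain ⟨B, hB⟩ := (h 1).bddAbove_range
  obtain ⟨B', hB'⟩ := (h (-1)).bddAbove_range
  have hle : ∀ n r, (P n : Measure ℝ) {x | r < ‖x‖}
      ≤ ENNReal.ofReal (Real.exp (-r) * (B + B')) := by
    intro n r
    have h1 := measure_ge_le_exp_mul_mgf (μ := (P n : Measure ℝ)) (X := id) r zero_le_one (hint n 1)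
    have h2 := measure_le_le_exp_mul_mgf (μ := (P n : Measure ℝ)) (X := id) (t := -1) (-r)
      (by norm_num) (hint n (-1))
    have h3 : mgf id (P n : Measure ℝ) 1 ≤ B := hB ⟨n, rfl⟩
    have h4 : mgf id (P n : Measure ℝ) (-1) ≤ B' := hB' ⟨n, rfl⟩
    have hsub : {x : ℝ | r < ‖x‖} ⊆ {x | r ≤ id x} ∪ {x | id x ≤ -r} := by
      intro x hx
      simp only [Set.mem_ofPred_eq, Real.norm_eq_abs, Set.mem_union, id] at hx ⊢
      rcases abs_cases x with ⟨e, -⟩ | ⟨e, -⟩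
      · left; linarith
      · right; linarith
    rw [← ofReal_measureReal]
    refine ENNReal.ofReal_le_ofReal ?_
    refine (measureReal_mono hsub).trans ((measureReal_union_le _ _).trans ?_)
    have e1 : (-1 : ℝ) * r = -r := by ring
    have e2 : -(-1 : ℝ) * -r = -r := by ring
    rw [e1] at h1
    rw [e2] at h2
    have := Real.exp_pos (-r)
    nlinarith
  refine isTightMeasureSet_of_tendsto_measure_norm_gt ?_
  have hlim : Tendsto (fun r : ℝ => ENNReal.ofReal (Real.exp (-r) * (B + B'))) atTop (𝓝 0) := by
    have := ENNReal.tendsto_ofReal (Real.tendsto_exp_neg_atTop_nhds_zero.mul_const (B + B'))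
    simpa using this
  refine tendsto_of_tendsto_of_tendsto_of_le_of_le tendsto_const_nhds hlim (fun _ => zero_le) ?_
  intro r
  refine iSup₂_le ?_
  rintro _ ⟨n, rfl⟩
  exact hle n r

/-- The function e^{tx} is unbounded, so weak convergence is applied to its truncation at K + 1. The
loss is at most e^{2tx}/(K + 1), whose integral is controlled by the mgf at 2t; monotone convergence
then removes the truncation. -/
lemma mgf_eq_of_weak_limit {U : Filter ℕ} [U.NeBot] (hU : U ≤ atTop) {ν : ProbabilityMeasure ℝ}
    (hν : Tendsto P U (𝓝 ν))
    (hint : ∀ n t, Integrable (fun x => Real.exp (t * x)) (P n : Measure ℝ))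
    (h : ∀ t, Tendsto (fun n => mgf id (P n : Measure ℝ) t) atTop (𝓝 (Real.exp (t ^ 2 / 2))))
    (t : ℝ) : mgf id (ν : Measure ℝ) t = Real.exp (t ^ 2 / 2) := by
  let f : ℕ → BoundedContinuousFunction ℝ ℝ := fun K =>
    BoundedContinuousFunction.ofNormedAddCommGroup (fun x => min (Real.exp (t * x)) (K + 1))
      (by fun_prop) (K + 1) (fun x => by
        rw [Real.norm_eq_abs, abs_of_nonneg (by positivity)]; exact min_le_right _ _)
  have hf : ∀ K x, f K x = min (Real.exp (t * x)) (K + 1) := fun _ _ => rfl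
  have hf0 : ∀ K x, 0 ≤ f K x := fun K x => by rw [hf]; positivity
  have hfi : ∀ K (ρ : ProbabilityMeasure ℝ), Integrable (f K) (ρ : Measure ℝ) :=
    fun K ρ => (f K).integrable _
  have hlim : ∀ K, Tendsto (fun n => ∫ x, f K x ∂(P n : Measure ℝ)) U
      (𝓝 (∫ x, f K x ∂(ν : Measure ℝ))) := fun K =>
    ProbabilityMeasure.tendsto_iff_forall_integral_tendsto.1 hν (f K)
  have hup : ∀ K, ∫ x, f K x ∂(ν : Measure ℝ) ≤ Real.exp (t ^ 2 / 2) := by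
    intro K
    refine le_of_tendsto_of_tendsto' (hlim K) ((h t).mono_left hU) fun n => ?_
    exact integral_mono (hfi K _) (hint n t) fun x => min_le_left _ _
  have hlo : ∀ K : ℕ, Real.exp (t ^ 2 / 2) - Real.exp ((2 * t) ^ 2 / 2) * (1 / ((K : ℝ) + 1))
      ≤ ∫ x, f K x ∂(ν : Measure ℝ) := by
    intro K
    refine le_of_tendsto_of_tendsto' (((h t).sub ((h (2 * t)).mul_const _)).mono_left hU)
      (hlim K) fun n => ?_
    simp only [mgf, id]
    rw [← integral_mul_const, ← integral_sub (hint n t) ((hint n (2 * t)).mul_const _)]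
    refine integral_mono ((hint n t).sub ((hint n (2 * t)).mul_const _)) (hfi K _) fun x => ?_
    have e : Real.exp (2 * t * x) = Real.exp (t * x) * Real.exp (t * x) := by
      rw [← Real.exp_add]; congr 1; ring
    have hK : (0 : ℝ) < K + 1 := by positivity
    have hp := Real.exp_pos (t * x)
    simp only [hf]
    rw [e]
    rcases le_total (Real.exp (t * x)) (K + 1) with h1 | h1
    · rw [min_eq_left h1]
      have : 0 ≤ Real.exp (t * x) * Real.exp (t * x) * (1 / ((K : ℝ) + 1)) := by positivity
      linarith
    · rw [min_eq_right h1]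
      have : Real.exp (t * x) ≤ Real.exp (t * x) * Real.exp (t * x) * (1 / ((K : ℝ) + 1)) := by
        rw [mul_one_div, le_div_iff₀ hK]
        exact mul_le_mul_of_nonneg_left h1 hp.le
      linarith
  have hconv : Tendsto (fun K => ∫ x, f K x ∂(ν : Measure ℝ)) atTop
      (𝓝 (Real.exp (t ^ 2 / 2))) := by
    refine tendsto_of_tendsto_of_tendsto_of_le_of_le ?_ tendsto_const_nhds hlo hup
    have := (tendsto_one_div_add_atTop_nhds_zero_nat (𝕜 := ℝ)).const_mul (Real.exp ((2 * t) ^ 2 / 2))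
    simpa using this.const_sub (Real.exp (t ^ 2 / 2))
  have hmono : Tendsto (fun K => ∫⁻ x, ENNReal.ofReal (f K x) ∂(ν : Measure ℝ)) atTop
      (𝓝 (∫⁻ x, ENNReal.ofReal (Real.exp (t * x)) ∂(ν : Measure ℝ))) := by
    refine lintegral_tendsto_of_tendsto_of_monotone (fun K => ?_) (ae_of_all _ fun x => ?_)
      (ae_of_all _ fun x => ?_)
    · exact (f K).continuous.measurable.ennreal_ofReal.aemeasurable
    · intro K L hKL
      refine ENNReal.ofReal_le_ofReal (min_le_min_left _ ?_)
      have : (K : ℝ) ≤ L := by exact_mod_cast hKL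
      linarith
    · refine ENNReal.tendsto_ofReal (tendsto_const_nhds.congr' ?_)
      obtain ⟨K, hK⟩ := exists_nat_ge (Real.exp (t * x))
      filter_upwards [eventually_ge_atTop K] with L hL
      have : (K : ℝ) ≤ L := by exact_mod_cast hL
      rw [hf, min_eq_left (by linarith)]
  have heq : ∫⁻ x, ENNReal.ofReal (Real.exp (t * x)) ∂(ν : Measure ℝ)
      = ENNReal.ofReal (Real.exp (t ^ 2 / 2)) := by
    refine tendsto_nhds_unique hmono ((ENNReal.tendsto_ofReal hconv).congr fun K => ?_)
    exact ofReal_integral_eq_lintegral_ofReal (hfi K _) (ae_of_all _ (hf0 K))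
  rw [mgf, integral_eq_lintegral_of_nonneg_ae (ae_of_all _ fun x => (Real.exp_pos _).le)
    (by fun_prop)]
  simp only [id]
  rw [heq, ENNReal.toReal_ofReal (Real.exp_pos _).le]

/-- Convergence of the moment generating functions to that of the standard normal distribution
implies weak convergence. -/
theorem tendsto_gaussianReal_of_tendsto_mgf
    (hint : ∀ n t, Integrable (fun x => Real.exp (t * x)) (P n : Measure ℝ))
    (h : ∀ t, Tendsto (fun n => mgf id (P n : Measure ℝ) t) atTop (𝓝 (Real.exp (t ^ 2 / 2)))) :
    Tendsto P atTop (𝓝 ⟨gaussianReal 0 1, inferInstance⟩) := by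
  -- By tightness every ultrafilter has a limit. That limit has the Gaussian mgf on the whole real
  -- line, which determines the complex mgf by analytic continuation and hence the measure.
  refine (Filter.tendsto_iff_ultrafilter _ _ _).2 fun U hU => ?_
  have hcpt : IsCompact (closure {P n | n}) :=
    isCompact_closure_of_isTightMeasureSet (by simpa using isTightMeasureSet_of_tendsto_mgf hint h)
  obtain ⟨ν, -, hν⟩ := hcpt.ultrafilter_le_nhds (U.map P)
    (.trans (by simp) (monotone_principal subset_closure))
  have hνlim : Tendsto P U (𝓝 ν) := hν
  have hmgf : mgf id (gaussianReal 0 1) = mgf id (ν : Measure ℝ) := by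
    funext t
    rw [mgf_eq_of_weak_limit hU hνlim hint h t, mgf_id_gaussianReal]
    simp
  have hc : complexMGF id (gaussianReal 0 1) = complexMGF id (ν : Measure ℝ) := by
    funext z
    exact eqOn_complexMGF_of_mgf hmgf (by simp)
  have he : ν = ⟨gaussianReal 0 1, inferInstance⟩ :=
    Subtype.ext (Measure.ext_of_complexMGF_id_eq hc).symm
  rw [← he]
  exact hνlim

lemma gaussianReal_real_Iio (x : ℝ) : (gaussianReal 0 1).real (Set.Iio x) = Φ x := by
  have := nullSingletonClass_gaussianReal (μ := 0) (v := 1) one_ne_zero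
  have e : (gaussianReal 0 1).real (Set.Iio x) = (gaussianReal 0 1).real (Set.Iic x) := by
    simp only [measureReal_def, measure_congr Iio_ae_eq_Iic]
  rw [e, measureReal_def, gaussianReal_apply_eq_integral _ one_ne_zero,
    ENNReal.toReal_ofReal (setIntegral_nonneg measurableSet_Iic fun _ _ => gaussianPDFReal_nonneg _ _ _),
    Φ, ← integral_const_mul]
  refine integral_congr_ae (ae_of_all _ fun t => ?_)
  simp [gaussianPDFReal]

lemma monotone_Φ : Monotone Φ := fun x y hxy => by
  rw [← gaussianReal_real_Iio, ← gaussianReal_real_Iio]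
  exact measureReal_mono (Set.Iio_subset_Iio hxy)

lemma Φ_eq_cdf (x : ℝ) : Φ x = cdf (gaussianReal 0 1) x := by
  have := nullSingletonClass_gaussianReal (μ := 0) (v := 1) one_ne_zero
  rw [cdf_eq_real, ← gaussianReal_real_Iio]
  simp only [measureReal_def, measure_congr Iio_ae_eq_Iic]

lemma tendsto_measure_Iio_of_tendsto_mgf
    (hint : ∀ n t, Integrable (fun x => Real.exp (t * x)) (P n : Measure ℝ))
    (h : ∀ t, Tendsto (fun n => mgf id (P n : Measure ℝ) t) atTop (𝓝 (Real.exp (t ^ 2 / 2))))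
    (x : ℝ) : Tendsto (fun n => (P n : Measure ℝ).real (Set.Iio x)) atTop (𝓝 (Φ x)) := by
  have := nullSingletonClass_gaussianReal (μ := 0) (v := 1) one_ne_zero
  have h1 := ProbabilityMeasure.tendsto_measure_of_null_frontier_of_tendsto'
    (tendsto_gaussianReal_of_tendsto_mgf hint h) (E := Set.Iio x) (by simp)
  rw [← gaussianReal_real_Iio]
  exact (ENNReal.tendsto_toReal (measure_ne_top _ _)).comp h1

end WeakLimit

lemma continuous_Φ : Continuous Φ := by
  have hi : Integrable fun t : ℝ => Real.exp (-t ^ 2 / 2) := by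
    have := integrable_exp_neg_mul_sq (b := 1 / 2) (by norm_num)
    refine this.congr (ae_of_all _ fun t => ?_)
    dsimp only
    congr 1; ring
  have : Φ = fun x => 1 / √(2 * Real.pi)
      * ((∫ t in Set.Iic 0, Real.exp (-t ^ 2 / 2)) + ∫ t in (0 : ℝ)..x, Real.exp (-t ^ 2 / 2)) := by
    funext x
    rw [Φ, ← intervalIntegral.integral_Iic_sub_Iic hi.integrableOn hi.integrableOn]
    ring
  rw [this]
  exact continuous_const.mul (continuous_const.add
    (intervalIntegral.continuous_primitive (fun a b => hi.intervalIntegrable) 0))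

/-- Pólya's theorem: pointwise convergence of monotone functions to a continuous distribution
function is uniform. -/
theorem tendstoUniformly_of_monotone {F : ℕ → ℝ → ℝ} {G : ℝ → ℝ}
    (hF : ∀ᶠ n in atTop, Monotone (F n)) (hF01 : ∀ᶠ n in atTop, ∀ x, 0 ≤ F n x ∧ F n x ≤ 1)
    (hG : Monotone G) (hGc : Continuous G) (hG0 : Tendsto G atBot (𝓝 0))
    (hG1 : Tendsto G atTop (𝓝 1)) (h : ∀ x, Tendsto (fun n => F n x) atTop (𝓝 (G x))) :
    TendstoUniformly F G atTop := by
  rw [Metric.tendstoUniformly_iff]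
  intro ε hε
  obtain ⟨a, ha⟩ := (hG0.eventually_lt_const (u := ε / 4) (by positivity)).exists
  obtain ⟨b, hb, hab⟩ := ((hG1.eventually_const_lt (u := 1 - ε / 4) (by linarith)).and
    (eventually_ge_atTop a)).exists
  have hG01 : ∀ x, 0 ≤ G x ∧ G x ≤ 1 := fun x => ⟨hG.le_of_tendsto hG0 x, hG.ge_of_tendsto hG1 x⟩
  obtain ⟨δ, hδ, hδG⟩ := Metric.uniformContinuousOn_iff.1
    (isCompact_Icc.uniformContinuousOn_of_continuous (s := Set.Icc a b) hGc.continuousOn)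
    (ε / 4) (by positivity)
  obtain ⟨N, hN⟩ := exists_nat_gt ((b - a) / δ)
  have hN0 : (0 : ℝ) < N := lt_of_le_of_lt (div_nonneg (by linarith) hδ.le) hN
  -- A finite grid on which G varies by less than ε/4 per step. Monotonicity carries closeness at
  -- the grid points over to all x, and outside [a, b] both functions are pinned near 0 or 1.
  set p : ℕ → ℝ := fun i => a + i * ((b - a) / N) with hp
  have hstep : (b - a) / N < δ := by
    rw [div_lt_iff₀ hN0]; rw [div_lt_iff₀ hδ] at hN; linarith
  have hst0 : 0 ≤ (b - a) / N := div_nonneg (by linarith) hN0.le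
  have hpN : p N = b := by simp only [hp]; field_simp; ring
  have hp0 : p 0 = a := by simp [hp]
  have hmem : ∀ i, i ≤ N → p i ∈ Set.Icc a b := by
    intro i hi
    have : (i : ℝ) ≤ N := by exact_mod_cast hi
    refine ⟨by simp only [hp]; nlinarith, ?_⟩
    rw [← hpN]
    simp only [hp]
    nlinarith
  have hclose : ∀ᶠ n in atTop, ∀ i ∈ Finset.range (N + 1), |F n (p i) - G (p i)| < ε / 4 := by
    rw [Filter.eventually_all_finset]
    intro i _
    exact (Metric.tendsto_nhds.1 (h (p i)) (ε / 4) (by positivity))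
  filter_upwards [hF, hF01, hclose] with n hm h01 hc x
  have hc' : ∀ i, i ≤ N → |F n (p i) - G (p i)| < ε / 4 := fun i hi =>
    hc i (Finset.mem_range.2 (by omega))
  rw [Real.dist_eq]
  rcases le_total x a with hxa | hxa
  · have h1 := abs_lt.1 (hc' 0 (Nat.zero_le _))
    rw [hp0] at h1
    rw [abs_lt]
    have h2 := hm hxa
    have h3 := hG hxa
    have h4 := (h01 x).1
    have h5 := (hG01 x).1
    constructor <;> linarith
  rcases le_total b x with hxb | hxb
  · have h1 := abs_lt.1 (hc' N le_rfl)
    rw [hpN] at h1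
    rw [abs_lt]
    have h2 := hm hxb
    have h3 := hG hxb
    have h4 := (h01 x).2
    have h5 := (hG01 x).2
    constructor <;> linarith
  obtain ⟨i, hiN, hi1, hi2⟩ : ∃ i, i + 1 ≤ N ∧ p i ≤ x ∧ x ≤ p (i + 1) := by
    by_contra hcon
    push Not at hcon
    have hall : ∀ i, i ≤ N → p i ≤ x := by
      intro i
      induction i with
      | zero => intro _; rw [hp0]; exact hxa
      | succ k ih => intro hk; exact (hcon k hk (ih (by omega))).le
    have hxeq : x = b := le_antisymm hxb (hpN ▸ hall N le_rfl)
    have hNpos : 1 ≤ N := by exact_mod_cast hN0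
    have := hcon (N - 1) (by omega) (hall (N - 1) (by omega))
    rw [Nat.sub_add_cancel hNpos, hpN] at this
    linarith
  have h1 := abs_lt.1 (hc' i (by omega))
  have h2 := abs_lt.1 (hc' (i + 1) hiN)
  have h3 := hδG (p i) (hmem i (by omega)) (p (i + 1)) (hmem (i + 1) hiN) (by
    rw [Real.dist_eq]
    have : p i - p (i + 1) = -((b - a) / N) := by simp only [hp]; push_cast; ring
    rw [this, abs_neg, abs_of_nonneg hst0]
    exact hstep)
  rw [Real.dist_eq, abs_lt] at h3
  have h4 := hm hi1
  have h5 := hm hi2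
  have h6 := hG hi1
  have h7 := hG hi2
  rw [abs_lt]
  constructor <;> linarith

lemma tendstoUniformly_Φ {Ω : Type*} [MeasurableSpace Ω] {P : ℕ → Measure Ω}
    [∀ n, IsProbabilityMeasure (P n)] {X : ℕ → Ω → ℝ}
    (hint : ∀ n t, Integrable (fun ω => Real.exp (t * X n ω)) (P n))
    (h : ∀ t, Tendsto (fun n => mgf (X n) (P n) t) atTop (𝓝 (Real.exp (t ^ 2 / 2)))) :
    TendstoUniformly (fun n x => (P n).real {ω | X n ω < x}) Φ atTop := by
  have hm : ∀ n, AEMeasurable (X n) (P n) := fun n => by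
    have := (integrable_pow_of_integrable_exp (hint n) 1).1.aemeasurable
    simpa using this
  let Q : ℕ → ProbabilityMeasure ℝ := fun n =>
    ⟨(P n).map (X n), Measure.isProbabilityMeasure_map (hm n)⟩
  have hQ : ∀ n, (Q n : Measure ℝ) = (P n).map (X n) := fun n => rfl
  refine tendstoUniformly_of_monotone (Eventually.of_forall fun n x y hxy => ?_)
    (Eventually.of_forall fun n x => ⟨measureReal_nonneg, measureReal_le_one⟩) monotone_Φ continuous_Φ
    ?_ ?_ fun x => ?_
  · exact measureReal_mono fun ω hω => lt_of_lt_of_le hω hxy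
  · rw [funext Φ_eq_cdf]
    exact tendsto_cdf_atBot (gaussianReal 0 1)
  · rw [funext Φ_eq_cdf]
    exact tendsto_cdf_atTop (gaussianReal 0 1)
  · have h1 := tendsto_measure_Iio_of_tendsto_mgf (P := Q) (fun n t => ?_) (fun t => ?_) x
    · refine h1.congr fun n => ?_
      rw [hQ, measureReal_def, Measure.map_apply_of_aemeasurable (hm n) measurableSet_Iio]
      rfl
    · rw [hQ, integrable_map_measure (by fun_prop) (hm n)]
      exact hint n t
    · refine (h t).congr fun n => ?_
      rw [hQ, mgf_id_map (hm n)]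

/-! ### The constants, and existence and asymptotics of the saddle point. -/

lemma limMoment_one_eq {α : ℝ} (hα : 0 < α) (hα1 : α < 1) :
    limMoment α 1 = -(1 / α * polylog (1 / α) (-1) * Real.Gamma (1 / α + 1)) := by
  rw [limMoment_eq hα hα1]
  simp only [Nat.cast_one, add_sub_cancel_right]
  ring

lemma limMoment_two_eq {α : ℝ} (hα : 0 < α) (hα1 : α < 1) :
    limMoment α 2 = -(1 / α * polylog (1 / α + 1) (-1) * Real.Gamma (1 / α + 2)) := by
  rw [limMoment_eq hα hα1, Nat.cast_ofNat, show 1 / α + 2 - 1 = 1 / α + 1 by ring]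
  ring

lemma limMoment_zero_eq {α : ℝ} (hα : 0 < α) (hα1 : α < 1) :
    limMoment α 0 = -(1 / α) * polylog (1 / α - 1) (-1) * Real.Gamma (1 / α) := by
  rw [limMoment_eq hα hα1, Nat.cast_zero, add_zero]
  ring

lemma constA_pos {α : ℝ} (hα : 0 < α) (hα1 : α < 1) : 0 < constA (1 / α) := by
  have hβ : 0 < 1 / α + 1 := by positivity
  have h := limMoment_pos hα 2
  rw [limMoment_two_eq hα hα1, show 1 / α + 2 = 1 / α + 1 + 1 by ring,
    Real.Gamma_add_one hβ.ne'] at h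
  have e : -(1 / α * polylog (1 / α + 1) (-1) * ((1 / α + 1) * Real.Gamma (1 / α + 1)))
      = (1 / α + 1) * constA (1 / α) := by rw [constA]; ring
  rw [e] at h
  exact pos_of_mul_pos_right h hβ.le

lemma mu_constant_pos {α : ℝ} (hα : 0 < α) (hα1 : α < 1) :
    0 < -(1 / α) * polylog (1 / α) (-1) * Real.Gamma (1 / α) := by
  have hβ : 0 < 1 / α := by positivity
  have h := limMoment_pos hα 1
  rw [limMoment_one_eq hα hα1, Real.Gamma_add_one hβ.ne'] at h
  have e : -(1 / α * polylog (1 / α) (-1) * (1 / α * Real.Gamma (1 / α)))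
      = (1 / α) * (-(1 / α) * polylog (1 / α) (-1) * Real.Gamma (1 / α)) := by ring
  rw [e] at h
  exact pos_of_mul_pos_right h hβ.le

lemma c₁_eq (α : ℝ) : c₁ (1 / α) = -(1 / α) * polylog (1 / α) (-1) * Real.Gamma (1 / α)
    * constA (1 / α) ^ (-(1 / α / (1 / α + 1))) := rfl

/-- The plus sign in `c₂` hides a subtraction: its denominator is minus the second limiting moment.
Positivity of the constant is then the strict Cauchy–Schwarz inequality. -/
lemma c₂_eq {α : ℝ} (hα : 0 < α) (hα1 : α < 1) : c₂ (1 / α)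
    = (limMoment α 0 - limMoment α 1 ^ 2 / limMoment α 2)
      * constA (1 / α) ^ (-(1 / α / (1 / α + 1))) := by
  rw [c₂, limMoment_zero_eq hα hα1, limMoment_one_eq hα hα1, limMoment_two_eq hα hα1, neg_sq,
    div_neg, sub_neg_eq_add]

lemma fermi_strictAnti : StrictAnti fermi := by
  intro x y hxy
  have := Real.exp_lt_exp.2 hxy
  have h0 := Real.exp_pos x
  unfold fermi
  gcongr

lemma strictAntiOn_meanSize {α : ℝ} (hα : 0 < α) : StrictAntiOn (meanSize α) (Set.Ioi 0) := by
  intro x hx y hy hxy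
  have hp : ∀ a, (0 : ℝ) < part α a := fun a => by exact_mod_cast one_le_part hα a
  have hlt : ∀ a, (part α a : ℝ) * fermi (y * part α a) < part α a * fermi (x * part α a) :=
    fun a => mul_lt_mul_of_pos_left (fermi_strictAnti (mul_lt_mul_of_pos_right hxy (hp a))) (hp a)
  exact Summable.tsum_lt_tsum (i := 0) (fun a => (hlt a).le) (hlt 0) (summable_meanSize hα hy)
    (summable_meanSize hα hx)

lemma continuousOn_meanSize {α : ℝ} (hα : 0 < α) : ContinuousOn (meanSize α) (Set.Ioi 0) := by
  intro x hx
  have hx : 0 < x := hx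
  have hp : ∀ a, (0 : ℝ) ≤ part α a := fun a => by positivity
  have h : ContinuousOn (meanSize α) (Set.Ioi (x / 2)) := by
    refine continuousOn_tsum (u := fun a => (part α a : ℝ) * fermi (x / 2 * part α a))
      (fun a => ?_) (summable_meanSize hα (by positivity)) fun a y hy => ?_
    · exact (continuous_const.mul (continuous_fermi.comp (by fun_prop))).continuousOn
    · rw [Real.norm_eq_abs, abs_of_nonneg (mul_nonneg (hp a) (fermi_pos _).le)]
      have hy : x / 2 < y := hy
      exact mul_le_mul_of_nonneg_left
        (fermi_strictAnti.antitone (mul_le_mul_of_nonneg_right hy.le (hp a))) (hp a)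
  exact (h.continuousAt (Ioi_mem_nhds (by linarith))).continuousWithinAt

/-- Every part is at least 1, so raising η from 1 gains a factor e^{-(η-1)} in each term. This
provides a point where the mean size is below 1. -/
lemma meanSize_le_exp_mul {α η : ℝ} (hα : 0 < α) (hη : 1 ≤ η) :
    meanSize α η ≤ 2 * Real.exp (-(η - 1)) * meanSize α 1 := by
  rw [meanSize, meanSize, ← tsum_mul_left]
  refine Summable.tsum_le_tsum (fun a => ?_) (summable_meanSize hα (by linarith))
    ((summable_meanSize hα one_pos).mul_left _)
  have hp : (1 : ℝ) ≤ part α a := by exact_mod_cast one_le_part hα a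
  set p : ℝ := (part α a : ℝ)
  have h1 : fermi (η * p) ≤ Real.exp (-(η - 1)) * Real.exp (-p) := by
    refine (fermi_le_exp_neg _).trans ?_
    rw [← Real.exp_add]
    exact Real.exp_le_exp.2 (by nlinarith)
  have h2 : Real.exp (-p) ≤ 2 * fermi (1 * p) := by
    rw [one_mul, fermi, Real.exp_neg, mul_one_div, inv_eq_one_div,
      div_le_div_iff₀ (Real.exp_pos _) (by positivity)]
    have := Real.one_le_exp (x := p) (by linarith)
    linarith
  calc p * fermi (η * p) ≤ p * (Real.exp (-(η - 1)) * (2 * fermi (1 * p))) := by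
        refine mul_le_mul_of_nonneg_left (h1.trans ?_) (by linarith)
        exact mul_le_mul_of_nonneg_left h2 (Real.exp_pos _).le
    _ = _ := by ring

theorem existsUnique_isSaddlePoint {α : ℝ} (hα : 0 < α) (hα1 : α < 1) {n : ℕ} (hn : 1 ≤ n) :
    ∃! η, IsSaddlePoint α n η := by
  have hn1 : (1 : ℝ) ≤ n := by exact_mod_cast hn
  simp only [isSaddlePoint_iff hα]
  -- Near 0 the mean size grows like η^{-(1/α + 1)}, so it exceeds n; for large η it falls below 1.
  -- The rest is the intermediate value theorem and strict monotonicity.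
  obtain ⟨x, hx0, hx⟩ : ∃ x, 0 < x ∧ (n : ℝ) ≤ meanSize α x := by
    have hA := constA_pos hα hα1
    have h1 := (tendsto_meanSize hα).eventually_const_lt (half_lt_self hA)
    have h2 : Tendsto (fun η : ℝ => η ^ (1 / α) * (η * n)) (𝓝[>] 0) (𝓝 0) := by
      have : Continuous fun η : ℝ => η ^ (1 / α) * (η * n) :=
        (Real.continuous_rpow_const (by positivity)).mul (by fun_prop)
      have h := (this.tendsto 0).mono_left (nhdsWithin_le_nhds (s := Set.Ioi 0))
      simpa using h
    obtain ⟨x, h3, h4, h5⟩ := (h1.and ((h2.eventually_lt_const (half_pos hA)).and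
      self_mem_nhdsWithin)).exists
    have hx : 0 < x := h5
    refine ⟨x, hx, ?_⟩
    have hlt := h4.trans h3
    have h6 : 0 < x ^ (1 / α) := by positivity
    exact (lt_of_mul_lt_mul_left (lt_of_mul_lt_mul_left hlt h6.le) hx.le).le
  obtain ⟨y, hy0, hy⟩ : ∃ y, 0 < y ∧ meanSize α y ≤ n := by
    have hM : 0 ≤ meanSize α 1 := tsum_nonneg fun a => mul_nonneg (by positivity) (fermi_pos _).le
    have hl := Real.log_nonneg (x := 2 * meanSize α 1 + 1) (by linarith)
    refine ⟨1 + Real.log (2 * meanSize α 1 + 1), by linarith,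
      (meanSize_le_exp_mul hα (by linarith)).trans ?_⟩
    rw [add_sub_cancel_left, Real.exp_neg, Real.exp_log (by positivity)]
    refine le_trans ?_ hn1
    rw [mul_right_comm, ← div_eq_mul_inv, div_le_one (by positivity)]
    linarith
  have hivt : (n : ℝ) ∈ meanSize α '' Set.Ioi 0 :=
    (isPreconnected_Ioi.image _ (continuousOn_meanSize hα)).ordConnected.out
      (Set.mem_image_of_mem _ hy0) (Set.mem_image_of_mem _ hx0) ⟨hy, hx⟩
  obtain ⟨η, hη, he⟩ := hivt
  refine ⟨η, ⟨hη, he⟩, fun z hz => ?_⟩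
  exact (strictAntiOn_meanSize hα).injOn hz.1 hη (hz.2.trans he.symm)

section SaddleSequence

variable {α : ℝ} {η : ℕ → ℝ}

lemma tendsto_saddle (hα : 0 < α) (hη : ∀ n : ℕ, 1 ≤ n → IsSaddlePoint α n (η n)) :
    Tendsto η atTop (𝓝[>] 0) := by
  have hpos : ∀ᶠ n in atTop, η n ∈ Set.Ioi (0 : ℝ) := by
    filter_upwards [eventually_ge_atTop 1] with n hn using (hη n hn).1
  refine tendsto_nhdsWithin_iff.2 ⟨?_, hpos⟩
  rw [Metric.tendsto_nhds]
  intro δ hδ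
  filter_upwards [eventually_ge_atTop 1,
    tendsto_natCast_atTop_atTop.eventually_gt_atTop (meanSize α δ)] with n hn hnδ
  obtain ⟨h0, h1⟩ := (isSaddlePoint_iff hα n).1 (hη n hn)
  rw [Real.dist_eq, sub_zero, abs_of_pos h0]
  by_contra hcon
  have := (strictAntiOn_meanSize hα).antitoneOn (show δ ∈ Set.Ioi (0 : ℝ) from hδ) h0
    (not_lt.1 hcon)
  linarith

/-- With β = 1/α, the saddle-point equation gives η^{β+1} n → A; raising this to the power -β/(β+1)
isolates η^{-β}. -/
lemma tendsto_vol_div (hα : 0 < α) (hα1 : α < 1)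
    (hη : ∀ n : ℕ, 1 ≤ n → IsSaddlePoint α n (η n)) :
    Tendsto (fun n : ℕ => vol α (η n) / (n : ℝ) ^ (1 / (α + 1))) atTop
      (𝓝 (constA (1 / α) ^ (-(1 / α / (1 / α + 1))))) := by
  have hA := constA_pos hα hα1
  have h1 := ((tendsto_meanSize hα).comp (tendsto_saddle hα hη)).rpow_const
    (p := -(1 / α / (1 / α + 1))) (Or.inl hA.ne')
  refine h1.congr' ?_
  filter_upwards [eventually_ge_atTop 1] with n hn
  obtain ⟨h0, h2⟩ := (isSaddlePoint_iff hα n).1 (hη n hn)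
  have hn0 : (0 : ℝ) < n := by exact_mod_cast hn
  have e1 : η n ^ (1 / α) * (η n * n) = η n ^ (1 / α + 1) * n := by
    rw [Real.rpow_add_one h0.ne']; ring
  have e2 : 1 / α / (1 / α + 1) = 1 / (α + 1) := by field_simp; ring
  have e3 : (1 / α + 1) * -(1 / α / (1 / α + 1)) = -(1 / α) := by field_simp
  simp only [Function.comp]
  rw [h2, e1, Real.mul_rpow (by positivity) hn0.le, ← Real.rpow_mul h0.le, e3, e2,
    Real.rpow_neg hn0.le, vol]
  exact (div_eq_mul_inv _ _).symm

lemma isEquivalent_of_tendsto_rpow_mul (hα : 0 < α) (hα1 : α < 1)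
    (hη : ∀ n : ℕ, 1 ≤ n → IsSaddlePoint α n (η n)) {f : ℝ → ℝ} {c : ℝ} (hc : c ≠ 0)
    (hf : Tendsto (fun η => η ^ (1 / α) * f η) (𝓝[>] 0) (𝓝 c)) :
    (fun n : ℕ => f (η n)) ~[atTop]
      (fun n => c * constA (1 / α) ^ (-(1 / α / (1 / α + 1))) * (n : ℝ) ^ (1 / (α + 1))) := by
  have hA := constA_pos hα hα1
  set a := constA (1 / α) ^ (-(1 / α / (1 / α + 1))) with ha
  have ha0 : a ≠ 0 := (Real.rpow_pos_of_pos hA _).ne'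
  have h1 := ((hf.comp (tendsto_saddle hα hη)).mul (tendsto_vol_div hα hα1 hη)).div_const (c * a)
  rw [div_self (mul_ne_zero hc ha0)] at h1
  have hn0 : ∀ᶠ n : ℕ in atTop, c * a * (n : ℝ) ^ (1 / (α + 1)) ≠ 0 := by
    filter_upwards [eventually_ge_atTop 1] with n hn
    have hn0 : (0 : ℝ) < n := by exact_mod_cast hn
    exact mul_ne_zero (mul_ne_zero hc ha0) (by positivity)
  refine (isEquivalent_iff_tendsto_one hn0).2 (h1.congr' ?_)
  filter_upwards [eventually_ge_atTop 1] with n hn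
  have h0 := (hη n hn).1
  have hn0 : (0 : ℝ) < n := by exact_mod_cast hn
  have e : η n ^ (1 / α) * vol α (η n) = 1 := by
    rw [vol, ← Real.rpow_add h0]; simp
  simp only [Function.comp, Pi.div_apply]
  rw [mul_div_assoc', mul_right_comm, e, one_mul, div_div, mul_comm ((n : ℝ) ^ _)]

end SaddleSequence

/-! ### The normalised number of summands: mgf bounds, limit law and tails. -/

/-- The normalised number of summands. -/
noncomputable def normalized (α η : ℝ) (S : Finset ℕ) : ℝ :=
  (numSummands S - mu α η) / √(sigmaSq α η)

lemma mgf_normalized (α η : ℝ) (n : ℕ) (t : ℝ) :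
    mgf (normalized α η) (unif α n) t
      = Real.exp (-(t / √(sigmaSq α η) * mu α η))
        * mgf numSummands (unif α n) (t / √(sigmaSq α η)) := by
  rw [mgf, mgf, ← integral_const_mul]
  congr 1
  funext S
  simp only [normalized, ← Real.exp_add]
  congr 1
  ring

lemma log_mgf_normalized {α η : ℝ} (hα : 0 < α) (hα1 : α < 1) (hσ : 0 < sigmaSq α η) {n : ℕ}
    (hn : 1 ≤ n) (t : ℝ) :
    Real.log (mgf (normalized α η) (unif α n) t) - t ^ 2 / 2
      = Real.log (mgf numSummands (unif α n) (t / √(sigmaSq α η)))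
        - (t / √(sigmaSq α η) * mu α η + (t / √(sigmaSq α η)) ^ 2 * sigmaSq α η / 2) := by
  have hpos : 0 < mgf numSummands (unif α n) (t / √(sigmaSq α η)) := by
    rw [mgf_numSummands hα]
    exact div_pos (partitionSum_pos hα hα1.le hn _) (partitionSum_pos hα hα1.le hn _)
  rw [mgf_normalized, Real.log_mul (Real.exp_pos _).ne' hpos.ne', Real.log_exp, div_pow,
    Real.sq_sqrt hσ.le]
  field_simp
  ring

lemma mgf_normalized_pos {α : ℝ} (hα : 0 < α) (hα1 : α < 1) (η : ℝ) {n : ℕ} (hn : 1 ≤ n) (t : ℝ) :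
    0 < mgf (normalized α η) (unif α n) t := by
  rw [mgf_normalized, mgf_numSummands hα]
  exact mul_pos (Real.exp_pos _)
    (div_pos (partitionSum_pos hα hα1.le hn _) (partitionSum_pos hα hα1.le hn _))

section SaddleSequence

variable {α : ℝ} {η : ℕ → ℝ}

lemma eventually_sigmaSq_pos (hα : 0 < α) (hη : ∀ n : ℕ, 1 ≤ n → IsSaddlePoint α n (η n)) :
    ∀ᶠ n in atTop, 0 < sigmaSq α (η n) := by
  filter_upwards [((tendsto_sigmaSq hα).comp (tendsto_saddle hα hη)).eventually_const_lt
    (limMoment_variance_pos hα), eventually_ge_atTop 1] with n h1 hn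
  have h0 := (hη n hn).1
  exact pos_of_mul_pos_right h1 (by positivity)

/-- The orders of magnitude of the saddle point and the variance. -/
lemma exists_vol_sigmaSq_bounds (hα : 0 < α) (hα1 : α < 1)
    (hη : ∀ n : ℕ, 1 ≤ n → IsSaddlePoint α n (η n)) :
    ∃ K : ℝ, 1 ≤ K ∧ ∀ᶠ n : ℕ in atTop, vol α (η n) ≤ K * (n : ℝ) ^ (1 / (α + 1)) ∧
      (n : ℝ) ^ (1 / (α + 1)) ≤ K * vol α (η n) ∧
      (n : ℝ) ^ (1 / (α + 1)) ≤ K ^ 2 * sigmaSq α (η n) := by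
  have hv := tendsto_vol_div hα hα1 hη
  have hA : 0 < constA (1 / α) ^ (-(1 / α / (1 / α + 1))) :=
    Real.rpow_pos_of_pos (constA_pos hα hα1) _
  set a := constA (1 / α) ^ (-(1 / α / (1 / α + 1)))
  obtain ⟨C, hC⟩ := exists_tiltBounds hα
  set K := max 1 (max (a + 1) (max (2 / a) C)) with hK
  have hK1 : 1 ≤ K := le_max_left _ _
  have hK2 : a + 1 ≤ K := (le_max_left _ _).trans (le_max_right _ _)
  have hK3 : 2 / a ≤ K := (le_max_left _ _).trans ((le_max_right _ _).trans (le_max_right _ _))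
  have hK4 : C ≤ K := (le_max_right _ _).trans ((le_max_right _ _).trans (le_max_right _ _))
  refine ⟨K, hK1, ?_⟩
  filter_upwards [hv.eventually_lt_const (lt_add_one a), hv.eventually_const_lt (half_lt_self hA),
    (tendsto_saddle hα hη).eventually hC, eventually_ge_atTop 1] with n h1 h2 h3 hn
  have hn0 : (0 : ℝ) < n := by exact_mod_cast hn
  have hW : 0 < (n : ℝ) ^ (1 / (α + 1)) := by positivity
  rw [div_lt_iff₀ hW] at h1
  rw [lt_div_iff₀ hW] at h2
  have hV : 0 < vol α (η n) := vol_pos h3.pos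
  have e1 : vol α (η n) ≤ K * (n : ℝ) ^ (1 / (α + 1)) :=
    h1.le.trans (mul_le_mul_of_nonneg_right hK2 hW.le)
  have e2 : (n : ℝ) ^ (1 / (α + 1)) ≤ K * vol α (η n) := by
    have : (n : ℝ) ^ (1 / (α + 1)) ≤ 2 / a * vol α (η n) := by
      rw [div_mul_eq_mul_div, le_div_iff₀ hA]; linarith
    exact this.trans (mul_le_mul_of_nonneg_right hK3 hV.le)
  refine ⟨e1, e2, e2.trans ?_⟩
  have hσ : 0 ≤ sigmaSq α (η n) := by
    have := h3.le_sigmaSq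
    exact (pos_of_mul_pos_right (hV.trans_le this) (by linarith [h3.one_le])).le
  calc K * vol α (η n) ≤ K * (K * sigmaSq α (η n)) := by
        refine mul_le_mul_of_nonneg_left ?_ (by linarith)
        exact h3.le_sigmaSq.trans (mul_le_mul_of_nonneg_right hK4 hσ)
    _ = _ := by ring

theorem exists_log_mgf_normalized_bound (hα : 0 < α) (hα1 : α < 1)
    (hη : ∀ n : ℕ, 1 ≤ n → IsSaddlePoint α n (η n)) :
    ∃ A : ℝ, 0 < A ∧ ∀ᶠ n : ℕ in atTop, ∀ t W : ℝ, W = (n : ℝ) ^ (1 / (α + 1)) →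
      A * |t| ≤ W ^ (3 / 16 : ℝ) →
      |Real.log (mgf (normalized α (η n)) (unif α n) t) - t ^ 2 / 2|
        ≤ A * (|t| ^ 3 * W ^ (-(1 / 2) : ℝ) + W ^ (-(1 / 4) : ℝ)) := by
  obtain ⟨A, hA0, hA⟩ := exists_log_mgf_bound hα hα1
  obtain ⟨K, hK, hbd⟩ := exists_vol_sigmaSq_bounds hα hα1 hη
  have hK0 : 0 < K := by linarith
  refine ⟨K ^ 2 + A * K ^ 4, by positivity, ?_⟩
  filter_upwards [(tendsto_saddle hα hη).eventually hA, hbd, eventually_sigmaSq_pos hα hη,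
    eventually_ge_atTop 1] with n hAn hbn hσ hn t W hWn ht
  obtain ⟨h0, hsize⟩ := (isSaddlePoint_iff hα n).1 (hη n hn)
  have hn0 : (0 : ℝ) < n := by exact_mod_cast hn
  rw [← hWn] at hbn
  have hW : 0 < W := by rw [hWn]; positivity
  have hV := vol_pos (α := α) h0
  set V := vol α (η n)
  set σ := √(sigmaSq α (η n)) with hσdef
  have hσ0 : 0 < σ := Real.sqrt_pos.2 hσ
  obtain ⟨hb1, hb2, hb3⟩ := hbn
  have hKp : ∀ p : ℝ, p ≤ 1 → K ^ p ≤ K := fun p hp => by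
    simpa using Real.rpow_le_rpow_of_exponent_le hK hp
  have hσinv : 1 / σ ≤ K * W ^ (-(1 / 2) : ℝ) := by
    have h1 : √W ≤ K * σ := by
      rw [hσdef, ← Real.sqrt_sq hK0.le, ← Real.sqrt_mul (by positivity)]
      exact Real.sqrt_le_sqrt hb3
    rw [Real.rpow_neg hW.le, ← Real.sqrt_eq_rpow, ← div_eq_mul_inv,
      div_le_div_iff₀ hσ0 (Real.sqrt_pos.2 hW)]
    linarith
  have hts : |t / σ| ≤ |t| * (K * W ^ (-(1 / 2) : ℝ)) := by
    rw [abs_div, abs_of_pos hσ0, div_eq_mul_one_div]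
    exact mul_le_mul_of_nonneg_left hσinv (abs_nonneg _)
  have hV1 : V ^ (5 / 16 : ℝ) ≤ K * W ^ (5 / 16 : ℝ) := by
    refine (Real.rpow_le_rpow hV.le hb1 (by norm_num)).trans ?_
    rw [Real.mul_rpow hK0.le hW.le]
    exact mul_le_mul_of_nonneg_right (hKp _ (by norm_num)) (by positivity)
  have hV2 : V ^ (-(1 / 4) : ℝ) ≤ K * W ^ (-(1 / 4) : ℝ) := by
    have h1 : W / K ≤ V := by rw [div_le_iff₀ hK0]; linarith
    refine (Real.rpow_le_rpow_of_nonpos (by positivity) h1 (by norm_num)).trans ?_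
    rw [Real.div_rpow hW.le hK0.le, Real.rpow_neg hK0.le, div_inv_eq_mul, mul_comm]
    exact mul_le_mul_of_nonneg_right (hKp _ (by norm_num)) (by positivity)
  -- With s = t/σ and σ of order W^{1/2}, the range |s| ≤ V^{-5/16} allows t up to order W^{1/2 -
  -- 5/16} = W^{3/16}.
  have hcond : |t / σ| * V ^ (5 / 16 : ℝ) ≤ 1 := by
    calc |t / σ| * V ^ (5 / 16 : ℝ)
        ≤ |t| * (K * W ^ (-(1 / 2) : ℝ)) * (K * W ^ (5 / 16 : ℝ)) :=
          mul_le_mul hts hV1 (by positivity) (by positivity)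
      _ = K ^ 2 * |t| * (W ^ (-(1 / 2) : ℝ) * W ^ (5 / 16 : ℝ)) := by ring
      _ = K ^ 2 * |t| / W ^ (3 / 16 : ℝ) := by
          rw [← Real.rpow_add hW, show (-(1 / 2) + 5 / 16 : ℝ) = -(3 / 16) by norm_num,
            Real.rpow_neg hW.le]
          exact (div_eq_mul_inv _ _).symm
      _ ≤ 1 := by
          rw [div_le_one (by positivity)]
          refine le_trans (mul_le_mul_of_nonneg_right ?_ (abs_nonneg _)) ht
          have : 0 ≤ A * K ^ 4 := by positivity
          linarith
  rw [log_mgf_normalized hα hα1 hσ hn]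
  refine (hAn n hn hsize _ hcond).trans ?_
  have h3 : |t / σ| ^ 3 * V ≤ K ^ 4 * (|t| ^ 3 * W ^ (-(1 / 2) : ℝ)) := by
    calc |t / σ| ^ 3 * V ≤ (|t| * (K * W ^ (-(1 / 2) : ℝ))) ^ 3 * (K * W) :=
          mul_le_mul (pow_le_pow_left₀ (abs_nonneg _) hts 3) hb1 hV.le (by positivity)
      _ = K ^ 4 * (|t| ^ 3 * (W ^ (-(1 / 2) : ℝ) * (W ^ (-(1 / 2) : ℝ) * W ^ (-(1 / 2) : ℝ)
            * W))) := by ring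
      _ = K ^ 4 * (|t| ^ 3 * W ^ (-(1 / 2) : ℝ)) := by
          have : W ^ (-(1 / 2) : ℝ) * W ^ (-(1 / 2) : ℝ) * W = 1 := by
            rw [← Real.rpow_add hW, ← Real.rpow_add_one hW.ne']; norm_num
          rw [this, mul_one]
  have h4 : V ^ (-(1 / 4) : ℝ) ≤ K ^ 4 * W ^ (-(1 / 4) : ℝ) := by
    refine hV2.trans (mul_le_mul_of_nonneg_right ?_ (by positivity))
    simpa using pow_le_pow_right₀ hK (show 1 ≤ 4 by norm_num)
  calc A * (|t / σ| ^ 3 * V + V ^ (-(1 / 4) : ℝ))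
      ≤ A * (K ^ 4 * (|t| ^ 3 * W ^ (-(1 / 2) : ℝ)) + K ^ 4 * W ^ (-(1 / 4) : ℝ)) :=
        mul_le_mul_of_nonneg_left (add_le_add h3 h4) hA0
    _ = A * K ^ 4 * (|t| ^ 3 * W ^ (-(1 / 2) : ℝ) + W ^ (-(1 / 4) : ℝ)) := by ring
    _ ≤ _ := by
        refine mul_le_mul_of_nonneg_right ?_ (by positivity)
        have : 0 ≤ K ^ 2 := by positivity
        linarith

lemma tendsto_natCast_rpow_inv (hα : 0 < α) :
    Tendsto (fun n : ℕ => (n : ℝ) ^ (1 / (α + 1))) atTop atTop :=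
  (tendsto_rpow_atTop (by positivity)).comp tendsto_natCast_atTop_atTop

theorem tendsto_mgf_normalized (hα : 0 < α) (hα1 : α < 1)
    (hη : ∀ n : ℕ, 1 ≤ n → IsSaddlePoint α n (η n)) (t : ℝ) :
    Tendsto (fun n => mgf (normalized α (η n)) (unif α n) t) atTop
      (𝓝 (Real.exp (t ^ 2 / 2))) := by
  obtain ⟨A, hA0, hA⟩ := exists_log_mgf_normalized_bound hα hα1 hη
  have hW := tendsto_natCast_rpow_inv hα
  have hsmall : Tendsto (fun n : ℕ => A * (|t| ^ 3 * ((n : ℝ) ^ (1 / (α + 1))) ^ (-(1 / 2) : ℝ)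
      + ((n : ℝ) ^ (1 / (α + 1))) ^ (-(1 / 4) : ℝ))) atTop (𝓝 0) := by
    have h1 := (tendsto_rpow_neg_atTop (y := 1 / 2) (by norm_num)).comp hW
    have h2 := (tendsto_rpow_neg_atTop (y := 1 / 4) (by norm_num)).comp hW
    simpa using ((h1.const_mul (|t| ^ 3)).add h2).const_mul A
  have hlog : Tendsto (fun n => Real.log (mgf (normalized α (η n)) (unif α n) t)) atTop
      (𝓝 (t ^ 2 / 2)) := by
    rw [tendsto_iff_norm_sub_tendsto_zero]
    refine squeeze_zero' (Eventually.of_forall fun _ => norm_nonneg _) ?_ hsmall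
    filter_upwards [hA, ((tendsto_rpow_atTop (y := 3 / 16) (by norm_num)).comp
      hW).eventually_ge_atTop (A * |t|)] with n h1 h2
    exact h1 t _ rfl h2
  refine ((Real.continuous_exp.tendsto _).comp hlog).congr' ?_
  filter_upwards [eventually_ge_atTop 1] with n hn
  exact Real.exp_log (mgf_normalized_pos hα hα1 _ hn t)

lemma exp_le_one_add_two_mul {y : ℝ} (h0 : 0 ≤ y) (h1 : y ≤ 1) : Real.exp y ≤ 1 + 2 * y := by
  have := exp_le_one_add_add_sq h0 h1
  nlinarith

/-- The moment generating function of the normalised number of summands in the range relevant for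
the tail bounds. -/
theorem exists_mgf_normalized_le (hα : 0 < α) (hα1 : α < 1)
    (hη : ∀ n : ℕ, 1 ≤ n → IsSaddlePoint α n (η n)) :
    ∃ C : ℝ, ∀ᶠ n : ℕ in atTop, ∀ t : ℝ, |t| ≤ (n : ℝ) ^ (1 / (6 * α + 6)) / Real.log n →
      mgf (normalized α (η n)) (unif α n) t
        ≤ Real.exp (t ^ 2 / 2) * (1 + C / Real.log n ^ 3) := by
  obtain ⟨A, hA0, hA⟩ := exists_log_mgf_normalized_bound hα hα1 hη
  have hW := tendsto_natCast_rpow_inv hα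
  have hlog : Tendsto (fun n : ℕ => Real.log n) atTop atTop :=
    Real.tendsto_log_atTop.comp tendsto_natCast_atTop_atTop
  have hlo : ∀ᶠ n : ℕ in atTop, Real.log n ^ 3 ≤ ((n : ℝ) ^ (1 / (α + 1))) ^ (1 / 4 : ℝ) := by
    have h1 := (isLittleO_log_rpow_rpow_atTop 3
      (show 0 < 1 / (α + 1) * (1 / 4) by positivity)).comp_tendsto
      tendsto_natCast_atTop_atTop
    filter_upwards [h1.def one_pos, eventually_ge_atTop 1] with n h2 hn
    have hn0 : (1 : ℝ) ≤ n := by exact_mod_cast hn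
    have hl := Real.log_nonneg hn0
    simp only [Function.comp, one_mul] at h2
    rw [Real.norm_of_nonneg (by positivity), Real.norm_of_nonneg (by positivity)] at h2
    rw [← Real.rpow_mul (by positivity)]
    exact_mod_cast h2
  refine ⟨4 * A, ?_⟩
  filter_upwards [hA, hlo, hlog.eventually_ge_atTop 1, hlog.eventually_ge_atTop (2 * A),
    eventually_ge_atTop 1, ((tendsto_rpow_atTop (y := 1 / 48) (by norm_num)).comp
      hW).eventually_ge_atTop A] with n h1 h2 h3 h4 hn h5 t ht
  have hn0 : (0 : ℝ) < n := by exact_mod_cast hn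
  set L := Real.log n
  have hT : (n : ℝ) ^ (1 / (6 * α + 6)) = ((n : ℝ) ^ (1 / (α + 1))) ^ (1 / 6 : ℝ) := by
    rw [← Real.rpow_mul hn0.le]; congr 1; field_simp
  rw [hT] at ht
  have h6 := h1 t _ rfl
  simp only [Function.comp] at h5
  have hW0 : 0 < (n : ℝ) ^ (1 / (α + 1)) := by positivity
  set W := (n : ℝ) ^ (1 / (α + 1))
  have hL0 : 0 < L := by linarith
  -- T_n is W^{1/6}/log n, and 3/16 = 1/6 + 1/48 leaves W^{1/48} to absorb the constant A. The power
  -- 1/6 is exactly what makes |t|³W^{-1/2} at most (log n)^{-3}.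
  have hcond : A * |t| ≤ W ^ (3 / 16 : ℝ) := by
    have e : W ^ (3 / 16 : ℝ) = W ^ (1 / 48 : ℝ) * W ^ (1 / 6 : ℝ) := by
      rw [← Real.rpow_add hW0]; norm_num
    rw [e]
    refine mul_le_mul h5 (ht.trans (div_le_self (by positivity) h3)) (abs_nonneg _) (by positivity)
  have h7 : |t| ^ 3 * W ^ (-(1 / 2) : ℝ) ≤ 1 / L ^ 3 := by
    calc |t| ^ 3 * W ^ (-(1 / 2) : ℝ) ≤ (W ^ (1 / 6 : ℝ) / L) ^ 3 * W ^ (-(1 / 2) : ℝ) :=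
          mul_le_mul_of_nonneg_right (pow_le_pow_left₀ (abs_nonneg _) ht 3) (by positivity)
      _ = W ^ (1 / 6 * (3 : ℕ) : ℝ) * W ^ (-(1 / 2) : ℝ) / L ^ 3 := by
          rw [div_pow, ← Real.rpow_mul_natCast hW0.le]; ring
      _ = 1 / L ^ 3 := by rw [← Real.rpow_add hW0]; norm_num
  have h8 : W ^ (-(1 / 4) : ℝ) ≤ 1 / L ^ 3 := by
    rw [Real.rpow_neg hW0.le, ← one_div]
    exact one_div_le_one_div_of_le (by positivity) h2
  have h9 : Real.log (mgf (normalized α (η n)) (unif α n) t) - t ^ 2 / 2 ≤ 2 * A / L ^ 3 := by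
    refine (le_abs_self _).trans ((h6 hcond).trans ?_)
    calc _ ≤ A * (1 / L ^ 3 + 1 / L ^ 3) := mul_le_mul_of_nonneg_left (add_le_add h7 h8) hA0.le
      _ = _ := by ring
  rw [← Real.exp_log (mgf_normalized_pos hα hα1 (η n) hn t)]
  calc Real.exp (Real.log (mgf (normalized α (η n)) (unif α n) t))
      ≤ Real.exp (t ^ 2 / 2 + 2 * A / L ^ 3) := Real.exp_le_exp.2 (by linarith)
    _ = Real.exp (t ^ 2 / 2) * Real.exp (2 * A / L ^ 3) := Real.exp_add _ _
    _ ≤ _ := by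
        refine mul_le_mul_of_nonneg_left ?_ (Real.exp_pos _).le
        have hle : 2 * A / L ^ 3 ≤ 1 := by
          rw [div_le_one (by positivity)]
          exact h4.trans (by simpa using pow_le_pow_right₀ h3 (show 1 ≤ 3 by norm_num))
        refine (exp_le_one_add_two_mul (by positivity) hle).trans (le_of_eq ?_)
        ring

lemma integral_normalized (hα : 0 < α) (hα1 : α < 1) {η : ℝ} (hσ : 0 < sigmaSq α η) {n : ℕ}
    (hn : 1 ≤ n) : ∫ S, numSummands S ∂(unif α n)
      = mu α η + √(sigmaSq α η) * ∫ S, normalized α η S ∂(unif α n) := by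
  have := isProbabilityMeasure_unif hα hα1.le hn
  have hσ0 := (Real.sqrt_pos.2 hσ).ne'
  rw [← integral_const_mul]
  have e : ∫ S, √(sigmaSq α η) * normalized α η S ∂(unif α n)
      = ∫ S, (numSummands S - mu α η) ∂(unif α n) := by
    congr 1
    funext S
    rw [normalized]; field_simp
  rw [e, integral_sub (integrable_unif hα n _) (integrable_const _)]
  simp

lemma variance_normalized (hα : 0 < α) (hα1 : α < 1) {η : ℝ} (hσ : 0 < sigmaSq α η) {n : ℕ}
    (hn : 1 ≤ n) : variance numSummands (unif α n)
      = sigmaSq α η * variance (normalized α η) (unif α n) := by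
  have := isProbabilityMeasure_unif hα hα1.le hn
  have hσ0 := (Real.sqrt_pos.2 hσ).ne'
  have e : numSummands = fun S => √(sigmaSq α η) * normalized α η S + mu α η := by
    funext S
    rw [normalized]; field_simp; ring
  conv_lhs => rw [e]
  rw [variance_add_const ((integrable_unif hα n _).1), variance_const_mul, Real.sq_sqrt hσ.le]

end SaddleSequence

section SaddleSequence

variable {α : ℝ} {η : ℕ → ℝ}

lemma integrable_exp_normalized (hα : 0 < α) (n : ℕ) (t : ℝ) :
    Integrable (fun S => Real.exp (t * normalized α (η n) S)) (unif α n) :=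
  integrable_unif hα n _

/-- The mean is μ + σ·E(normalised) with the last expectation tending to 0, and σ/μ tends to 0
because σ² and μ have the same order while μ tends to infinity. -/
theorem integral_numSummands_isEquivalent (hα : 0 < α) (hα1 : α < 1)
    (hη : ∀ n : ℕ, 1 ≤ n → IsSaddlePoint α n (η n)) :
    (fun n : ℕ => ∫ S, numSummands S ∂(unif α n)) ~[atTop] (fun n => mu α (η n)) := by
  -- The limit lemmas require a probability measure at every index, so the sequence is shifted by
  -- one to start at n = 1.
  have := fun n : ℕ => isProbabilityMeasure_unif hα hα1.le (Nat.succ_pos n)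
  have h0 : Tendsto (fun n => ∫ S, normalized α (η n) S ∂(unif α n)) atTop (𝓝 0) := by
    rw [← tendsto_add_atTop_iff_nat 1]
    exact tendsto_integral_of_tendsto_mgf (fun n t => integrable_exp_normalized hα (n + 1) t)
      fun t => (tendsto_add_atTop_iff_nat 1).2 (tendsto_mgf_normalized hα hα1 hη t)
  have hs := tendsto_saddle hα hη
  have hratio : Tendsto (fun n => sigmaSq α (η n) / mu α (η n)) atTop
      (𝓝 ((limMoment α 0 - limMoment α 1 ^ 2 / limMoment α 2)
        / (-(1 / α) * polylog (1 / α) (-1) * Real.Gamma (1 / α)))) := by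
    refine (((tendsto_sigmaSq hα).comp hs).div ((tendsto_mu hα).comp hs)
      (mu_constant_pos hα hα1).ne').congr' ?_
    filter_upwards [eventually_ge_atTop 1] with n hn
    have h1 := (hη n hn).1
    exact mul_div_mul_left _ _ (Real.rpow_pos_of_pos h1 _).ne'
  have hmu : Tendsto (fun n => mu α (η n)) atTop atTop := by
    have hc := mu_constant_pos hα hα1
    refine (isEquivalent_of_tendsto_rpow_mul hα hα1 hη hc.ne' (tendsto_mu hα)).symm.tendsto_atTop ?_
    exact (tendsto_natCast_rpow_inv hα).const_mul_atTop
      (mul_pos hc (Real.rpow_pos_of_pos (constA_pos hα hα1) _))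
  have hsq : Tendsto (fun n => √(sigmaSq α (η n)) / mu α (η n)) atTop (𝓝 0) := by
    have h2 := (hratio.mul (tendsto_inv_atTop_zero.comp hmu)).sqrt
    rw [mul_zero, Real.sqrt_zero] at h2
    refine h2.congr' ?_
    filter_upwards [hmu.eventually_gt_atTop 0, eventually_sigmaSq_pos hα hη] with n h3 h4
    simp only [Function.comp]
    rw [← div_eq_mul_inv, div_div, Real.sqrt_div h4.le, Real.sqrt_mul_self h3.le]
  have hne : ∀ᶠ n in atTop, mu α (η n) ≠ 0 := by
    filter_upwards [hmu.eventually_gt_atTop 0] with n h using h.ne'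
  refine (isEquivalent_iff_tendsto_one hne).2 ?_
  have h5 := (hsq.mul h0).const_add 1
  rw [zero_mul, add_zero] at h5
  refine h5.congr' ?_
  filter_upwards [hne, eventually_sigmaSq_pos hα hη, eventually_ge_atTop 1] with n h6 h7 hn
  rw [Pi.div_apply, integral_normalized hα hα1 h7 hn]
  field_simp

theorem variance_numSummands_isEquivalent (hα : 0 < α) (hα1 : α < 1)
    (hη : ∀ n : ℕ, 1 ≤ n → IsSaddlePoint α n (η n)) :
    (fun n : ℕ => variance numSummands (unif α n)) ~[atTop] (fun n => sigmaSq α (η n)) := by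
  have := fun n : ℕ => isProbabilityMeasure_unif hα hα1.le (Nat.succ_pos n)
  have h0 : Tendsto (fun n => variance (normalized α (η n)) (unif α n)) atTop (𝓝 1) := by
    rw [← tendsto_add_atTop_iff_nat 1]
    exact tendsto_variance_of_tendsto_mgf (fun n t => integrable_exp_normalized hα (n + 1) t)
      fun t => (tendsto_add_atTop_iff_nat 1).2 (tendsto_mgf_normalized hα hα1 hη t)
  have hpos := eventually_sigmaSq_pos hα hη
  refine (isEquivalent_iff_tendsto_one (hpos.mono fun n h => h.ne')).2 (h0.congr' ?_)
  filter_upwards [hpos, eventually_ge_atTop 1] with n h7 hn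
  rw [Pi.div_apply, variance_normalized hα hα1 h7 hn, mul_div_cancel_left₀ _ h7.ne']

theorem tendstoUniformly_normalized (hα : 0 < α) (hα1 : α < 1)
    (hη : ∀ n : ℕ, 1 ≤ n → IsSaddlePoint α n (η n)) :
    TendstoUniformly (fun (n : ℕ) (x : ℝ) => (unif α n).real {S | normalized α (η n) S < x})
      Φ atTop := by
  have := fun n : ℕ => isProbabilityMeasure_unif hα hα1.le (Nat.succ_pos n)
  have h := tendstoUniformly_Φ (P := fun n => unif α (n + 1))
    (X := fun n => normalized α (η (n + 1)))
    (fun n t => integrable_exp_normalized hα (n + 1) t)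
    fun t => (tendsto_add_atTop_iff_nat 1).2 (tendsto_mgf_normalized hα hα1 hη t)
  rw [Metric.tendstoUniformly_iff] at h ⊢
  intro ε hε
  obtain ⟨N, hN⟩ := eventually_atTop.1 (h ε hε)
  filter_upwards [eventually_ge_atTop (N + 1)] with n hn x
  obtain ⟨m, rfl⟩ : ∃ m, n = m + 1 := ⟨n - 1, by omega⟩
  exact hN m (by omega) x

lemma exp_neg_mul_mul_le {T x y B : ℝ} (hB : 0 ≤ B) (hy : y ≤ Real.exp (T ^ 2 / 2) * B)
    {e : ℝ} (he : T ^ 2 / 2 - T * x ≤ e) : Real.exp (-T * x) * y ≤ Real.exp e * B := by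
  calc Real.exp (-T * x) * y ≤ Real.exp (-T * x) * (Real.exp (T ^ 2 / 2) * B) :=
        mul_le_mul_of_nonneg_left hy (Real.exp_pos _).le
    _ = Real.exp (T ^ 2 / 2 - T * x) * B := by
        rw [← mul_assoc, ← Real.exp_add]; congr 2; ring
    _ ≤ _ := mul_le_mul_of_nonneg_right (Real.exp_le_exp.2 he) hB

/-- Chernoff bounds for both tails of the normalised number of summands. -/
lemma tail_le (hα : 0 < α) (hα1 : α < 1) {η : ℝ} {n : ℕ} (hn : 1 ≤ n) {T x e B : ℝ} (hT : 0 ≤ T)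
    (hm : ∀ t, |t| ≤ T → mgf (normalized α η) (unif α n) t ≤ Real.exp (t ^ 2 / 2) * B)
    (he : T ^ 2 / 2 - T * x ≤ e) :
    (unif α n).real {S | normalized α η S ≥ x} ≤ Real.exp e * B ∧
      (unif α n).real {S | normalized α η S ≤ -x} ≤ Real.exp e * B := by
  have := isProbabilityMeasure_unif hα hα1.le hn
  have hB : 0 ≤ B :=
    (pos_of_mul_pos_right ((mgf_normalized_pos hα hα1 η hn T).trans_le
      (hm T (abs_of_nonneg hT).le)) (Real.exp_pos _).le).le
  have hm' := hm (-T) (by rw [abs_neg, abs_of_nonneg hT])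
  rw [neg_sq] at hm'
  refine ⟨(measure_ge_le_exp_mul_mgf x hT (integrable_unif hα n _)).trans
    (exp_neg_mul_mul_le hB (hm T (abs_of_nonneg hT).le) he),
    (measure_le_le_exp_mul_mgf (-x) (neg_nonpos.2 hT) (integrable_unif hα n _)).trans ?_⟩
  rw [neg_mul_neg]
  exact exp_neg_mul_mul_le hB hm' he

end SaddleSequence

end AlphaPartition

open AlphaPartition in
theorem theorem1 (α : ℝ) (hα0 : 0 < α) (hα1 : α < 1) :
    -- the saddle point exists and is unique
    (∀ n : ℕ, 1 ≤ n → ∃! η : ℝ, IsSaddlePoint α n η) ∧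
    ∀ η : ℕ → ℝ, (∀ n : ℕ, 1 ≤ n → IsSaddlePoint α n (η n)) →
      -- mean and variance of the number of summands
      (fun n : ℕ => ∫ S, numSummands S ∂(unif α n)) ~[atTop] (fun n => mu α (η n)) ∧
      (fun n : ℕ => variance numSummands (unif α n)) ~[atTop] (fun n => sigmaSq α (η n)) ∧
      -- central limit theorem, uniformly in `x`
      TendstoUniformly
        (fun (n : ℕ) (x : ℝ) =>
          (unif α n).real {S | (numSummands S - mu α (η n)) / √(sigmaSq α (η n)) < x})
        Φ atTop ∧
      -- asymptotics of `μ_n` and `σ_n²`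
      (fun n : ℕ => mu α (η n)) ~[atTop]
        (fun n => c₁ (1 / α) * (n : ℝ) ^ (1 / (α + 1))) ∧
      (fun n : ℕ => sigmaSq α (η n)) ~[atTop]
        (fun n => c₂ (1 / α) * (n : ℝ) ^ (1 / (α + 1))) ∧
      -- upper and lower tails
      ∃ C : ℝ, ∃ N : ℕ, ∀ n : ℕ, N ≤ n → ∀ x : ℝ,
        (0 ≤ x → x ≤ (n : ℝ) ^ (1 / (6 * α + 6)) / Real.log n →
          (unif α n).real {S | (numSummands S - mu α (η n)) / √(sigmaSq α (η n)) ≥ x}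
              ≤ Real.exp (-x ^ 2 / 2) * (1 + C / Real.log n ^ 3) ∧
          (unif α n).real {S | (numSummands S - mu α (η n)) / √(sigmaSq α (η n)) ≤ -x}
              ≤ Real.exp (-x ^ 2 / 2) * (1 + C / Real.log n ^ 3)) ∧
        ((n : ℝ) ^ (1 / (6 * α + 6)) / Real.log n ≤ x →
          (unif α n).real {S | (numSummands S - mu α (η n)) / √(sigmaSq α (η n)) ≥ x}
              ≤ Real.exp (-((n : ℝ) ^ (1 / (6 * α + 6)) / Real.log n) * x / 2)
                  * (1 + C / Real.log n ^ 3) ∧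
          (unif α n).real {S | (numSummands S - mu α (η n)) / √(sigmaSq α (η n)) ≤ -x}
              ≤ Real.exp (-((n : ℝ) ^ (1 / (6 * α + 6)) / Real.log n) * x / 2)
                  * (1 + C / Real.log n ^ 3)) := by
  refine ⟨fun n hn => existsUnique_isSaddlePoint hα0 hα1 hn, fun η hη =>
    ⟨integral_numSummands_isEquivalent hα0 hα1 hη, variance_numSummands_isEquivalent hα0 hα1 hη,
      tendstoUniformly_normalized hα0 hα1 hη, ?_, ?_, ?_⟩⟩
  · rw [c₁_eq]
    exact isEquivalent_of_tendsto_rpow_mul hα0 hα1 hη (mu_constant_pos hα0 hα1).ne'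
      (tendsto_mu hα0)
  · rw [c₂_eq hα0 hα1]
    exact isEquivalent_of_tendsto_rpow_mul hα0 hα1 hη (limMoment_variance_pos hα0).ne'
      (tendsto_sigmaSq hα0)
  · obtain ⟨C, hC⟩ := exists_mgf_normalized_le hα0 hα1 hη
    obtain ⟨N, hN⟩ := eventually_atTop.1 hC
    refine ⟨C, max N 1, fun n hn x => ?_⟩
    have hn1 : 1 ≤ n := (le_max_right _ _).trans hn
    have hm := hN n ((le_max_left _ _).trans hn)
    have hT : 0 ≤ (n : ℝ) ^ (1 / (6 * α + 6)) / Real.log n :=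
      div_nonneg (by positivity) (Real.log_nonneg (by exact_mod_cast hn1))
    -- Chernoff at the optimal t = x gives x²/2 - x² = -x²/2. For x ≥ T_n the largest admissible t =
    -- T_n is used, and T_n²/2 - T_n x ≤ -T_n x/2.
    exact ⟨fun h0 hx => tail_le hα0 hα1 hn1 h0 (fun t ht => hm t (ht.trans hx)) (by linarith),
      fun hx => tail_le hα0 hα1 hn1 hT hm (by nlinarith)⟩
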